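/- A *black graph* $B$ is a finite connected plane graph (multiple edges and loops allowed) each of whose edges has height $0$ or $1$; it encodes a link projection $\mathcal D$ whose crossings are the edges of $B$. For a spanning tree $T$ of $B$ let the total height be the number of edges of height $1$ in $T$ plus the number of edges of height $0$ not in $T$. Choose a base vertex $b$, and let $F$ be the field of rational functions over $\mathbb F_2$ in one variable for each vertex other than $b$ and one variable for each bounded face of $B$. The *unshifted BOS complex* $\mathcal C_0(\mathcal D)$ has in degree $i\in\frac12\mathbb Z$ the free $F$-module on the spanning trees of total height $2i$. Its differential $\Psi$, of degree $+1$, has a possibly non-zero coefficient from $T$ to $T'$ only if $T'=(T\smallsetminus\{e\})\cup\{f\}$ with an edge $e\in T$ of height $0$ and an edge $f\notin T$ of height $1$, and this coefficient is $$\frac1{1+\alpha}+\frac1{1+\beta}.$$ Here $\beta$ is the product of the variables of the vertices in the component of $T\smallsetminus\{e\}$ that does not contain $b$; and, with $c$ the cycle in $T\cup\{f\}$, $\alpha$ is the product of the variables of the faces enclosed by $c$ if $e$, $f$ and the base point occur in this order counter-clockwise on $c$, and the product of the inverses of these variables otherwise. (If $b$ is not on $c$, the base point is placed at the vertex of $c$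 where the path in $T$ from $b$ meets $c$.) For $k\ge 0$ let $B_{(3,3,k)}$ be the black graph that consists of a circle subdivided into $6+k$ edges of height $0$ and a central vertex joined to the circle by three edges $e_0,e_1,e_2$ of height $1$, such that, counter-clockwise, there are $3$ edges of the circle between the outer ends of $e_0$ and $e_1$, $3$ between those of $e_1$ and $e_2$, and $k$ between those of $e_2$ and $e_0$ (for $k=0$ the edges $e_2$ and $e_0$ are parallel, and bound a face). Let $\mathcal D_{(3,3,k)}$ be the corresponding link projection. **Proposition.** For every $k\ge 0$ and every choice of the base vertex, $\Psi\circ\Psi=0$ on $\mathcal C_0(\mathcal D_{(3,3,k)})$, and $$\operatorname{rank}_F H^i(\mathcal C_0(\mathcal D_{(3,3,k)}))=\begin{cases}1&\text{for } i=1,2,\\ 0&\text{for all other } i\in\tfrac12\mathbb Z.\end{cases}$$ -/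

import Mathlib

noncomputable section

namespace BOS

/-- A dart is an edge with one of its two directions; `rev` reverses the direction. -/
def rev {E : Type} (d : E × Bool) : E × Bool := (d.1, !d.2)

/-- `Linked p S x y`: one can go from `x` to `y` in finitely many steps, each of which leads along
an edge `e ∈ S` from the point `p d` to the point `p (rev d)`, where `d` is a dart of `e`.
With `p d` the starting vertex of `d` this is a walk in the graph with the edges `S`; with `p d` the
face to the left of `d` it is a walk in the plane that crosses only edges of `S`. -/
def Linked {E X : Type} (p : E × Bool → X) (S : Set E) : X → X → Prop :=
  Relation.ReflTransGen fun x y => ∃ d : E × Bool, d.1 ∈ S ∧ p d = x ∧ p (rev d) = y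

/-- A finite connected plane graph (multiple edges and loops are allowed), given as a combinatorial
map of genus zero with a distinguished unbounded face. -/
structure PlaneGraph where
  /-- vertices -/
  V : Type
  /-- edges -/
  E : Type
  /-- faces -/
  F : Type
  [fintypeV : Fintype V]
  [fintypeE : Fintype E]
  [fintypeF : Fintype F]
  [decEqV : DecidableEq V]
  [decEqE : DecidableEq E]
  [decEqF : DecidableEq F]
  /-- the vertex at which a dart starts -/
  src : E × Bool → V
  /-- the face to the left of a dart -/
  left : E × Bool → F
  /-- the unbounded face -/
  outer : F
  /-- the dart that follows `d` on the boundary of the face to the left of `d`; accordingly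
  `next (rev d)` is the dart that follows `d` in the clockwise order around `src d` -/
  next : E × Bool → E × Bool
  /-- the faces are the orbits of `next` -/
  face_iff : ∀ d d', left d = left d' ↔ ∃ n : ℕ, next^[n] d = d'
  /-- the vertices are the orbits of the clockwise rotation -/
  vertex_iff : ∀ d d', src d = src d' ↔ ∃ n : ℕ, (fun x => next (rev x))^[n] d = d'
  left_surjective : ∀ φ, IsEmpty E ∨ ∃ d, left d = φ
  connected : ∀ u v, Linked src Set.univ u v
  /-- Euler's formula: the map has genus zero -/
  euler : Fintype.card V + Fintype.card F = Fintype.card E + 2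

attribute [instance] PlaneGraph.fintypeV PlaneGraph.fintypeE PlaneGraph.fintypeF
  PlaneGraph.decEqV PlaneGraph.decEqE PlaneGraph.decEqF

/-- A black graph: a plane graph whose edges (the crossings of the link projection) have heights
`0` or `1`. Such a graph determines the link projection. -/
structure BlackGraph extends PlaneGraph where
  height : E → Fin 2

namespace BlackGraph

variable (B : BlackGraph)

/-- Spanning trees, as sets of edges: connected, with one edge less than there are vertices. -/
def IsSpanningTree (T : Finset B.E) : Prop :=
  (∀ u v, Linked B.src (T : Set B.E) u v) ∧ T.card + 1 = Fintype.card B.V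

/-- The number of edges of height `1` in `T` plus the number of edges of height `0` not in `T`. -/
def totalHeight (T : Finset B.E) : ℕ :=
  (T.filter fun e => B.height e = 1).card + (Tᶜ.filter fun e => B.height e = 0).card

/-- The spanning trees of degree `i`, i.e. of total height `2 i`. -/
def Tree (i : ℚ) : Type :=
  {T : Finset B.E // B.IsSpanningTree T ∧ (B.totalHeight T : ℚ) = 2 * i}

open Classical in
instance (i : ℚ) : Fintype (B.Tree i) :=
  inferInstanceAs (Fintype {T : Finset B.E //
    B.IsSpanningTree T ∧ (B.totalHeight T : ℚ) = 2 * i})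

/-- The field of rational functions over the field with two elements, in variables for the vertices
other than the base point `b` and for the bounded faces. -/
abbrev K (b : B.V) : Type :=
  FractionRing (MvPolynomial ({v : B.V // v ≠ b} ⊕ {φ : B.F // φ ≠ B.outer}) (ZMod 2))

/-- The variable of a vertex other than the base point. -/
def vertexVar (b : B.V) (v : {v : B.V // v ≠ b}) : B.K b :=
  algebraMap (MvPolynomial ({v : B.V // v ≠ b} ⊕ {φ : B.F // φ ≠ B.outer}) (ZMod 2))
    (B.K b) (MvPolynomial.X (Sum.inl v))

/-- The variable of a bounded face. -/
def faceVar (b : B.V) (φ : {φ : B.F // φ ≠ B.outer}) : B.K b :=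
  algebraMap (MvPolynomial ({v : B.V // v ≠ b} ⊕ {φ : B.F // φ ≠ B.outer}) (ZMod 2))
    (B.K b) (MvPolynomial.X (Sum.inr φ))

/-- The edges of the cycle in `T ∪ {f}`: the edges whose removal leaves their ends linked. -/
def cycle (T : Finset B.E) (f : B.E) : Set B.E :=
  {g | g ∈ insert f T ∧
    Linked B.src (((insert f T).erase g : Finset B.E) : Set B.E) (B.src (g, true)) (B.src (g, false))}

/-- The face `φ` is enclosed inside the cycle with the set of edges `c`: one cannot get there from
the unbounded face without crossing `c`. -/
def Enclosed (c : Set B.E) (φ : B.F) : Prop := ¬ Linked B.left cᶜ B.outer φ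

/-- The edges `e`, `f` and the base point `b` occur in this order counter-clockwise on the cycle in
`T ∪ {f}`, which contains `e`. The dart `(e, s)` is the counter-clockwise one, i.e. it has the inside
of the cycle to its left. Its end point is where the counter-clockwise arc from `e` to `f` begins;
the point of the cycle at which `b` is attached (`b` itself, if it lies on the cycle) is not on this
arc if and only if this end point and `b` are in different components of `T ∖ {e}`. -/
def CounterClockwise (T : Finset B.E) (e f : B.E) (b : B.V) : Prop :=
  ∃ s : Bool, B.Enclosed (B.cycle T f) (B.left (e, s)) ∧
    ¬ Linked B.src ((T.erase e : Finset B.E) : Set B.E) (B.src (rev (e, s))) b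

open Classical in
/-- The product of the variables of the faces enclosed inside the cycle in `T ∪ {f}`, or of their
inverses, according to the orientation. -/
def alpha (b : B.V) (T : Finset B.E) (e f : B.E) : B.K b :=
  ∏ φ : {φ : B.F // φ ≠ B.outer},
    if B.Enclosed (B.cycle T f) φ then
      (if B.CounterClockwise T e f b then B.faceVar b φ else (B.faceVar b φ)⁻¹)
    else 1

open Classical in
/-- The product of the variables of the vertices in the component of `T ∖ {e}` without `b`. -/
def beta (b : B.V) (T : Finset B.E) (e : B.E) : B.K b :=
  ∏ v : {v : B.V // v ≠ b},
    if Linked B.src ((T.erase e : Finset B.E) : Set B.E) v b then 1 else B.vertexVar b v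

open Classical in
/-- The coefficient of `Ψ` from `T` to `T'`. It is non-trivial only if `T'` arises from `T` by removing
an edge `e` of height `0` and adding an edge `f` of height `1`; the sum then has only one term that
is not zero, since `T` and `T'` determine `e` and `f`. -/
def coeff (b : B.V) (T T' : Finset B.E) : B.K b :=
  ∑ e : B.E, ∑ f : B.E,
    if e ∈ T ∧ B.height e = 0 ∧ f ∉ T ∧ B.height f = 1 ∧ T' = insert f (T.erase e) then
      1 / (1 + B.alpha b T e f) + 1 / (1 + B.beta b T e)
    else 0

/-- The degree `i` part of the complex: the free module on the (finitely many) spanning trees of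
degree `i`. -/
abbrev C (b : B.V) (i : ℚ) : Type := B.Tree i → B.K b

/-- The part of the differential `Ψ` that leads from degree `i` to degree `j`. Since `Ψ` raises the
degree by `1`, it is of interest for `j = i + 1` only. -/
def Psi (b : B.V) (i j : ℚ) : B.C b i →ₗ[B.K b] B.C b j :=
  Matrix.mulVecLin (Matrix.of fun (T' : B.Tree j) (T : B.Tree i) => B.coeff b T.1 T'.1)

/-- The cohomology in degree `i`: the kernel of `Ψ` modulo the image of `Ψ`. -/
abbrev H (b : B.V) (i : ℚ) : Type :=
  LinearMap.ker (B.Psi b i (i + 1)) ⧸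
    (LinearMap.range (B.Psi b (i - 1) i)).comap (LinearMap.ker (B.Psi b i (i + 1))).subtype

end BlackGraph

/-! ### The black graphs of the family

The graph with the parameters `p, q, r` is a circle with `p + q + r` edges, drawn around a central
vertex which is joined to the circle by three spokes; the spokes cut the disk into sectors that have
`p`, `q` and `r` edges of the circle, in counter-clockwise order. -/

namespace Wheel

/-- The edges: the spokes `0, 1, 2` and the edges of the circle, both in counter-clockwise order. -/
abbrev Edge (p q r : ℕ) : Type := Fin 3 ⊕ Fin (p + q + r)

/-- The sector `i`, between the spokes `i` and `i + 1`, has the edges `j` of the circle with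
`start i ≤ j < finish i`. -/
def start (p q : ℕ) : Fin 3 → ℕ := ![0, p, p + q]

/-- See `start`. -/
def finish (p q r : ℕ) : Fin 3 → ℕ := ![p, p + q, p + q + r]

/-- The sector in which the edge `j` of the circle lies. -/
def sector (p q : ℕ) (j : ℕ) : Fin 3 := if j < p then 0 else if j < p + q then 1 else 2

/-- Reduction modulo the length of the circle. -/
def wrap {N : ℕ} (h : 0 < N) (j : ℕ) : Fin N := ⟨j % N, Nat.mod_lt j h⟩

variable {p q r : ℕ} (h : 0 < p + q + r)

/-- The starting points of darts. The vertices are the centre `none` and the vertices `some j` of the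
circle. The edge `j` of the circle leads from `j` to `j + 1`, and the spoke `i` leads from the centre
to the vertex `start i`. -/
def src : Edge p q r × Bool → Option (Fin (p + q + r))
  | (Sum.inl _, true) => none
  | (Sum.inl i, false) => some (wrap h (start p q i))
  | (Sum.inr j, true) => some j
  | (Sum.inr j, false) => some (wrap h (j + 1))

/-- The faces to the left of darts. The faces are the three sectors and the unbounded face `none`. -/
def left : Edge p q r × Bool → Option (Fin 3)
  | (Sum.inl i, true) => some i
  | (Sum.inl i, false) => some (i - 1)
  | (Sum.inr j, true) => some (sector p q j)
  | (Sum.inr _, false) => none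

/-- The boundary of the sector `i` runs along the spoke `i` outwards, then along edges of the circle
and then along the spoke `i + 1` inwards. -/
def next : Edge p q r × Bool → Edge p q r × Bool
  | (Sum.inl i, true) =>
      if start p q i < finish p q r i then (Sum.inr (wrap h (start p q i)), true)
      else (Sum.inl (i + 1), false)
  | (Sum.inl i, false) => (Sum.inl (i - 1), true)
  | (Sum.inr j, true) =>
      if j + 1 < finish p q r (sector p q j) then (Sum.inr (wrap h (j + 1)), true)
      else (Sum.inl (sector p q j + 1), false)
  | (Sum.inr j, false) => (Sum.inr (wrap h (j + (p + q + r - 1))), false)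

/-- `b` is obtained from `a` by iterating `f`. -/
def Reach {X : Type} (f : X → X) (a b : X) : Prop := ∃ n : ℕ, f^[n] a = b

theorem Reach.refl {X : Type} (f : X → X) (a : X) : Reach f a a := ⟨0, rfl⟩

theorem Reach.head {X : Type} {f : X → X} {a b : X} (hab : Reach f (f a) b) : Reach f a b := by
  obtain ⟨n, hn⟩ := hab
  exact ⟨n + 1, hn⟩

theorem Reach.trans {X : Type} {f : X → X} {a b c : X} (hab : Reach f a b) (hbc : Reach f b c) :
    Reach f a c := by
  obtain ⟨n, rfl⟩ := hab
  obtain ⟨m, rfl⟩ := hbc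
  exact ⟨m + n, Function.iterate_add_apply f m n a⟩

theorem Reach.symm {X : Type} [Finite X] {f : X → X} (hf : Function.Injective f) {a b : X}
    (hab : Reach f a b) : Reach f b a := by
  obtain ⟨n, rfl⟩ := hab
  obtain ⟨m, hm, hp⟩ := hf.mem_periodicPts a
  refine ⟨m * n - n, ?_⟩
  rw [← Function.iterate_add_apply, Nat.sub_add_cancel (Nat.le_mul_of_pos_left n hm)]
  exact hp.mul_const n

theorem reach_iff {X Y : Type} [Finite X] {f : X → X} (hf : Function.Injective f) (g : X → Y)
    (hg : ∀ x, g (f x) = g x) (c : Y → X) (hc : ∀ x, Reach f x (c (g x))) (x y : X) :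
    g x = g y ↔ ∃ n : ℕ, f^[n] x = y := by
  constructor
  · intro hxy
    exact (hc x).trans (hxy ▸ (hc y).symm hf)
  · rintro ⟨n, rfl⟩
    induction n generalizing x with
    | zero => rfl
    | succ n ih => rw [Function.iterate_succ_apply, ← ih, hg]

theorem wrap_of_lt {N : ℕ} (h : 0 < N) {j : ℕ} (hj : j < N) : wrap h j = ⟨j, hj⟩ :=
  Fin.ext (Nat.mod_eq_of_lt hj)

theorem rev_injective {E : Type} : Function.Injective (rev : E × Bool → E × Bool) := by
  rintro ⟨a, _ | _⟩ ⟨b, _ | _⟩ hab <;> simp_all [rev]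

theorem sector_eq {i : Fin 3} {j : ℕ} (h1 : start p q i ≤ j) (h2 : j < finish p q r i) :
    sector p q j = i := by
  fin_cases i <;> simp [start, finish, sector] at * <;> grind

theorem start_sector_le (j : ℕ) : start p q (sector p q j) ≤ j := by
  unfold sector; split_ifs <;> simp [start] <;> omega

theorem lt_finish_sector {j : ℕ} (hj : j < p + q + r) : j < finish p q r (sector p q j) := by
  unfold sector; split_ifs <;> simp [finish] <;> omega

theorem finish_le (i : Fin 3) : finish p q r i ≤ p + q + r := by
  fin_cases i <;> simp [finish] <;> omega

theorem start_le_finish (i : Fin 3) : start p q i ≤ finish p q r i := by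
  fin_cases i <;> simp [start, finish]

theorem wrap_finish (i : Fin 3) : wrap h (finish p q r i) = wrap h (start p q (i + 1)) := by
  fin_cases i <;> simp [start, finish, wrap]

theorem pred_mod {N j : ℕ} (hj : j < N) : (j + (N - 1)) % N = if j = 0 then N - 1 else j - 1 := by
  split_ifs with h0
  · subst h0; rw [Nat.mod_eq_of_lt (by omega)]; omega
  · rw [show j + (N - 1) = (j - 1) + N by omega, Nat.add_mod_right, Nat.mod_eq_of_lt (by omega)]

theorem succ_mod {N j : ℕ} (hj : j < N) : (j + 1) % N = if j + 1 = N then 0 else j + 1 := by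
  split_ifs with h0
  · rw [h0, Nat.mod_self]
  · exact Nat.mod_eq_of_lt (by omega)

/-- The inverse of `next`. -/
def prev : Edge p q r × Bool → Edge p q r × Bool
  | (Sum.inl i, true) => (Sum.inl (i + 1), false)
  | (Sum.inl i, false) =>
      if start p q (i - 1) < finish p q r (i - 1) then
        (Sum.inr (wrap h (finish p q r (i - 1) - 1)), true)
      else (Sum.inl (i - 1), true)
  | (Sum.inr j, true) =>
      if (j : ℕ) = start p q (sector p q j) then (Sum.inl (sector p q j), true)
      else (Sum.inr (wrap h (j - 1)), true)
  | (Sum.inr j, false) => (Sum.inr (wrap h (j + 1)), false)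

theorem prev_next : Function.LeftInverse (prev h) (next h) := by
  rintro ⟨i | ⟨j, hj⟩, _ | _⟩
  · simp [next, prev]
  · unfold next
    dsimp only
    split_ifs with h1
    · have h2 := finish_le (p := p) (q := q) (r := r) i
      have := sector_eq le_rfl h1
      rw [wrap_of_lt h (h1.trans_le h2)]
      simp [prev, this]
    · simp [prev, h1]
  · have h0 := pred_mod hj
    have : ((j + (p + q + r - 1)) % (p + q + r) + 1) % (p + q + r) = j := by
      rw [h0, succ_mod] <;> split_ifs <;> omega
    simp [next, prev, wrap, this]
  · unfold next
    dsimp only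
    have h3 := start_sector_le (p := p) (q := q) j
    have h2 := finish_le (p := p) (q := q) (r := r) (sector p q j)
    split_ifs with h1
    · have := sector_eq (h3.trans (Nat.le_succ j)) h1
      rw [wrap_of_lt h (h1.trans_le h2)]
      simp only [prev, this]
      rw [if_neg (by omega)]
      simp [wrap_of_lt h hj]
    · have h4 := lt_finish_sector hj
      simp only [prev, add_sub_cancel_right]
      rw [if_pos (by omega), show finish p q r (sector p q j) - 1 = j by omega, wrap_of_lt h hj]

theorem left_next (d : Edge p q r × Bool) : left (next h d) = left d := by
  obtain ⟨i | ⟨j, hj⟩, _ | _⟩ := d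
  · simp [next, left]
  · unfold next
    dsimp only
    split_ifs with h1
    · have h2 := finish_le (p := p) (q := q) (r := r) i
      rw [wrap_of_lt h (h1.trans_le h2)]
      simp [left, sector_eq le_rfl h1]
    · simp [left]
  · simp [next, left]
  · unfold next
    dsimp only
    have h3 := start_sector_le (p := p) (q := q) j
    have h2 := finish_le (p := p) (q := q) (r := r) (sector p q j)
    split_ifs with h1
    · rw [wrap_of_lt h (h1.trans_le h2)]
      simp [left, sector_eq (h3.trans (Nat.le_succ j)) h1]
    · simp [left]

theorem src_next (d : Edge p q r × Bool) : src h (next h d) = src h (rev d) := by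
  obtain ⟨i | ⟨j, hj⟩, _ | _⟩ := d
  · simp [next, src, rev]
  · unfold next
    dsimp only
    split_ifs with h1
    · rfl
    · have := start_le_finish (p := p) (q := q) (r := r) i
      simp only [src, rev, Bool.not_true, ← wrap_finish]
      congr 2
      omega
  · have h0 := pred_mod hj
    have : ((j + (p + q + r - 1)) % (p + q + r) + 1) % (p + q + r) = j := by
      rw [h0, succ_mod] <;> split_ifs <;> omega
    simp [next, src, rev, wrap, this]
  · unfold next
    dsimp only
    split_ifs with h1
    · rfl
    · have h4 := lt_finish_sector hj
      simp only [src, rev, Bool.not_true, ← wrap_finish]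
      congr 2
      omega

/-- A dart with the given face to its left. -/
def faceDart : Option (Fin 3) → Edge p q r × Bool
  | some i => (Sum.inl (i + 1), false)
  | none => (Sum.inr (wrap h 0), false)

theorem reach_face (x : Edge p q r × Bool) :
    Reach (next h) x (faceDart h (left x)) := by
  have key : ∀ (n j : ℕ) (hj : j < p + q + r), n = p + q + r - j →
      Reach (next h) ((Sum.inr ⟨j, hj⟩, true) : Edge p q r × Bool)
        (Sum.inl (sector p q j + 1), false) := by
    intro n
    induction n with
    | zero => intro j hj; omega
    | succ n ih =>
      intro j hj hn
      apply Reach.head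
      have h3 := start_sector_le (p := p) (q := q) j
      have h2 := finish_le (p := p) (q := q) (r := r) (sector p q j)
      unfold next
      dsimp only
      split_ifs with h1
      · have h5 := sector_eq (h3.trans (Nat.le_succ j)) h1
        rw [wrap_of_lt h (h1.trans_le h2)]
        have := ih (j + 1) (h1.trans_le h2) (by omega)
        rwa [show sector p q (j + 1) = sector p q j from h5] at this
      · exact Reach.refl _ _
  have key2 : ∀ i : Fin 3, Reach (next h) ((Sum.inl i, true) : Edge p q r × Bool)
      (Sum.inl (i + 1), false) := by
    intro i
    apply Reach.head
    have h2 := finish_le (p := p) (q := q) (r := r) i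
    unfold next
    dsimp only
    split_ifs with h1
    · rw [wrap_of_lt h (h1.trans_le h2)]
      have := key _ _ (h1.trans_le h2) rfl
      rwa [sector_eq le_rfl h1] at this
    · exact Reach.refl _ _
  obtain ⟨i | ⟨j, hj⟩, _ | _⟩ := x
  · simpa [left, faceDart] using Reach.refl _ _
  · exact key2 i
  · change Reach _ _ (Sum.inr (wrap h 0), false)
    induction j with
    | zero => rw [wrap_of_lt h h]; exact Reach.refl _ _
    | succ j ih =>
      apply Reach.head
      have : wrap h (j + 1 + (p + q + r - 1)) = ⟨j, by omega⟩ :=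
        Fin.ext ((pred_mod hj).trans (by simp))
      simp only [next, this]
      exact ih _
  · exact key _ _ hj rfl

/-- A dart that starts at the given vertex. -/
def vertexDart : Option (Fin (p + q + r)) → Edge p q r × Bool
  | some j => (Sum.inr j, true)
  | none => (Sum.inl 0, true)

theorem reach_vertex (x : Edge p q r × Bool) :
    Reach (fun x => next h (rev x)) x (vertexDart (src h x)) := by
  have key : ∀ i : Fin 3, Reach (fun x => next h (rev x)) (Sum.inl i, true)
      (Sum.inl 0, true) := by
    intro i
    fin_cases i
    · exact ⟨0, rfl⟩
    · exact ⟨1, rfl⟩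
    · exact ⟨2, rfl⟩
  have step : ∀ i : Fin 3, (start p q i < finish p q r i ∨
      Reach (fun x => next h (rev x)) (Sum.inl (i + 1), false)
        (Sum.inr (wrap h (start p q (i + 1))), true)) →
      Reach (fun x => next h (rev x)) (Sum.inl i, false)
        (Sum.inr (wrap h (start p q i)), true) := by
    intro i hi
    apply Reach.head
    simp only [rev, Bool.not_false, next]
    split_ifs with h1
    · exact Reach.refl _ _
    · have := start_le_finish (p := p) (q := q) (r := r) i
      have h4 := hi.resolve_left h1
      rwa [← wrap_finish, show finish p q r i = start p q i by omega] at h4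
  have key2 : ∀ i : Fin 3, Reach (fun x => next h (rev x)) (Sum.inl i, false)
        (Sum.inr (wrap h (start p q i)), true) := by
    have h0 : start p q 0 < finish p q r 0 ∨ start p q 1 < finish p q r 1 ∨
        start p q 2 < finish p q r 2 := by
      simp [start, finish]; omega
    rcases h0 with h0 | h0 | h0
    · have a0 := step 0 (Or.inl h0)
      have a2 := step 2 (Or.inr a0)
      have a1 := step 1 (Or.inr a2)
      intro i
      fin_cases i <;> assumption
    · have a1 := step 1 (Or.inl h0)
      have a0 := step 0 (Or.inr a1)
      have a2 := step 2 (Or.inr a0)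
      intro i
      fin_cases i <;> assumption
    · have a2 := step 2 (Or.inl h0)
      have a1 := step 1 (Or.inr a2)
      have a0 := step 0 (Or.inr a1)
      intro i
      fin_cases i <;> assumption
  obtain ⟨i | ⟨j, hj⟩, _ | _⟩ := x
  · exact key2 i
  · exact key i
  · apply Reach.head
    simp only [src, rev, Bool.not_false, next]
    split_ifs with h1
    · exact Reach.refl _ _
    · have h4 := lt_finish_sector hj
      rw [show j + 1 = finish p q r (sector p q j) by omega, wrap_finish]
      exact key2 _
  · exact Reach.refl _ _

theorem connected (u v : Option (Fin (p + q + r))) : Linked (src h) Set.univ u v := by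
  have sym : ∀ u v, Linked (src h) Set.univ u v → Linked (src h) Set.univ v u := by
    intro u v huv
    induction huv with
    | refl => exact Relation.ReflTransGen.refl
    | tail _ hs ih =>
      obtain ⟨d, -, hx, hy⟩ := hs
      exact Relation.ReflTransGen.head ⟨rev d, trivial, hy, by simpa [rev] using hx⟩ ih
  have c : ∀ u, Linked (src h) Set.univ none u := by
    have h0 : Linked (src h) Set.univ none (some (wrap h 0)) :=
      Relation.ReflTransGen.single ⟨(Sum.inl 0, true), trivial, rfl, rfl⟩
    rintro (_ | ⟨j, hj⟩)
    · exact Relation.ReflTransGen.refl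
    · induction j with
      | zero => rwa [wrap_of_lt h h] at h0
      | succ j ih =>
        refine (ih (by omega)).tail ⟨(Sum.inr ⟨j, by omega⟩, true), trivial, rfl, ?_⟩
        simp [src, rev, wrap_of_lt h hj]
  exact (sym _ _ (c u)).trans (c v)

/-- The black graph `B_(p,q,r)`: the spokes have height `1` and the edges of the circle have
height `0`. -/
def graph : BlackGraph where
  V := Option (Fin (p + q + r))
  E := Edge p q r
  F := Option (Fin 3)
  src := src h
  left := left
  outer := none
  next := next h
  face_iff := reach_iff (prev_next h).injective left (left_next h) _ (reach_face h)
  vertex_iff := reach_iff ((prev_next h).injective.comp rev_injective) (src h)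
    (fun x => by simpa [rev] using src_next h (rev x)) _ (reach_vertex h)
  left_surjective := by
    rintro (_ | i)
    · exact Or.inr ⟨(Sum.inr (wrap h 0), false), rfl⟩
    · exact Or.inr ⟨(Sum.inl i, true), rfl⟩
  connected := connected h
  euler := by simp; omega
  height := Sum.elim (fun _ => 1) (fun _ => 0)

end Wheel

/-- The black graph `B_(3,3,k)` of the projection `D_(3,3,k)`. -/
def blackGraph33 (k : ℕ) : BlackGraph :=
  Wheel.graph (p := 3) (q := 3) (r := k) (by omega)

end BOS

end

/-!
A spanning tree of the wheel is given by the set `S` of its spokes and the set `M` of the edges of the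
circle that it lacks (`treeOf S M`). It has `|S| = |M|`, its degree is this number, and any two
edges in `M` lie in different sectors. Hence there are spanning trees in the degrees `1`, `2` and `3`
only, and they correspond to a spoke and an edge of the circle, to two edges in different sectors (in
order), and to one edge in each sector. For sectors of lengths `3, 3, k` their numbers are `3 (6 + k)`,
`18 + 12 k` and `9 k`.

Adding to the vertex variables a variable of the base point that makes the product of all of them `1`
(`BlackGraph.weight`), one finds that a coefficient of `Ψ` depends neither on the base vertex nor on the
orientation of the cycle: passing to the other component of `T ∖ {e}` inverts both `α` and `β`, and
`1 / (1 + x⁻¹) = 1 + 1 / (1 + x)` in characteristic two. So every coefficient is, up to adding `1`, the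
sum of `1 / (1 + A)` and `1 / (1 + X)`, where `A` is a product of face variables and `X` the product of
the weights along an arc of the circle (`Move.term_eq_left`, `Move.term_eq_right`). If `Y m` denotes the
product of the weights of the vertices up to the edge `m`, and `P` the product over the whole circle,
then `X` is `Y m' / Y m` or `P * Y m' / Y m`.

With these coefficients (`Psi_pairTree`, `Psi_tripleTree`) `Ψ ∘ Ψ = 0` reduces to two identities of
rational functions. For the ranks, three facts about sectors with three edges are used.

* Functions on three points are combinations of `y⁻¹, 1, y`. For a cocycle in degree `1` the
  conditions at the pairs of edges in the sectors `0` and `1` therefore become linear equations for few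
  coefficients, which only the constants satisfy (`cocycle_constant`).
* The edges of the remaining sector are dealt with one at a time (`cocycle_vanishes`). So the kernel of
  `Ψ` in degree `1` has rank `1`.
* A functional that vanishes on the image of `Ψ` in degree `3` is zero: for a fixed edge of the last
  sector it is a function on a grid of three by three points, and all its nine moments vanish
  (`eq_zero_of_orthogonal`). So `Ψ` is onto in degree `3`.

The ranks of the cohomology follow by counting. The relations that must not hold between the variables
are excluded by specializing them to powers of a third root of unity (`Specializes.ne`).
-/

noncomputable section

/-! ### Laurent polynomials on three points -/

namespace BOS

section ThreePoints

variable {K : Type*} [Field K]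

theorem quadratic_eq_zero {y : Fin 3 → K} (hy : Function.Injective y) {a b c : K}
    (h : ∀ i, a + b * y i + c * y i ^ 2 = 0) : a = 0 ∧ b = 0 ∧ c = 0 := by
  have d01 : y 0 - y 1 ≠ 0 := sub_ne_zero.2 fun e => by simpa using hy e
  have d02 : y 0 - y 2 ≠ 0 := sub_ne_zero.2 fun e => by simpa using hy e
  have d12 : y 1 - y 2 ≠ 0 := sub_ne_zero.2 fun e => by simpa using hy e
  have h0 := h 0
  have h1 := h 1
  have h2 := h 2
  have e01 : b + c * (y 0 + y 1) = 0 :=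
    (mul_eq_zero.1 (show (y 0 - y 1) * (b + c * (y 0 + y 1)) = 0 by
      linear_combination h0 - h1)).resolve_left d01
  have e12 : b + c * (y 1 + y 2) = 0 :=
    (mul_eq_zero.1 (show (y 1 - y 2) * (b + c * (y 1 + y 2)) = 0 by
      linear_combination h1 - h2)).resolve_left d12
  have hc : c = 0 :=
    (mul_eq_zero.1 (show (y 0 - y 2) * c = 0 by
      linear_combination e01 - e12)).resolve_left d02
  have hb : b = 0 := by simpa [hc] using e01
  exact ⟨by simpa [hb, hc] using h0, hb, hc⟩

/-- A combination of `y⁻¹`, `1` and `y` that vanishes at three distinct points is trivial. -/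
theorem laurent_eq_zero {y : Fin 3 → K} (hy : Function.Injective y) (hy0 : ∀ i, y i ≠ 0)
    {a b c : K} (h : ∀ i, a / y i + b + c * y i = 0) : a = 0 ∧ b = 0 ∧ c = 0 :=
  quadratic_eq_zero hy fun i => by
    have h1 := h i
    have h2 := hy0 i
    field_simp at h1
    linear_combination h1

/-- Every function on three distinct non-zero points is a combination of `y⁻¹`, `1` and `y`. -/
theorem exists_laurent {y : Fin 3 → K} (hy : Function.Injective y) (hy0 : ∀ i, y i ≠ 0)
    (f : Fin 3 → K) : ∃ a b c : K, ∀ i, f i = a / y i + b + c * y i := by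
  let L : (Fin 3 → K) →ₗ[K] (Fin 3 → K) :=
    { toFun := fun v i => v 0 / y i + v 1 + v 2 * y i
      map_add' := fun v w => by ext i; simp only [Pi.add_apply]; ring
      map_smul' := fun r v => by
        ext i; simp only [Pi.smul_apply, smul_eq_mul, RingHom.id_apply]; ring }
  have hL : Function.Injective L := by
    rw [← LinearMap.ker_eq_bot, LinearMap.ker_eq_bot']
    intro v hv
    obtain ⟨h0, h1, h2⟩ := laurent_eq_zero hy hy0 fun i => congrFun hv i
    ext i
    fin_cases i <;> assumption
  obtain ⟨v, hv⟩ := (LinearMap.injective_iff_surjective.1 hL) f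
  exact ⟨v 0, v 1, v 2, fun i => (congrFun hv i).symm⟩

/-- The dual of `exists_laurent`: a function on three points is determined by its moments of order
`-1`, `0` and `1`. -/
theorem eq_zero_of_moments {y : Fin 3 → K} (hy : Function.Injective y) (hy0 : ∀ i, y i ≠ 0)
    {f : Fin 3 → K} (hm : ∑ i, f i / y i = 0) (h0 : ∑ i, f i = 0) (h1 : ∑ i, f i * y i = 0)
    (i : Fin 3) : f i = 0 := by
  obtain ⟨a, b, c, habc⟩ := exists_laurent hy hy0 (Pi.single i 1)
  have : f i = ∑ j, f j * (Pi.single i 1 : Fin 3 → K) j := by simp [Pi.single_apply]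
  rw [this]
  simp only [habc, Fin.sum_univ_three] at hm h0 h1 ⊢
  linear_combination a * hm + b * h0 + c * h1

/-- On a grid of three by three points the nine functions `yᵃ zᵇ` with `-1 ≤ a, b ≤ 1` are
linearly independent. -/
theorem laurent₂_eq_zero {y z : Fin 3 → K} (hy : Function.Injective y) (hy0 : ∀ i, y i ≠ 0)
    (hz : Function.Injective z) (hz0 : ∀ i, z i ≠ 0) {c : Fin 3 → Fin 3 → K}
    (h : ∀ i j, (c 0 0 / z j + c 0 1 + c 0 2 * z j) / y i + (c 1 0 / z j + c 1 1 + c 1 2 * z j) +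
      (c 2 0 / z j + c 2 1 + c 2 2 * z j) * y i = 0) (a b : Fin 3) : c a b = 0 := by
  have h1 : ∀ j, _ := fun j => laurent_eq_zero hy hy0 fun i => h i j
  have r0 := laurent_eq_zero hz hz0 fun j => (h1 j).1
  have r1 := laurent_eq_zero hz hz0 fun j => (h1 j).2.1
  have r2 := laurent_eq_zero hz hz0 fun j => (h1 j).2.2
  fin_cases a <;> fin_cases b <;> simp_all

end ThreePoints

/-- The elementary symmetric functions of three elements. -/
def esym₁ {K : Type*} [Field K] (y : Fin 3 → K) : K := y 0 + y 1 + y 2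

/-- See `esym₁`. -/
def esym₂ {K : Type*} [Field K] (y : Fin 3 → K) : K := y 0 * y 1 + y 0 * y 2 + y 1 * y 2

/-- See `esym₁`. -/
def esym₃ {K : Type*} [Field K] (y : Fin 3 → K) : K := y 0 * y 1 * y 2

theorem esym₃_ne_zero {K : Type*} [Field K] {y : Fin 3 → K} (hy0 : ∀ i, y i ≠ 0) : esym₃ y ≠ 0 :=
  mul_ne_zero (mul_ne_zero (hy0 0) (hy0 1)) (hy0 2)

section Char2

variable {K : Type*} [Field K] [CharP K 2]

theorem one_add_ne_zero {a : K} (h : a ≠ 1) : 1 + a ≠ 0 := fun e => h (by grind)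

theorem add_ne_zero_of_ne {a b : K} (h : a ≠ b) : a + b ≠ 0 := fun e => h (by grind)

/-- In characteristic two: `y i` is a root of the cubic polynomial with the roots `y 0, y 1, y 2`. -/
theorem sq_eq_esym (y : Fin 3 → K) (hy0 : ∀ i, y i ≠ 0) (i : Fin 3) :
    y i ^ 2 = esym₃ y / y i + esym₂ y + esym₁ y * y i := by
  have h := hy0 i
  field_simp
  fin_cases i <;> simp only [esym₁, esym₂, esym₃] <;> grind

theorem inv_sq_eq_esym (y : Fin 3 → K) (hy0 : ∀ i, y i ≠ 0) (i : Fin 3) :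
    1 / y i ^ 2 = (esym₂ y / y i + esym₁ y + y i) / esym₃ y := by
  have h := hy0 i
  have h3 := esym₃_ne_zero hy0
  have h1 := sq_eq_esym y hy0 i
  field_simp at h1 ⊢
  grind

/-- The sum of the coefficients of `Ψ` from the two spanning trees that lack the edges with the partial
products `y` and `x` into the one that also lacks the edge with `z`, up to the factor `y * (1 + B)`. -/
theorem row_identity {y z x B : K} (hy : y ≠ 0) (hz : z ≠ 0) (hB : 1 + B ≠ 0)
    (hyz : y + z ≠ 0) (hzx : z + x ≠ 0) :
    y * (1 + B) * (1 / (1 + B) + 1 / (1 + x / z) + (1 + 1 / (1 + B) + 1 / (1 + z / y))) =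
      (y + x) * (1 + B) * (z * y / ((y + z) * (z + x))) := by
  field_simp
  grind

/-- The analogue of `row_identity` with the roles of `y` and `z` exchanged. -/
theorem col_identity {y z x A P : K} (hy : y ≠ 0) (hx : x ≠ 0) (hA : 1 + A ≠ 0)
    (hyz : y + z ≠ 0) (hyx : x + P * y ≠ 0) :
    P * z * (1 + A) * (1 + 1 / (1 + A) + 1 / (1 + P * y / x) + (1 / (1 + A) + 1 / (1 + z / y))) =
      (P * z + x) * (1 + A) * (z * (P * y) / ((y + z) * (x + P * y))) := by
  have hyx' : x + y * P ≠ 0 := by rwa [mul_comm y P]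
  field_simp
  grind

theorem row_identity' {y z x B : K} (hy : y ≠ 0) (hz : z ≠ 0) (hB : 1 + B ≠ 0)
    (hyz : y + z ≠ 0) (hzx : z + x ≠ 0) :
    (1 + B) * (1 + 1 / (1 + B) + 1 / (1 + z / y)) =
      (x * y / z + y + B * (z + x)) * (z / ((y + z) * (z + x))) := by
  field_simp
  grind

theorem col_identity' {y z x A P : K} (hy : y ≠ 0) (hA : 1 + A ≠ 0)
    (hyz : y + z ≠ 0) (hyx : x + P * y ≠ 0) :
    (1 + A) * (1 / (1 + A) + 1 / (1 + z / y)) =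
      (A * P * y + A * x + P * z + x * z / y) * (y / ((y + z) * (x + P * y))) := by
  have hyx' : x + y * P ≠ 0 := by rwa [mul_comm y P]
  field_simp
  grind

/-- The dual statement of the surjectivity of `Ψ` onto the spanning trees that lack a fixed edge of
the last sector: the four families of hypotheses say that `W` is orthogonal to the images of the four
kinds of spanning trees that lack this edge. The moments `∑ yᵃ zᵇ v` with `-1 ≤ a, b ≤ 1` of a
rescaling `v` of `W` all vanish. -/
theorem eq_zero_of_orthogonal {y z : Fin 3 → K} {x P A B : K}
    (hy : Function.Injective y) (hy0 : ∀ i, y i ≠ 0)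
    (hz : Function.Injective z) (hz0 : ∀ i, z i ≠ 0) (hx0 : x ≠ 0) (hP0 : P ≠ 0)
    (hB0 : B ≠ 0) (hA1 : A ≠ 1) (hB1 : B ≠ 1) (hyz : ∀ i j, z j ≠ y i)
    (hyx : ∀ i, x ≠ y i) (hzx : ∀ j, x ≠ z j) (hPyx : ∀ i, P * y i ≠ x)
    (hPzx : ∀ j, P * z j ≠ x) (hAB : A * P * esym₃ y ≠ B * esym₃ z)
    {W : Fin 3 → Fin 3 → K}
    (h1 : ∀ i, ∑ j, W i j * (1 / (1 + B) + 1 / (1 + x / z j)) = 0)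
    (h2 : ∀ i, ∑ j, W i j * (1 + 1 / (1 + B) + 1 / (1 + z j / y i)) = 0)
    (h3 : ∀ j, ∑ i, W i j * (1 + 1 / (1 + A) + 1 / (1 + P * y i / x)) = 0)
    (h4 : ∀ j, ∑ i, W i j * (1 / (1 + A) + 1 / (1 + z j / y i)) = 0) (i j : Fin 3) :
    W i j = 0 := by
  have nA := one_add_ne_zero hA1
  have nB := one_add_ne_zero hB1
  have nyz : ∀ i j, y i + z j ≠ 0 := fun i j => add_ne_zero_of_ne (hyz i j).symm
  have nyx : ∀ i, y i + x ≠ 0 := fun i => add_ne_zero_of_ne (hyx i).symm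
  have nzx : ∀ j, z j + x ≠ 0 := fun j => add_ne_zero_of_ne (hzx j).symm
  have nPy : ∀ i, x + P * y i ≠ 0 := fun i => add_ne_zero_of_ne (hPyx i).symm
  have nPz : ∀ j, P * z j + x ≠ 0 := fun j => add_ne_zero_of_ne (hPzx j)
  let v : Fin 3 → Fin 3 → K := fun i j =>
    W i j * z j * y i / ((y i + z j) * (z j + x) * (x + P * y i))
  have hv : ∀ i j, v i j = W i j * z j * y i / ((y i + z j) * (z j + x) * (x + P * y i)) :=
    fun _ _ => rfl
  -- The row sums and the column sums of `v` vanish.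
  have r0 : ∀ i, ∑ j, v i j = 0 := by
    intro i
    have c : (y i + x) * (1 + B) * (x + P * y i) * ∑ j, v i j =
        y i * (1 + B) * (∑ j, W i j * (1 / (1 + B) + 1 / (1 + x / z j)) +
          ∑ j, W i j * (1 + 1 / (1 + B) + 1 / (1 + z j / y i))) := by
      rw [← Finset.sum_add_distrib, Finset.mul_sum, Finset.mul_sum]
      refine Finset.sum_congr rfl fun j _ => ?_
      rw [hv, ← mul_add, mul_left_comm, row_identity (hy0 i) (hz0 j) nB (nyz i j) (nzx j),
        div_eq_mul_inv, div_eq_mul_inv, mul_inv _ (x + P * y i)]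
      linear_combination (y i + x) * (1 + B) * (W i j * z j * y i) *
        ((y i + z j) * (z j + x))⁻¹ * mul_inv_cancel₀ (nPy i)
    rw [h1, h2, add_zero, mul_zero] at c
    exact (mul_eq_zero.1 c).resolve_left (mul_ne_zero (mul_ne_zero (nyx i) nB) (nPy i))
  have c0 : ∀ j, ∑ i, v i j = 0 := by
    intro j
    have c : (P * z j + x) * (1 + A) * (z j + x) * P * ∑ i, v i j =
        P * z j * (1 + A) * (∑ i, W i j * (1 + 1 / (1 + A) + 1 / (1 + P * y i / x)) +
          ∑ i, W i j * (1 / (1 + A) + 1 / (1 + z j / y i))) := by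
      rw [← Finset.sum_add_distrib, Finset.mul_sum, Finset.mul_sum]
      refine Finset.sum_congr rfl fun i _ => ?_
      rw [hv, ← mul_add, mul_left_comm, col_identity (hy0 i) hx0 nA (nyz i j) (nPy i),
        div_eq_mul_inv, div_eq_mul_inv, mul_right_comm (y i + z j), mul_inv _ (z j + x)]
      linear_combination (P * z j + x) * (1 + A) * P * (W i j * z j * y i) *
        ((y i + z j) * (x + P * y i))⁻¹ * mul_inv_cancel₀ (nzx j)
    rw [h3, h4, add_zero, mul_zero] at c
    exact (mul_eq_zero.1 c).resolve_left
      (mul_ne_zero (mul_ne_zero (mul_ne_zero (nPz j) nA) (nzx j)) hP0)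
  have r1 : ∀ i, x * y i * ∑ j, v i j / z j + B * ∑ j, v i j * z j = 0 := by
    intro i
    have c : x * y i * (∑ j, v i j / z j) + B * (∑ j, v i j * z j) +
        (y i + B * x) * ∑ j, v i j = y i / (x + P * y i) * ((1 + B) *
          ∑ j, W i j * (1 + 1 / (1 + B) + 1 / (1 + z j / y i))) := by
      simp only [Finset.mul_sum, ← Finset.sum_add_distrib]
      refine Finset.sum_congr rfl fun j _ => ?_
      rw [hv, mul_left_comm (1 + B), row_identity' (hy0 i) (hz0 j) nB (nyz i j) (nzx j)]
      simp only [div_eq_mul_inv, mul_inv]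
      ring
    rwa [h2, r0, mul_zero, mul_zero, mul_zero, add_zero] at c
  have c1 : ∀ j, A * P * (∑ i, v i j * y i) + x * z j * ∑ i, v i j / y i = 0 := by
    intro j
    have c : A * P * (∑ i, v i j * y i) + x * z j * (∑ i, v i j / y i) +
        (A * x + P * z j) * ∑ i, v i j = z j / (z j + x) * ((1 + A) *
          ∑ i, W i j * (1 / (1 + A) + 1 / (1 + z j / y i))) := by
      simp only [Finset.mul_sum, ← Finset.sum_add_distrib]
      refine Finset.sum_congr rfl fun i _ => ?_
      rw [hv, mul_left_comm (1 + A), col_identity' (hy0 i) nA (nyz i j) (nPy i)]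
      simp only [div_eq_mul_inv, mul_inv]
      ring
    rwa [h4, c0, mul_zero, mul_zero, mul_zero, add_zero] at c
  -- The remaining moments of `v`.
  obtain ⟨mpm, hpm⟩ : ∃ m, m = ∑ i, (∑ j, v i j / z j) * y i := ⟨_, rfl⟩
  obtain ⟨mmm, hmm⟩ : ∃ m, m = ∑ i, (∑ j, v i j / z j) / y i := ⟨_, rfl⟩
  obtain ⟨mpp, hpp⟩ : ∃ m, m = ∑ i, (∑ j, v i j * z j) * y i := ⟨_, rfl⟩
  obtain ⟨mmp, hmp⟩ : ∃ m, m = ∑ i, (∑ j, v i j * z j) / y i := ⟨_, rfl⟩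
  have m0m : ∑ i, ∑ j, v i j / z j = 0 := by
    rw [Finset.sum_comm]; simp only [← Finset.sum_div, c0, zero_div, Finset.sum_const_zero]
  have m0p : ∑ i, ∑ j, v i j * z j = 0 := by
    rw [Finset.sum_comm]; simp only [← Finset.sum_mul, c0, zero_mul, Finset.sum_const_zero]
  have e1 : mmp = 0 := by
    have : ∑ i, (x * y i * ∑ j, v i j / z j + B * ∑ j, v i j * z j) / y i = 0 := by simp [r1]
    have h : x * (∑ i, ∑ j, v i j / z j) + B * mmp = 0 := by
      rw [← this, hmp, Finset.mul_sum, Finset.mul_sum, ← Finset.sum_add_distrib]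
      refine Finset.sum_congr rfl fun i _ => ?_
      have := hy0 i
      field_simp
    rw [m0m, mul_zero, zero_add] at h
    exact (mul_eq_zero.1 h).resolve_left hB0
  have e2 : mpm = 0 := by
    have : ∑ i, (x * y i * ∑ j, v i j / z j + B * ∑ j, v i j * z j) = 0 := by simp [r1]
    rw [Finset.sum_add_distrib, ← Finset.mul_sum _ _ B, m0p, mul_zero, add_zero] at this
    have h : x * mpm = 0 := by
      rw [← this, hpm, Finset.mul_sum]
      exact Finset.sum_congr rfl fun i _ => by ring
    exact (mul_eq_zero.1 h).resolve_left hx0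
  have e3 : x * (esym₃ y * mmm) + B * mpp = 0 := by
    have : ∑ i, (x * y i * ∑ j, v i j / z j + B * ∑ j, v i j * z j) * y i = 0 := by simp [r1]
    have h : x * (esym₃ y * mmm + esym₂ y * (∑ i, ∑ j, v i j / z j) + esym₁ y * mpm) +
        B * mpp = 0 := by
      rw [← this, hmm, hpm, hpp]
      simp only [Finset.mul_sum _ (fun i => ∑ j, v i j / z j),
        Finset.mul_sum _ (fun i => (∑ j, v i j / z j) * y i),
        Finset.mul_sum _ (fun i => (∑ j, v i j / z j) / y i),
        Finset.mul_sum _ (fun i => (∑ j, v i j * z j) * y i), ← Finset.sum_add_distrib]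
      rw [Finset.mul_sum, ← Finset.sum_add_distrib]
      refine Finset.sum_congr rfl fun i _ => ?_
      linear_combination -x * (∑ j, v i j / z j) * sq_eq_esym y hy0 i
    rwa [m0m, e2, mul_zero, mul_zero, add_zero, add_zero] at h
  have e4 : A * P * mpp + x * (esym₃ z * mmm) = 0 := by
    have : ∑ j, (A * P * (∑ i, v i j * y i) + x * z j * ∑ i, v i j / y i) * z j = 0 := by
      simp [c1]
    have s1 : mpp = ∑ j, (∑ i, v i j * y i) * z j := by
      simp only [hpp, Finset.sum_mul]
      rw [Finset.sum_comm]
      exact Finset.sum_congr rfl fun j _ => Finset.sum_congr rfl fun i _ => by ring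
    have s2 : mmm = ∑ j, (∑ i, v i j / y i) / z j := by
      simp only [hmm, Finset.sum_div]
      rw [Finset.sum_comm]
      exact Finset.sum_congr rfl fun j _ => Finset.sum_congr rfl fun i _ => by ring
    have s3 : mmp = ∑ j, (∑ i, v i j / y i) * z j := by
      simp only [hmp, Finset.sum_mul, Finset.sum_div]
      rw [Finset.sum_comm]
      exact Finset.sum_congr rfl fun j _ => Finset.sum_congr rfl fun i _ => by ring
    have s4 : ∑ j, ∑ i, v i j / y i = 0 := by
      rw [Finset.sum_comm]; simp only [← Finset.sum_div, r0, zero_div, Finset.sum_const_zero]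
    have h : A * P * mpp +
        x * (esym₃ z * mmm + esym₂ z * (∑ j, ∑ i, v i j / y i) + esym₁ z * mmp) = 0 := by
      rw [← this, s1, s2, s3]
      simp only [Finset.mul_sum _ (fun j => ∑ i, v i j / y i),
        Finset.mul_sum _ (fun j => (∑ i, v i j / y i) * z j),
        Finset.mul_sum _ (fun j => (∑ i, v i j / y i) / z j),
        Finset.mul_sum _ (fun j => (∑ i, v i j * y i) * z j), ← Finset.sum_add_distrib]
      rw [Finset.mul_sum, ← Finset.sum_add_distrib]
      refine Finset.sum_congr rfl fun j _ => ?_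
      linear_combination -x * (∑ i, v i j / y i) * sq_eq_esym z hz0 j
    rwa [s4, e1, mul_zero, mul_zero, add_zero, add_zero] at h
  have e5 : mmm = 0 := by
    have : x * (A * P * esym₃ y + B * esym₃ z) * mmm = 0 := by
      linear_combination (A * P) * e3 + B * e4 - (A * P * B * mpp) * (CharTwo.two_eq_zero (R := K))
    exact (mul_eq_zero.1 this).resolve_left (mul_ne_zero hx0 (add_ne_zero_of_ne hAB))
  have e6 : mpp = 0 := by simpa [e5, hB0] using e3
  have z1 : ∀ i, ∑ j, v i j / z j = 0 :=
    eq_zero_of_moments hy hy0 (hmm.symm.trans e5) m0m (hpm.symm.trans e2)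
  have z2 : ∀ i, ∑ j, v i j * z j = 0 :=
    eq_zero_of_moments hy hy0 (hmp.symm.trans e1) m0p (hpp.symm.trans e6)
  have := eq_zero_of_moments hz hz0 (z1 i) (r0 i) (z2 i) j
  simpa [hv, hy0, hz0, nyz, nzx, nPy] using this

end Char2

end BOS

/-! ### Cocycle conditions and the square of the differential -/

namespace BOS
section Char2

variable {K : Type*} [Field K] [CharP K 2]

/-- The cocycle condition at a pair of edges, for the values `a, a'` and `b, b'` of a cocycle on the
spanning trees that lack the first, respectively the second edge, without the denominators that
involve `y` and `z`. -/
theorem pair_identity {y z P A B a a' b b' : K} (hy : y ≠ 0) (hz : z ≠ 0) (hyz : y + z ≠ 0)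
    (hPyz : z + P * y ≠ 0) (hA : 1 + A ≠ 0) (hB : 1 + B ≠ 0) (hP : 1 + P ≠ 0)
    (h : (1 + 1 / (1 + A) + 1 / (1 + z / y)) * a + (1 / (1 + B) + 1 / (1 + z / y)) * b +
      (1 / (1 + A) + 1 / (1 + P * y / z)) * a' + (1 + 1 / (1 + B) + 1 / (1 + P * y / z)) * b' = 0) :
    (P * y / z + (1 + A * P) + A * z / y) * ((a + a') / ((1 + P) * (1 + A))) +
      (B * P * y / z + (B + P) + z / y) * ((b + b') / ((1 + P) * (1 + B))) + a' + b' = 0 := by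
  have hPyz' : z + y * P ≠ 0 := by rwa [mul_comm y P]
  field_simp at h ⊢
  grind

/-- The equations for the coefficients of `yᵃ zᵇ` with `-1 ≤ a, b ≤ 1` in the identity
`pair_identity`, when the four functions of `y` or of `z` in it are combinations of `y⁻¹, 1, y` or of
`z⁻¹, 1, z`. The exponents `2` and `-2` are eliminated by means of `sq_eq_esym` and
`inv_sq_eq_esym`. -/
theorem coefficient_equations {y z : Fin 3 → K} {P A B : K}
    (hy : Function.Injective y) (hy0 : ∀ i, y i ≠ 0)
    (hz : Function.Injective z) (hz0 : ∀ i, z i ≠ 0)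
    {sm s0 sp tm t0 tp am a0 ap bm b0 bp : K}
    (h : ∀ i j, (P * y i / z j + (1 + A * P) + A * z j / y i) * (sm / y i + s0 + sp * y i) +
      (B * P * y i / z j + (B + P) + z j / y i) * (tm / z j + t0 + tp * z j) +
      (am / y i + a0 + ap * y i) + (bm / z j + b0 + bp * z j) = 0) :
    (A * sm / esym₃ y + B * P * tm / esym₃ z = 0 ∧
      P * sp * esym₃ y + tp * esym₃ z = 0 ∧
      P * (s0 + sp * esym₁ y) + B * P * (t0 + tm * esym₂ z / esym₃ z) = 0 ∧
      A * (s0 + sm * esym₂ y / esym₃ y) + (t0 + tp * esym₁ z) = 0) ∧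
    ((1 + A * P) * sp + B * P * (tp + tm * esym₁ z / esym₃ z) + ap = 0 ∧
      (1 + A * P) * sm + (tm + tp * esym₂ z) + am = 0 ∧
      A * (sp + sm * esym₁ y / esym₃ y) + (B + P) * tp + bp = 0 ∧
      P * (sm + sp * esym₂ y) + (B + P) * tm + bm = 0) ∧
    (1 + A * P) * s0 + (B + P) * t0 + a0 + b0 = 0 := by
  have key := laurent₂_eq_zero hy hy0 hz hz0 (c := ![
    ![P * sp * esym₃ y + tp * esym₃ z, (1 + A * P) * sm + (tm + tp * esym₂ z) + am,
      A * (s0 + sm * esym₂ y / esym₃ y) + (t0 + tp * esym₁ z)],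
    ![P * (sm + sp * esym₂ y) + (B + P) * tm + bm, (1 + A * P) * s0 + (B + P) * t0 + a0 + b0,
      A * (sp + sm * esym₁ y / esym₃ y) + (B + P) * tp + bp],
    ![P * (s0 + sp * esym₁ y) + B * P * (t0 + tm * esym₂ z / esym₃ z),
      (1 + A * P) * sp + B * P * (tp + tm * esym₁ z / esym₃ z) + ap,
      A * sm / esym₃ y + B * P * tm / esym₃ z]]) (by
    intro i j
    have h' := h i j
    have e1 := sq_eq_esym y hy0 i
    have e2 := sq_eq_esym z hz0 j
    have e3 := inv_sq_eq_esym y hy0 i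
    have e4 := inv_sq_eq_esym z hz0 j
    have f1 := mul_inv_cancel₀ (hy0 i)
    have f2 := mul_inv_cancel₀ (hz0 j)
    simp only [div_eq_mul_inv, one_mul] at h' e1 e2 e3 e4 ⊢
    rw [← inv_pow] at e3 e4
    simp only [Matrix.cons_val]
    linear_combination h' - P * (z j)⁻¹ * sm * f1 - P * (z j)⁻¹ * sp * e1 - A * z j * sm * e3 -
      A * z j * sp * f1 - B * P * y i * tm * e4 - B * P * y i * tp * f2 - (y i)⁻¹ * tm * f2 -
      (y i)⁻¹ * tp * e2)
  exact ⟨⟨key 2 2, key 0 0, key 2 0, key 0 2⟩, ⟨key 2 1, key 0 1, key 1 2, key 1 0⟩, key 1 1⟩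

/-- Two systems of coefficient equations, with the face variables `t * A, B` and `A, t * B`, that share
the unknowns `am, ap, bm, bp` have only the trivial solution. The expression in `hΔ` is the determinant
of the linear equations `k1` and `k2` below, up to the factor `t * A * B`. -/
theorem coefficients_eq_zero {P A B t e₁ e₂ e₃ f₁ f₂ f₃ : K} (hP : P ≠ 0) (hA : A ≠ 0)
    (hB : B ≠ 0) (ht : t ≠ 0) (he : e₃ ≠ 0) (hf : f₃ ≠ 0) (ht1 : t ≠ 1) (hAB : t * A * B ≠ 1)
    (hk : B * P * e₃ ≠ A * f₃)
    (hΔ : (f₃ + P ^ 3 * e₃) ^ 2 +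
      P ^ 2 * (e₂ * f₃ + P * e₃ * f₂) * (f₁ + P * e₁) ≠ 0)
    {sm s0 sp tm t0 tp sm' s0' sp' tm' t0' tp' am ap bm bp : K}
    (h1 : t * A * sm / e₃ + B * P * tm / f₃ = 0) (h2 : P * sp * e₃ + tp * f₃ = 0)
    (h3 : P * (s0 + sp * e₁) + B * P * (t0 + tm * f₂ / f₃) = 0)
    (h4 : t * A * (s0 + sm * e₂ / e₃) + (t0 + tp * f₁) = 0)
    (h5 : (1 + t * A * P) * sp + B * P * (tp + tm * f₁ / f₃) + ap = 0)
    (h6 : (1 + t * A * P) * sm + (tm + tp * f₂) + am = 0)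
    (h7 : t * A * (sp + sm * e₁ / e₃) + (B + P) * tp + bp = 0)
    (h8 : P * (sm + sp * e₂) + (B + P) * tm + bm = 0)
    (h1' : A * sm' / e₃ + t * B * P * tm' / f₃ = 0) (h2' : P * sp' * e₃ + tp' * f₃ = 0)
    (h3' : P * (s0' + sp' * e₁) + t * B * P * (t0' + tm' * f₂ / f₃) = 0)
    (h4' : A * (s0' + sm' * e₂ / e₃) + (t0' + tp' * f₁) = 0)
    (h5' : (1 + A * P) * sp' + t * B * P * (tp' + tm' * f₁ / f₃) + ap = 0)
    (h6' : (1 + A * P) * sm' + (tm' + tp' * f₂) + am = 0)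
    (h7' : A * (sp' + sm' * e₁ / e₃) + (t * B + P) * tp' + bp = 0)
    (h8' : P * (sm' + sp' * e₂) + (t * B + P) * tm' + bm = 0) :
    (sm = 0 ∧ s0 = 0 ∧ sp = 0 ∧ tm = 0 ∧ t0 = 0 ∧ tp = 0) ∧
      (sm' = 0 ∧ s0' = 0 ∧ sp' = 0 ∧ tm' = 0 ∧ t0' = 0 ∧ tp' = 0) ∧ am = 0 ∧ ap = 0 ∧ bm = 0 ∧ bp = 0 := by
  have ht2 := one_add_ne_zero ht1
  have hk' := add_ne_zero_of_ne hk
  -- The equations `h1, h2, h1', h2'` are solved by four parameters.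
  obtain ⟨p, rfl⟩ : ∃ p, sp = f₃ * p := ⟨sp / f₃, by field_simp⟩
  obtain ⟨p', rfl⟩ : ∃ p', sp' = f₃ * p' := ⟨sp' / f₃, by field_simp⟩
  obtain ⟨q, rfl⟩ : ∃ q, tm = t * A * f₃ * q := ⟨tm / (t * A * f₃), by field_simp⟩
  obtain ⟨q', rfl⟩ : ∃ q', tm' = t * A * f₃ * q' := ⟨tm' / (t * A * f₃), by field_simp⟩
  have h2 : tp = P * e₃ * p := by
    refine mul_left_cancel₀ hf ?_; clear * - h2; grind
  have h2' : tp' = P * e₃ * p' := by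
    refine mul_left_cancel₀ hf ?_; clear * - h2'; grind
  have h1 : sm = B * P * e₃ * q := by
    refine mul_left_cancel₀ (mul_ne_zero (mul_ne_zero ht hA) hf) ?_
    field_simp at h1; clear * - h1; grind
  have h1' : sm' = t ^ 2 * B * P * e₃ * q' := by
    refine mul_left_cancel₀ (mul_ne_zero hA hf) ?_
    field_simp at h1'; clear * - h1'; grind
  subst h1 h2 h1' h2'
  have c1 : ∀ q c, t * A * f₃ * q * c / f₃ = t * A * q * c := fun q c => by field_simp
  have c2 : ∀ q c, B * P * e₃ * q * c / e₃ = B * P * q * c := fun q c => by field_simp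
  have c3 : ∀ q c, t ^ 2 * B * P * e₃ * q * c / e₃ = t ^ 2 * B * P * q * c :=
    fun q c => by field_simp
  rw [c1] at h3 h5 h3' h5'
  rw [c2] at h4 h7
  rw [c3] at h4' h7'
  clear c1 c2 c3
  -- Eliminating `am, ap, bm, bp` leaves two linear equations for `p + p'` and `q + t * q'`.
  have k1 : (f₃ + P ^ 3 * e₃) * (p + p') +
      t * A * B * P * (f₁ + P * e₁) * (q + t * q') = 0 := by
    clear * - h5 h5' h7 h7'
    linear_combination h5 + h5' + P * (h7 + h7') -
      (P ^ 2 * B * (p + t * p') * e₃ + A * P * f₃ * (t * p + p') + ap + P * bp) *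
        (CharTwo.two_eq_zero (R := K))
  have k2 : P * (e₂ * f₃ + P * e₃ * f₂) * (p + p') +
      t * A * B * (f₃ + P ^ 3 * e₃) * (q + t * q') = 0 := by
    clear * - h6 h6' h8 h8'
    grind
  have hd : p + p' = 0 := by
    have : (t * A * B) * ((f₃ + P ^ 3 * e₃) ^ 2 +
      P ^ 2 * (e₂ * f₃ + P * e₃ * f₂) * (f₁ + P * e₁)) * (p + p') = 0 := by
      clear * - k1 k2
      grind
    refine (mul_eq_zero.1 this).resolve_left (mul_ne_zero ?_ hΔ)
    exact mul_ne_zero (mul_ne_zero ht hA) hB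
  have hw : q + t * q' = 0 := by
    have : (t * A * B) * ((f₃ + P ^ 3 * e₃) ^ 2 +
      P ^ 2 * (e₂ * f₃ + P * e₃ * f₂) * (f₁ + P * e₁)) * (q + t * q') = 0 := by
      clear * - k1 k2
      grind
    refine (mul_eq_zero.1 this).resolve_left (mul_ne_zero ?_ hΔ)
    exact mul_ne_zero (mul_ne_zero ht hA) hB
  obtain rfl : p' = p := by clear * - hd; grind
  obtain rfl : q = t * q' := by clear * - hw; grind
  obtain rfl : q' = 0 := by
    have : t * (1 + t) * (B * P * e₃ + A * f₃) * q' = 0 := by clear * - h6 h6'; grind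
    exact (mul_eq_zero.1 this).resolve_left (mul_ne_zero (mul_ne_zero ht ht2) hk')
  obtain rfl : p' = 0 := by
    have : (1 + t) * (B * P * e₃ + A * f₃) * p' = 0 := by clear * - h7 h7'; grind
    exact (mul_eq_zero.1 this).resolve_left (mul_ne_zero ht2 hk')
  simp only [mul_zero, zero_mul, add_zero, zero_add] at h3 h4 h3' h4' h5 h6 h7 h8
  obtain rfl : s0 = 0 := by
    have : P * (1 + t * A * B) * s0 = 0 := by clear * - h3 h4; grind
    exact (mul_eq_zero.1 this).resolve_left (mul_ne_zero hP (one_add_ne_zero hAB))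
  obtain rfl : s0' = 0 := by
    have : P * (1 + t * A * B) * s0' = 0 := by clear * - h3' h4'; grind
    exact (mul_eq_zero.1 this).resolve_left (mul_ne_zero hP (one_add_ne_zero hAB))
  simp_all

/-- The cocycle condition for the pairs of edges in the sectors `0` and `1`: the functions `a i` and
`b i` are the values of a cocycle on the spanning trees with the single spoke `i` that lack an edge of
the sector `0`, respectively `1`. -/
theorem cocycle_constant {y z : Fin 3 → K} {P A₀ A₁ A₂ : K}
    (hy : Function.Injective y) (hy0 : ∀ i, y i ≠ 0)
    (hz : Function.Injective z) (hz0 : ∀ i, z i ≠ 0) (hP0 : P ≠ 0) (hP1 : P ≠ 1)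
    (hA0 : A₀ ≠ 0) (hA1 : A₁ ≠ 0) (hA2 : A₂ ≠ 0) (h0 : A₀ ≠ 1) (h1 : A₁ ≠ 1) (h2 : A₂ ≠ 1)
    (h12 : A₁ * A₂ ≠ 1) (h20 : A₂ * A₀ ≠ 1) (h012 : A₀ * A₁ * A₂ ≠ 1)
    (hyz : ∀ i j, z j ≠ y i) (hPyz : ∀ i j, P * y i ≠ z j)
    (hk : A₀ * P * esym₃ y ≠ A₁ * esym₃ z)
    (hΔ : (esym₃ z + P ^ 3 * esym₃ y) ^ 2 + P ^ 2 * (esym₂ y * esym₃ z +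
      P * esym₃ y * esym₂ z) * (esym₁ z + P * esym₁ y) ≠ 0)
    {a b : Fin 3 → Fin 3 → K}
    (e01 : ∀ i j, (1 + 1 / (1 + A₁ * A₂) + 1 / (1 + z j / y i)) * a 0 i +
      (1 / (1 + A₀) + 1 / (1 + z j / y i)) * b 0 j +
      (1 / (1 + A₁ * A₂) + 1 / (1 + P * y i / z j)) * a 1 i +
      (1 + 1 / (1 + A₀) + 1 / (1 + P * y i / z j)) * b 1 j = 0)
    (e21 : ∀ i j, (1 + 1 / (1 + A₁) + 1 / (1 + z j / y i)) * a 2 i +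
      (1 / (1 + A₂ * A₀) + 1 / (1 + z j / y i)) * b 2 j +
      (1 / (1 + A₁) + 1 / (1 + P * y i / z j)) * a 1 i +
      (1 + 1 / (1 + A₂ * A₀) + 1 / (1 + P * y i / z j)) * b 1 j = 0) :
    ∃ c, ∀ s i, a s i = c ∧ b s i = c := by
  have nP := one_add_ne_zero hP1
  -- The two families of conditions involve the same functions `a 1` and `b 1`.
  have pi1 : ∀ i j, _ := fun i j => pair_identity (hy0 i) (hz0 j)
    (add_ne_zero_of_ne (hyz i j).symm) (add_ne_zero_of_ne (hPyz i j).symm)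
    (one_add_ne_zero h12) (one_add_ne_zero h0) nP (e01 i j)
  have pi2 : ∀ i j, _ := fun i j => pair_identity (hy0 i) (hz0 j)
    (add_ne_zero_of_ne (hyz i j).symm) (add_ne_zero_of_ne (hPyz i j).symm)
    (one_add_ne_zero h1) (one_add_ne_zero h20) nP (e21 i j)
  obtain ⟨sm, s0, sp, hs⟩ := exists_laurent hy hy0 fun i =>
    (a 0 i + a 1 i) / ((1 + P) * (1 + A₁ * A₂))
  obtain ⟨tm, t0, tp, ht⟩ := exists_laurent hz hz0 fun j =>
    (b 0 j + b 1 j) / ((1 + P) * (1 + A₀))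
  obtain ⟨sm', s0', sp', hs'⟩ := exists_laurent hy hy0 fun i =>
    (a 2 i + a 1 i) / ((1 + P) * (1 + A₁))
  obtain ⟨tm', t0', tp', ht'⟩ := exists_laurent hz hz0 fun j =>
    (b 2 j + b 1 j) / ((1 + P) * (1 + A₂ * A₀))
  obtain ⟨am, a0, ap, ha⟩ := exists_laurent hy hy0 (a 1)
  obtain ⟨bm, b0, bp, hb⟩ := exists_laurent hz hz0 (b 1)
  obtain ⟨⟨q1, q2, q3, q4⟩, ⟨q5, q6, q7, q8⟩, q9⟩ :=
    coefficient_equations (P := P) (A := A₂ * A₁) (B := A₀) hy hy0 hz hz0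
      (sm := sm) (s0 := s0) (sp := sp) (tm := tm) (t0 := t0) (tp := tp)
      (am := am) (a0 := a0) (ap := ap) (bm := bm) (b0 := b0) (bp := bp) fun i j => by
      rw [← hs, ← ht, ← ha, ← hb, mul_comm A₂]; exact pi1 i j
  obtain ⟨⟨q1', q2', q3', q4'⟩, ⟨q5', q6', q7', q8'⟩, q9'⟩ :=
    coefficient_equations (P := P) (A := A₁) (B := A₂ * A₀) hy hy0 hz hz0
      (sm := sm') (s0 := s0') (sp := sp') (tm := tm') (t0 := t0') (tp := tp')
      (am := am) (a0 := a0) (ap := ap) (bm := bm) (b0 := b0) (bp := bp) fun i j => by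
      rw [← hs', ← ht', ← ha, ← hb]; exact pi2 i j
  obtain ⟨⟨rfl, rfl, rfl, rfl, rfl, rfl⟩, ⟨rfl, rfl, rfl, rfl, rfl, rfl⟩, rfl, rfl, rfl, rfl⟩ :=
    coefficients_eq_zero hP0 hA1 hA0
    hA2 (esym₃_ne_zero hy0) (esym₃_ne_zero hz0) h2 (by rwa [mul_comm, mul_comm A₂, ← mul_assoc])
    hk hΔ q1 q2 q3 q4 q5 q6 q7 q8 q1' q2' q3' q4' q5' q6' q7' q8'
  simp only [zero_div, zero_mul, add_zero, zero_add, mul_zero] at hs ht hs' ht' ha hb q9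
  have d : ∀ {f g A : K}, A ≠ 1 → (f + g) / ((1 + P) * (1 + A)) = 0 → f = g := by
    intro f g A hA h
    rw [div_eq_zero_iff, or_iff_left (mul_ne_zero nP (one_add_ne_zero hA))] at h
    exact CharTwo.add_eq_zero.1 h
  obtain rfl : a0 = b0 := CharTwo.add_eq_zero.1 q9
  refine ⟨a0, fun s i => ?_⟩
  have r0 := (d h12 (hs i)).trans (ha i)
  have r1 := (d h0 (ht i)).trans (hb i)
  have r2 := (d h1 (hs' i)).trans (ha i)
  have r3 := (d h20 (ht' i)).trans (hb i)
  fin_cases s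
  exacts [⟨r0, r1⟩, ⟨ha i, hb i⟩, ⟨r2, r3⟩]

/-- The cocycle condition for the pairs that consist of a fixed edge and of an edge of a sector with
three edges: a cocycle that vanishes on the spanning trees with a single spoke that lack an edge of this
sector also vanishes on those that lack the fixed edge. -/
theorem cocycle_vanishes {y : Fin 3 → K} {x P A : K} (hy : Function.Injective y)
    (hy0 : ∀ i, y i ≠ 0) (hx0 : x ≠ 0) (hA1 : A ≠ 1) (hP1 : P ≠ 1)
    (hyx : ∀ i, x ≠ y i) (hPyx : ∀ i, P * y i ≠ x) {a b : K}
    (h : ∀ i, (1 / (1 + A) + 1 / (1 + x / y i)) * a +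
      (1 + 1 / (1 + A) + 1 / (1 + P * y i / x)) * b = 0) : a = 0 ∧ b = 0 := by
  have nA := one_add_ne_zero hA1
  obtain ⟨k0, k1, -⟩ := quadratic_eq_zero (a := x ^ 2 * (a + b))
    (b := x * ((A + P) * a + (A * P + 1) * b)) (c := A * P * (a + b)) hy fun i => by
      have n1 := add_ne_zero_of_ne (hyx i).symm
      have n2 : x + y i * P ≠ 0 := by
        rw [mul_comm]; exact add_ne_zero_of_ne (hPyx i).symm
      have n3 := hy0 i
      have h' := h i
      field_simp at h'
      clear * - h'
      grind
  obtain rfl : a = b :=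
    CharTwo.add_eq_zero.1 ((mul_eq_zero.1 k0).resolve_left (pow_ne_zero 2 hx0))
  have : x * ((1 + A) * (1 + P)) * a = 0 := by linear_combination k1
  have := (mul_eq_zero.1 this).resolve_left (mul_ne_zero hx0 (mul_ne_zero nA (one_add_ne_zero hP1)))
  exact ⟨this, this⟩

/-- The contributions of the three ways from a spanning tree with one spoke, which lacks an edge of the
sector that follows this spoke, to a spanning tree with three spokes cancel. -/
theorem square_identity₀ {A B U V : K} (h1 : 1 + A ≠ 0) (h2 : 1 + B ≠ 0) (h3 : 1 + A * B ≠ 0)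
    (h4 : 1 + U ≠ 0) (h5 : 1 + V ≠ 0) (h6 : 1 + U * V ≠ 0) :
    (1 + 1 / (1 + A * B) + 1 / (1 + U)) * (1 + 1 / (1 + B) + 1 / (1 + V)) +
      (1 + 1 / (1 + A * B) + 1 / (1 + U * V)) * (1 / (1 + A) + 1 / (1 + V)) +
      (1 + 1 / (1 + B) + 1 / (1 + U * V)) * (1 + 1 / (1 + A) + 1 / (1 + U)) = 0 := by
  field_simp
  grind

/-- The analogue of `square_identity₀` for an edge of the sector that precedes the spoke. -/
theorem square_identity₁ {A B U V : K} (h1 : 1 + A ≠ 0) (h2 : 1 + B ≠ 0) (h3 : 1 + A * B ≠ 0)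
    (h4 : 1 + U ≠ 0) (h5 : 1 + V ≠ 0) (h6 : 1 + U * V ≠ 0) :
    (1 / (1 + A) + 1 / (1 + U * V)) * (1 / (1 + B) + 1 / (1 + V)) +
      (1 / (1 + A * B) + 1 / (1 + U * V)) * (1 + 1 / (1 + B) + 1 / (1 + U)) +
      (1 / (1 + A * B) + 1 / (1 + V)) * (1 / (1 + A) + 1 / (1 + U)) = 0 := by
  field_simp
  grind

end Char2
end BOS

/-! ### Cuts of graphs and arcs of the circle -/

namespace BOS

section Linked

variable {E X : Type} {p : E × Bool → X} {S S' : Set E} {U : X → Prop} {e f : E}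

theorem Linked.mono (hS : S ⊆ S') {x y : X} (h : Linked p S x y) : Linked p S' x y :=
  Relation.ReflTransGen.mono (fun _ _ ⟨d, hd, h⟩ => ⟨d, hS hd, h⟩) _ _ h

theorem linked_of_mem (he : e ∈ S) : Linked p S (p (e, true)) (p (e, false)) :=
  Relation.ReflTransGen.single ⟨(e, true), he, rfl, rfl⟩

theorem Linked.symm {x y : X} (h : Linked p S x y) : Linked p S y x := by
  induction h with
  | refl => exact Relation.ReflTransGen.refl
  | tail _ hs ih =>
    obtain ⟨d, hd, hx, hy⟩ := hs
    exact Relation.ReflTransGen.head ⟨rev d, hd, hy, by simpa [rev] using hx⟩ ih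

/-- Linked points lie on the same side of every set `U` that no edge in `S` leaves. -/
theorem Linked.iff_of_closed (hU : ∀ e ∈ S, U (p (e, true)) ↔ U (p (e, false))) {x y : X}
    (h : Linked p S x y) : U x ↔ U y := by
  induction h with
  | refl => rfl
  | tail _ hs ih =>
    obtain ⟨⟨e, s⟩, hd, rfl, rfl⟩ := hs
    rw [ih]
    cases s
    · exact (hU e hd).symm
    · exact hU e hd

/-- If `S ∪ {e}` is connected, then `S` has at most two components, those of the ends of `e`. -/
theorem linked_end (h : ∀ u v, Linked p (insert e S) u v) (v : X) :
    Linked p S v (p (e, true)) ∨ Linked p S v (p (e, false)) := by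
  refine (Linked.iff_of_closed (S := insert e S)
    (U := fun v => Linked p S v (p (e, true)) ∨ Linked p S v (p (e, false))) ?_
    (h (p (e, true)) v)).1 (Or.inl Relation.ReflTransGen.refl)
  rintro g (rfl | hg)
  · exact ⟨fun _ => Or.inr Relation.ReflTransGen.refl, fun _ => Or.inl Relation.ReflTransGen.refl⟩
  · have := linked_of_mem (p := p) hg
    exact ⟨Or.imp this.symm.trans this.symm.trans, Or.imp this.trans this.trans⟩

/-- If `f` joins the closed set `U` to its complement, then `U` and its complement are the components
of `S`, as soon as `S ∪ {f}` is connected. -/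
theorem linked_iff (h : ∀ u v, Linked p (insert f S) u v)
    (hU : ∀ e ∈ S, U (p (e, true)) ↔ U (p (e, false)))
    (hf : ¬ (U (p (f, true)) ↔ U (p (f, false)))) (u v : X) :
    Linked p S u v ↔ (U u ↔ U v) := by
  refine ⟨Linked.iff_of_closed hU, fun huv => ?_⟩
  rcases linked_end h u with h1 | h1 <;> rcases linked_end h v with h2 | h2
  · exact h1.trans h2.symm
  · exact absurd ((h1.iff_of_closed hU).symm.trans (huv.trans (h2.iff_of_closed hU))) hf
  · exact absurd ((h2.iff_of_closed hU).symm.trans (huv.symm.trans (h1.iff_of_closed hU))) hf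
  · exact h1.trans h2.symm

/-- Exchange of the edge `e` of a connected graph for an edge `f` between the two sides of the cut that
`e` belongs to. -/
theorem linked_exchange (h : ∀ u v, Linked p (insert e S) u v)
    (hU : ∀ e ∈ S, U (p (e, true)) ↔ U (p (e, false)))
    (hf : ¬ (U (p (f, true)) ↔ U (p (f, false)))) (u v : X) :
    Linked p (insert f S) u v := by
  have hS : S ⊆ insert f S := Set.subset_insert f S
  have hff : Linked p (insert f S) (p (f, true)) (p (f, false)) :=
    linked_of_mem (Set.mem_insert f S)
  have he : Linked p (insert f S) (p (e, true)) (p (e, false)) := by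
    rcases linked_end h (p (f, true)) with h1 | h1 <;>
      rcases linked_end h (p (f, false)) with h2 | h2
    · exact absurd ((h1.iff_of_closed hU).trans (h2.iff_of_closed hU).symm) hf
    · exact ((h1.symm.mono hS).trans hff).trans (h2.mono hS)
    · exact ((h2.symm.mono hS).trans hff.symm).trans (h1.mono hS)
    · exact absurd ((h1.iff_of_closed hU).trans (h2.iff_of_closed hU).symm) hf
  have key : ∀ v, Linked p (insert f S) v (p (e, true)) := fun v =>
    (linked_end h v).elim (Linked.mono hS) fun h => (h.mono hS).trans he.symm
  exact (key u).trans (key v).symm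

end Linked

namespace Wheel

/-- The vertices of the circle that one passes when going counter-clockwise from the edge `n` to the
edge `n'`; all vertices if `n = n'`. -/
def arc {N : ℕ} (n n' : Fin N) : Finset (Fin N) :=
  if n < n' then Finset.Ioc n n' else Finset.Ioi n ∪ Finset.Iic n'

theorem mem_arc {N : ℕ} {n n' v : Fin N} :
    v ∈ arc n n' ↔ if n < n' then n < v ∧ v ≤ n' else n < v ∨ v ≤ n' := by
  unfold arc
  split_ifs <;> simp

variable {p q r : ℕ} (h : 0 < p + q + r)

theorem wrap_succ_val {N : ℕ} (h : 0 < N) (e : Fin N) :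
    (wrap h (e + 1) : ℕ) = if (e : ℕ) + 1 = N then 0 else (e : ℕ) + 1 :=
  succ_mod e.2

theorem succ_mem_arc {N : ℕ} (h : 0 < N) {n n' e : Fin N} (h1 : e ≠ n) (h2 : e ≠ n') :
    wrap h (e + 1) ∈ arc n n' ↔ e ∈ arc n n' := by
  have := wrap_succ_val h e
  simp only [mem_arc, Fin.lt_def, Fin.le_def, this, ne_eq, Fin.ext_iff] at *
  have := e.2; have := n.2; have := n'.2
  split_ifs <;> omega

theorem mem_arc_right {N : ℕ} (n n' : Fin N) : n' ∈ arc n n' := by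
  simp only [mem_arc, Fin.lt_def, Fin.le_def]
  split_ifs <;> omega

theorem succ_mem_arc_left {N : ℕ} (h : 0 < N) (n n' : Fin N) : wrap h (n + 1) ∈ arc n n' := by
  have := wrap_succ_val h n
  simp only [mem_arc, Fin.lt_def, Fin.le_def, this]
  have := n.2; have := n'.2
  split_ifs <;> omega

theorem succ_notMem_arc {N : ℕ} (h : 0 < N) {n n' : Fin N} (hn : n ≠ n') :
    wrap h (n' + 1) ∉ arc n n' := by
  have := wrap_succ_val h n'
  simp only [mem_arc, Fin.lt_def, Fin.le_def, this, ne_eq, Fin.ext_iff] at *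
  have := n.2; have := n'.2
  split_ifs <;> omega

theorem mem_arc_comm {N : ℕ} {n n' v : Fin N} (hn : n ≠ n') : v ∈ arc n n' ↔ v ∉ arc n' n := by
  simp only [mem_arc, Fin.lt_def, Fin.le_def, ne_eq, Fin.ext_iff] at *
  split_ifs <;> omega

/-- The vertex of the circle at the outer end of a spoke. -/
def foot (i : Fin 3) : Fin (p + q + r) := wrap h (start p q i)

theorem foot_val (i : Fin 3) :
    (foot h i : ℕ) = if start p q i = p + q + r then 0 else start p q i := by
  have h1 := start_le_finish (p := p) (q := q) (r := r) i
  have h2 := finish_le (p := p) (q := q) (r := r) i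
  simp only [foot, wrap]
  split_ifs with h3
  · rw [h3, Nat.mod_self]
  · exact Nat.mod_eq_of_lt (by omega)

theorem foot_zero : (foot h 0 : ℕ) = 0 := by
  rw [foot_val, show start p q 0 = 0 from rfl]
  simp

theorem foot_one : (foot h 1 : ℕ) = if q + r = 0 then 0 else p := by
  rw [foot_val, show start p q 1 = p from rfl]
  exact if_congr (by omega) rfl rfl

theorem foot_two : (foot h 2 : ℕ) = if r = 0 then 0 else p + q := by
  rw [foot_val, show start p q 2 = p + q from rfl]
  exact if_congr (by omega) rfl rfl

set_option maxHeartbeats 1000000 in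
/-- The spokes that end on the arc between two edges in different sectors. -/
theorem foot_mem_arc {n n' : Fin (p + q + r)} (hn : sector p q n ≠ sector p q n') (i : Fin 3) :
    foot h i ∈ arc n n' ↔ (sector p q n' = sector p q n + 1 ∧ i = sector p q n + 1) ∨
      (sector p q n' = sector p q n + 2 ∧ i ≠ sector p q n) := by
  have h0 := foot_zero h
  have h1 := foot_one h
  have h2 := foot_two h
  simp only [mem_arc, Fin.lt_def, Fin.le_def]
  have := n.2; have := n'.2
  revert hn
  unfold sector
  fin_cases i <;> split_ifs at * <;> simp at * <;> omega

/-- No spoke ends on the arc between two edges in the same sector. -/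
theorem foot_notMem_arc {n n' : Fin (p + q + r)} (hn : sector p q n = sector p q n') (hlt : n < n')
    (i : Fin 3) : foot h i ∉ arc n n' := by
  have h0 := foot_zero h
  have h1 := foot_one h
  have h2 := foot_two h
  simp only [mem_arc, Fin.lt_def, Fin.le_def] at *
  have := n.2; have := n'.2
  revert hn
  unfold sector
  fin_cases i <;> split_ifs at * <;> simp at * <;> omega

end Wheel
end BOS

/-! ### Spanning trees of the wheel -/

namespace BOS
namespace Wheel
variable {p q r : ℕ} (h : 0 < p + q + r)

/-- The set of edges that consists of the spokes in `S` and of the edges of the circle that are not in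
`M`. -/
def treeOf (S : Finset (Fin 3)) (M : Finset (Fin (p + q + r))) : Finset (Edge p q r) :=
  S.disjSum Mᶜ

/-- The spokes in `S` and the edges of the circle outside `M` connect all vertices. -/
def Conn (S : Finset (Fin 3)) (M : Finset (Fin (p + q + r))) : Prop :=
  ∀ u v, Linked (src h) (treeOf S M : Set (Edge p q r)) u v

/-- The set of vertices `arc n n'`, as a predicate on all vertices. -/
def InArc (n n' : Fin (p + q + r)) (v : Option (Fin (p + q + r))) : Prop := ∃ j ∈ arc n n', v = some j

theorem inArc_some {n n' j : Fin (p + q + r)} : InArc n n' (some j) ↔ j ∈ arc n n' := by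
  simp [InArc]

theorem not_inArc_none {n n' : Fin (p + q + r)} : ¬ InArc n n' none := by simp [InArc]

variable {S : Finset (Fin 3)} {M : Finset (Fin (p + q + r))} {n n' e : Fin (p + q + r)} {f : Fin 3}

@[simp] theorem inl_mem_treeOf {i : Fin 3} : (Sum.inl i : Edge p q r) ∈ treeOf S M ↔ i ∈ S := by
  simp [treeOf]

@[simp] theorem inr_mem_treeOf {j : Fin (p + q + r)} :
    (Sum.inr j : Edge p q r) ∈ treeOf S M ↔ j ∉ M := by
  simp [treeOf]

theorem exists_treeOf (T : Finset (Edge p q r)) : ∃ S M, T = treeOf S M :=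
  ⟨T.toLeft, T.toRightᶜ, by rw [treeOf, compl_compl, Finset.toLeft_disjSum_toRight]⟩

theorem treeOf_injective {S' : Finset (Fin 3)} {M' : Finset (Fin (p + q + r))}
    (hT : treeOf S M = treeOf S' M') : S = S' ∧ M = M' := by
  constructor
  · ext i; rw [← inl_mem_treeOf (M := M), hT, inl_mem_treeOf]
  · ext j; rw [← not_iff_not, ← inr_mem_treeOf (S := S), hT, inr_mem_treeOf]

theorem card_treeOf : (treeOf S M).card = S.card + (p + q + r - M.card) := by
  simp [treeOf, Finset.card_compl]

theorem treeOf_insert_left : (treeOf (insert f S) M : Finset (Edge p q r)) =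
    insert (Sum.inl f) (treeOf S M) := by
  ext (i | j) <;> simp

theorem insert_treeOf (he : e ∉ M) : insert (Sum.inr e) (treeOf S (insert e M)) = treeOf S M := by
  ext (i | j)
  · simp
  · simp only [Finset.mem_insert, Sum.inr.injEq, inr_mem_treeOf]
    by_cases hj : j = e
    · simp [hj, he]
    · simp [hj]

theorem treeOf_erase_inr : (treeOf S M).erase (Sum.inr e) = treeOf S (insert e M) := by
  ext (i | j) <;> simp

theorem treeOf_erase_inl : (treeOf S M).erase (Sum.inl f) = treeOf (S.erase f) M := by
  ext (i | j) <;> simp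

/-- An arc between two missing edges that contains no outer end of a spoke is a union of components. -/
theorem arc_closed (hn : n ∈ M) (hn' : n' ∈ M) (hS : ∀ i ∈ S, foot h i ∉ arc n n') :
    ∀ e ∈ (treeOf S M : Set (Edge p q r)),
      InArc n n' (src h (e, true)) ↔ InArc n n' (src h (e, false)) := by
  rintro (i | j) he
  · have := hS i (by simpa using he)
    simp only [src]
    rw [inArc_some]
    exact iff_of_false not_inArc_none this
  · have : j ∉ M := by simpa using he
    simp only [src]
    rw [inArc_some, inArc_some]
    exact (succ_mem_arc h (ne_of_mem_of_not_mem hn this).symm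
      (ne_of_mem_of_not_mem hn' this).symm).symm

/-- Every arc between two missing edges contains the outer end of a spoke, since otherwise nothing would
connect it to the centre. -/
theorem exists_foot_mem_arc (hc : Conn h S M) (hn : n ∈ M) (hn' : n' ∈ M) :
    ∃ i ∈ S, foot h i ∈ arc n n' := by
  by_contra! hS
  refine not_inArc_none (n := n) (n' := n') ?_
  exact ((hc (some n') none).iff_of_closed (arc_closed h hn hn' hS)).1
    (inArc_some.2 (mem_arc_right n n'))

/-- If an edge `e` of the circle is replaced by a spoke `f` that ends on the arc cut off by removing `e`,
all vertices remain connected. -/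
theorem conn_insert (hc : Conn h S M) (he : e ∉ M) (hn : n ∈ insert e M) (hn' : n' ∈ insert e M)
    (hS : ∀ i ∈ S, foot h i ∉ arc n n') (hf : foot h f ∈ arc n n') :
    Conn h (insert f S) (insert e M) := by
  have hc' : ∀ u v, Linked (src h)
      (insert (Sum.inr e) (treeOf S (insert e M) : Set (Edge p q r))) u v := by
    rw [← Finset.coe_insert, insert_treeOf he]
    exact hc
  intro u v
  rw [treeOf_insert_left, Finset.coe_insert]
  refine linked_exchange hc' (arc_closed h hn hn' hS) (fun hh => ?_) u v
  exact not_inArc_none (hh.2 (inArc_some.2 hf))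

theorem conn_singleton (i : Fin 3) (m : Fin (p + q + r)) : Conn h {i} {m} := by
  -- The circle without `m` is a path that starts at the vertex `m + 1`.
  have step : ∀ j : Fin (p + q + r), j ≠ m →
      Linked (src h) (treeOf {i} {m} : Set (Edge p q r)) (some j) (some (wrap h (j + 1))) :=
    fun j hj => linked_of_mem (p := src h) (e := Sum.inr j) (by simpa using hj)
  have walk : ∀ n : ℕ, n < p + q + r → Linked (src h) (treeOf {i} {m} : Set (Edge p q r))
      (some (wrap h (m + 1))) (some (wrap h (m + 1 + n))) := by
    intro n
    induction n with
    | zero => intro _; exact Relation.ReflTransGen.refl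
    | succ n ih =>
      intro hn
      refine (ih (by omega)).trans ?_
      have h1 : wrap h (m + 1 + n) ≠ m := by
        intro e
        have e := congrArg Fin.val e
        simp only [wrap] at e
        have := m.2
        rcases lt_or_ge (m + 1 + n : ℕ) (p + q + r) with h2 | h2
        · rw [Nat.mod_eq_of_lt h2] at e; omega
        · rw [Nat.mod_eq_sub_mod h2, Nat.mod_eq_of_lt (by omega)] at e; omega
      have := step _ h1
      rwa [show wrap h ((wrap h (m + 1 + n) : Fin (p + q + r)) + 1) = wrap h (m + 1 + (n + 1)) from
        Fin.ext (by simp only [wrap, Nat.mod_add_mod]; rfl)] at this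
  have all : ∀ j : Fin (p + q + r), Linked (src h) (treeOf {i} {m} : Set (Edge p q r))
      (some (wrap h (m + 1))) (some j) := by
    intro j
    have hm := m.2
    have hj := j.2
    rcases lt_or_ge (m : ℕ) j with h1 | h1
    · have := walk (j - (m + 1)) (by omega)
      rwa [show (m + 1 + (j - (m + 1)) : ℕ) = j by omega, wrap_of_lt h j.2] at this
    · have := walk (j + (p + q + r) - (m + 1)) (by omega)
      rwa [show (m + 1 + (j + (p + q + r) - (m + 1)) : ℕ) = j + (p + q + r) by omega,
        show wrap h (j + (p + q + r)) = j from
          Fin.ext (by simp only [wrap, Nat.add_mod_right]; exact Nat.mod_eq_of_lt hj)] at this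
  have hub : Linked (src h) (treeOf {i} {m} : Set (Edge p q r)) none (some (foot h i)) :=
    linked_of_mem (p := src h) (e := Sum.inl i) (by simp)
  have key : ∀ v, Linked (src h) (treeOf {i} {m} : Set (Edge p q r))
      (some (wrap h (m + 1))) v := by
    rintro (_ | j)
    · exact (all _).trans hub.symm
    · exact all j
  exact fun u v => (key u).symm.trans (key v)

theorem ne_of_sector_ne {m m' : Fin (p + q + r)} (hm : sector p q m ≠ sector p q m') : m ≠ m' :=
  fun e => hm (e ▸ rfl)

theorem conn_pair {m m' : Fin (p + q + r)} (hm : sector p q m ≠ sector p q m') {a : Fin 3}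
    (ha : sector p q m = a) : Conn h {a, a + 1} {m, m'} := by
  have := conn_insert h (conn_singleton h a m) (e := m') (n := m) (n' := m') (f := a + 1)
    (by simpa using (ne_of_sector_ne hm).symm) (by simp) (by simp)
    (by
      simp only [Finset.mem_singleton, forall_eq]
      rw [foot_mem_arc h hm, ha]
      simp)
    (by
      rw [foot_mem_arc h hm, ha]
      generalize sector p q m' = b at *
      subst ha
      clear * - hm
      generalize sector p q m = a at *
      revert a b; decide)
  rwa [Finset.pair_comm, Finset.pair_comm m]

theorem conn_univ {t : Fin 3 → Fin (p + q + r)} (ht : ∀ i, sector p q (t i) = i) :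
    Conn h Finset.univ {t 0, t 1, t 2} := by
  have s : ∀ i j, i ≠ j → sector p q (t i) ≠ sector p q (t j) := fun i j => by simp [ht]
  have c := conn_pair h (s 0 2 (by decide)) (ht 0)
  have := conn_insert h c (e := t 1) (n := t 1) (n' := t 2) (f := 2)
    (by simp [ne_of_sector_ne (s 1 0 (by decide)), ne_of_sector_ne (s 1 2 (by decide))])
    (by simp) (by simp)
    (by
      intro i hi
      rw [foot_mem_arc h (s 1 2 (by decide)), ht, ht]
      revert i; decide)
    (by rw [foot_mem_arc h (s 1 2 (by decide)), ht, ht]; decide)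
  rwa [show ({2, 0, 0 + 1} : Finset (Fin 3)) = Finset.univ by decide,
    Finset.insert_comm] at this

variable {h}

theorem Conn.nonempty (hc : Conn h S M) : S.Nonempty := by
  by_contra hS
  rw [Finset.not_nonempty_iff_eq_empty] at hS
  have := (hc none (some ⟨0, h⟩)).iff_of_closed (U := fun v => v = none) (by
    rintro (i | j) he
    · simp [hS] at he
    · simp [src])
  simp at this

/-- Two missing edges cannot lie in the same sector, because the arc between them would be cut off. -/
theorem Conn.sector_ne (hc : Conn h S M) (hn : n ∈ M) (hn' : n' ∈ M) (hne : n ≠ n') :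
    sector p q n ≠ sector p q n' := by
  intro hs
  rcases lt_or_gt_of_ne hne with hlt | hlt
  · obtain ⟨i, -, hi⟩ := exists_foot_mem_arc h hc hn hn'
    exact foot_notMem_arc h hs hlt i hi
  · obtain ⟨i, -, hi⟩ := exists_foot_mem_arc h hc hn' hn
    exact foot_notMem_arc h hs.symm hlt i hi

/-- The connected sets with two spokes and two missing edges of the circle. -/
theorem Conn.exists_pair (hc : Conn h S M) (hS : S.card = 2) (hM : M.card = 2) :
    ∃ n n' : Fin (p + q + r), sector p q n ≠ sector p q n' ∧ S = {sector p q n, sector p q n + 1} ∧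
      M = {n, n'} := by
  have hS' : ∀ S : Finset (Fin 3), S.card = 2 → ∃ a, S = {a, a + 1} := by decide
  obtain ⟨a, rfl⟩ := hS' S hS
  obtain ⟨m, m', hne, rfl⟩ := Finset.card_eq_two.1 hM
  have hs := hc.sector_ne (n := m) (n' := m') (by simp) (by simp) hne
  obtain ⟨i, hi, hia⟩ := exists_foot_mem_arc h hc (n := m) (n' := m') (by simp) (by simp)
  obtain ⟨j, hj, hja⟩ := exists_foot_mem_arc h hc (n := m') (n' := m) (by simp) (by simp)
  rw [foot_mem_arc h hs] at hia
  rw [foot_mem_arc h hs.symm] at hja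
  have key : sector p q m = a ∨ sector p q m' = a := by
    clear * - hs hi hj hia hja
    simp only [Finset.mem_insert, Finset.mem_singleton] at hi hj
    generalize sector p q m = b at *
    generalize sector p q m' = c at *
    revert a b c i j
    decide
  rcases key with rfl | rfl
  · exact ⟨m, m', hs, rfl, rfl⟩
  · exact ⟨m', m, hs.symm, rfl, Finset.pair_comm _ _⟩

/-- The connected sets with three spokes and three missing edges of the circle. -/
theorem Conn.exists_triple (hc : Conn h S M) (hS : S.card = 3) (hM : M.card = 3) :
    ∃ t : Fin 3 → Fin (p + q + r), (∀ i, sector p q (t i) = i) ∧ S = Finset.univ ∧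
      M = {t 0, t 1, t 2} := by
  have hinj : Set.InjOn (fun n : Fin (p + q + r) => sector p q n) M := fun n hn n' hn' hs => by
    by_contra hne
    exact hc.sector_ne hn hn' hne hs
  have himg : M.image (fun n : Fin (p + q + r) => sector p q n) = Finset.univ := by
    rw [← Finset.card_eq_iff_eq_univ, Finset.card_image_of_injOn hinj, hM, Fintype.card_fin]
  have hex : ∀ i, ∃ n ∈ M, sector p q n = i := fun i => by
    have := Finset.mem_univ i
    rw [← himg] at this
    simpa using this
  choose t htM hts using hex
  refine ⟨t, hts, (Finset.card_eq_iff_eq_univ S).1 (by rw [hS, Fintype.card_fin]), ?_⟩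
  refine (Finset.eq_of_subset_of_card_le ?_ ?_).symm
  · simp [Finset.insert_subset_iff, htM]
  · have s : ∀ i j, i ≠ j → t i ≠ t j := fun i j hij e => hij (by rw [← hts i, e, hts])
    rw [hM, Finset.card_eq_three.2 ⟨t 0, t 1, t 2, s _ _ (by decide), s _ _ (by decide),
      s _ _ (by decide), rfl⟩]

/-- The spanning trees of the wheel. -/
theorem isSpanningTree_treeOf :
    (graph h).IsSpanningTree (treeOf S M) ↔ Conn h S M ∧ S.card = M.card := by
  have hM : M.card ≤ p + q + r := by simpa using M.card_le_univ
  have : (treeOf S M : Finset (Edge p q r)).card + 1 = Fintype.card (Option (Fin (p + q + r))) ↔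
      S.card = M.card := by
    rw [card_treeOf, Fintype.card_option, Fintype.card_fin]
    omega
  exact and_congr Iff.rfl this

theorem totalHeight_treeOf : (graph h).totalHeight (treeOf S M) = S.card + M.card := by
  have h1 : ((treeOf S M).filter fun e : Edge p q r =>
      Sum.elim (fun _ => (1 : Fin 2)) (fun _ => 0) e = 1) =
      S.map (Function.Embedding.inl : Fin 3 ↪ Edge p q r) := by
    ext (i | j) <;> simp
  have h2 : ((treeOf S M)ᶜ.filter fun e : Edge p q r =>
      Sum.elim (fun _ => (1 : Fin 2)) (fun _ => 0) e = 0) =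
      M.map (Function.Embedding.inr : Fin (p + q + r) ↪ Edge p q r) := by
    ext (i | j) <;> simp
  have h3 : (graph h).totalHeight (treeOf S M) =
      ((treeOf S M).filter fun e : Edge p q r =>
        Sum.elim (fun _ => (1 : Fin 2)) (fun _ => 0) e = 1).card +
      ((treeOf S M)ᶜ.filter fun e : Edge p q r =>
        Sum.elim (fun _ => (1 : Fin 2)) (fun _ => 0) e = 0).card := rfl
  rw [h3, h1, h2, Finset.card_map, Finset.card_map]

end Wheel
end BOS

/-! ### Cycles, cuts and the coefficient of an exchange -/

namespace BOS

/-- The vertex variables, with the base point included in such a way that the product of all of them is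
`1`. -/
def BlackGraph.weight (B : BlackGraph) (b : B.V) (v : B.V) : B.K b :=
  if hv : v ≠ b then B.vertexVar b ⟨v, hv⟩ else (∏ v, B.vertexVar b v)⁻¹

theorem BlackGraph.vertexVar_ne_zero (B : BlackGraph) (b : B.V) (v : {v : B.V // v ≠ b}) :
    B.vertexVar b v ≠ 0 := by
  unfold BlackGraph.vertexVar
  rw [Ne, FaithfulSMul.algebraMap_eq_zero_iff]
  exact MvPolynomial.X_ne_zero _

theorem BlackGraph.faceVar_ne_zero (B : BlackGraph) (b : B.V) (φ : {φ : B.F // φ ≠ B.outer}) :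
    B.faceVar b φ ≠ 0 := by
  unfold BlackGraph.faceVar
  rw [Ne, FaithfulSMul.algebraMap_eq_zero_iff]
  exact MvPolynomial.X_ne_zero _

theorem BlackGraph.prod_weight (B : BlackGraph) (b : B.V) : ∏ v, B.weight b v = 1 := by
  have h1 : ∏ v : {v : B.V // v ≠ b}, B.weight b v = ∏ v, B.vertexVar b v :=
    Finset.prod_congr rfl fun v _ => dif_pos v.2
  have h2 : B.weight b b = (∏ v, B.vertexVar b v)⁻¹ := dif_neg (by simp)
  have h3 : ∏ v, B.vertexVar b v ≠ 0 := Finset.prod_ne_zero_iff.2 fun v _ => B.vertexVar_ne_zero b v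
  rw [Fintype.prod_eq_mul_prod_subtype_ne _ b, h1, h2, inv_mul_cancel₀ h3]

theorem BlackGraph.weight_ne_zero (B : BlackGraph) (b v : B.V) : B.weight b v ≠ 0 := by
  have h := B.prod_weight b
  intro h0
  rw [Finset.prod_eq_zero (Finset.mem_univ v) h0] at h
  exact zero_ne_one h

namespace Wheel
variable {p q r : ℕ} (h : 0 < p + q + r)
variable {S : Finset (Fin 3)} {M : Finset (Fin (p + q + r))} {n n' e : Fin (p + q + r)} {f : Fin 3}

/-- The definition of the cycle, in terms of spokes and missing edges. -/
theorem mem_cycle {g : Edge p q r} :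
    g ∈ (graph h).cycle (treeOf S M) (Sum.inl f) ↔ g ∈ treeOf (insert f S) M ∧
      Linked (src h) ((treeOf (insert f S) M).erase g : Finset (Edge p q r))
        (src h (g, true)) (src h (g, false)) := by
  rw [treeOf_insert_left]
  exact Iff.rfl

/-- The faces enclosed by the cycle in `T ∪ {f}` are those in `Φ`, if the edges between `Φ` and its
complement lie on the cycle, because they can be exchanged for `f`, and if every face outside `Φ` can be
reached from the unbounded face through an edge outside `T ∪ {f}`, possibly followed by a spoke outside
`T ∪ {f}`. -/
theorem enclosed_iff {Φ : Finset (Fin 3)}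
    (hΦ : ∀ g, g ∉ M → sector p q g ∈ Φ → Conn h (insert f S) (insert g M))
    (hM : ∀ g ∈ M, sector p q g ∉ Φ)
    (hsp : ∀ i, ¬ (i ∈ Φ ↔ i - 1 ∈ Φ) → i ∈ insert f S ∧ Conn h ((insert f S).erase i) M)
    (hout : ∀ φ, φ ∉ Φ → ∃ g ∈ M, sector p q g = φ ∨
      ∃ i, i ∉ insert f S ∧ (φ = i ∧ sector p q g = i - 1 ∨ φ = i - 1 ∧ sector p q g = i))
    (φ : Option (Fin 3)) :
    (graph h).Enclosed ((graph h).cycle (treeOf S M) (Sum.inl f)) φ ↔ ∃ ψ ∈ Φ, φ = some ψ := by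
  set c : Set (Edge p q r) := (graph h).cycle (treeOf S M) (Sum.inl f) with hc
  change ¬ Linked left cᶜ none φ ↔ _
  have hclosed : ∀ g ∈ cᶜ, (∃ ψ ∈ Φ, left (g, true) = some ψ) ↔
      ∃ ψ ∈ Φ, (left (g, false) : Option (Fin 3)) = some ψ := by
    rintro (i | g) hg
    · simp only [left, Option.some.injEq, exists_eq_right']
      by_contra hi
      obtain ⟨h1, h2⟩ := hsp i hi
      refine hg ((mem_cycle h).2 ⟨inl_mem_treeOf.2 h1, ?_⟩)
      rw [treeOf_erase_inl]
      exact h2 _ _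
    · simp only [left, Option.some.injEq, exists_eq_right', reduceCtorEq, and_false, exists_false,
        iff_false]
      intro h1
      have h2 : g ∉ M := fun h2 => hM g h2 h1
      refine hg ((mem_cycle h).2 ⟨inr_mem_treeOf.2 h2, ?_⟩)
      rw [treeOf_erase_inr]
      exact hΦ g h2 h1 _ _
  constructor
  · intro hφ
    by_contra hψ
    refine hφ ?_
    obtain _ | φ := φ
    · exact Relation.ReflTransGen.refl
    · have hφ' : φ ∉ Φ := fun hh => hψ ⟨φ, hh, rfl⟩
      obtain ⟨g, hgM, hg⟩ := hout φ hφ'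
      have h1 : Linked left cᶜ none (some (sector p q g)) :=
        (linked_of_mem (p := left) (S := cᶜ) (e := (Sum.inr g : Edge p q r))
          fun hh => inr_mem_treeOf.1 ((mem_cycle h).1 hh).1 hgM).symm
      rcases hg with rfl | ⟨i, hi, hi'⟩
      · exact h1
      · have h2 : Linked left cᶜ (some i) (some (i - 1)) :=
          linked_of_mem (p := left) (S := cᶜ) (e := (Sum.inl i : Edge p q r))
            fun hh => hi (inl_mem_treeOf.1 ((mem_cycle h).1 hh).1)
        rcases hi' with ⟨rfl, hs⟩ | ⟨rfl, hs⟩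
        · rw [hs] at h1; exact h1.trans h2.symm
        · rw [hs] at h1; exact h1.trans h2
  · rintro ⟨ψ, hψ, rfl⟩ hh
    have := (hh.iff_of_closed (U := fun φ => ∃ ψ ∈ Φ, φ = some ψ) hclosed).2 ⟨ψ, hψ, rfl⟩
    simp at this

/-- The components of `T ∖ {e}` are an arc and its complement. -/
theorem linked_erase_iff (hc : Conn h (insert f S) (insert e M))
    (hn : n ∈ insert e M) (hn' : n' ∈ insert e M)
    (hS : ∀ i ∈ S, foot h i ∉ arc n n') (hf : foot h f ∈ arc n n')
    (u v : Option (Fin (p + q + r))) :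
    Linked (src h) ((treeOf S M).erase (Sum.inr e) : Finset (Edge p q r)) u v ↔
      (InArc n n' u ↔ InArc n n' v) := by
  rw [treeOf_erase_inr]
  refine linked_iff (f := Sum.inl f) ?_ (arc_closed h hn hn' hS) ?_ u v
  · rw [← Finset.coe_insert, ← treeOf_insert_left]
    exact hc
  · exact fun hh => not_inArc_none (hh.2 (inArc_some.2 hf))

/-- The product of the variables of the vertices in an arc. -/
def arcWeight (b : (graph h).V) (n n' : Fin (p + q + r)) : (graph h).K b :=
  ∏ j ∈ arc n n', (graph h).weight b (some j)

/-- The variable of a sector. -/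
def sectorVar (b : (graph h).V) (φ : Fin 3) : (graph h).K b :=
  (graph h).faceVar b ⟨some φ, by exact Option.some_ne_none φ⟩

theorem arcWeight_ne_zero (b : (graph h).V) (n n' : Fin (p + q + r)) : arcWeight h b n n' ≠ 0 :=
  Finset.prod_ne_zero_iff.2 fun _ _ => BlackGraph.weight_ne_zero _ _ _

theorem sectorVar_ne_zero (b : (graph h).V) (φ : Fin 3) : sectorVar h b φ ≠ 0 :=
  BlackGraph.faceVar_ne_zero _ _ _

open Classical in
/-- The product of the vertex variables of the component of `T ∖ {e}` without `b`. If this component is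
not the arc but its complement, the product is the inverse of the weight of the arc, since all weights
multiply to `1`. -/
theorem beta_eq (b : (graph h).V) (hc : Conn h (insert f S) (insert e M))
    (hn : n ∈ insert e M) (hn' : n' ∈ insert e M)
    (hS : ∀ i ∈ S, foot h i ∉ arc n n') (hf : foot h f ∈ arc n n') :
    (graph h).beta b (treeOf S M) (Sum.inr e) =
      if InArc n n' b then (arcWeight h b n n')⁻¹ else arcWeight h b n n' := by
  have h1 : (graph h).beta b (treeOf S M) (Sum.inr e) =
      ∏ v : {v : (graph h).V // v ≠ b},
        if InArc n n' v.1 ↔ InArc n n' b then 1 else (graph h).weight b v := by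
    refine Finset.prod_congr rfl fun v _ => ?_
    have hw : (graph h).weight b v = (graph h).vertexVar b v := dif_pos v.2
    rw [hw]
    exact if_congr (linked_erase_iff h hc hn hn' hS hf v.1 b) rfl rfl
  have h2 : ∏ v : (graph h).V, (if InArc n n' v ↔ InArc n n' b then 1 else (graph h).weight b v) =
      ∏ v : {v : (graph h).V // v ≠ b},
        if InArc n n' v.1 ↔ InArc n n' b then 1 else (graph h).weight b v := by
    rw [Fintype.prod_eq_mul_prod_subtype_ne _ b, if_pos Iff.rfl, one_mul]
  have h3 : ∏ v : (graph h).V, (if InArc n n' v then (graph h).weight b v else 1) =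
      arcWeight h b n n' := by
    change ∏ v : Option (Fin (p + q + r)), (if InArc n n' v then (graph h).weight b v else 1) = _
    rw [Fintype.prod_option, if_neg not_inArc_none, one_mul, arcWeight, ← Finset.prod_filter]
    refine Finset.prod_congr ?_ fun _ _ => rfl
    ext j
    simp [inArc_some]
  rw [h1, ← h2]
  split_ifs with hb
  · refine eq_inv_of_mul_eq_one_left ?_
    rw [← h3, ← Finset.prod_mul_distrib]
    refine Eq.trans ?_ ((graph h).prod_weight b)
    refine Finset.prod_congr rfl fun v _ => ?_
    by_cases hv : InArc n n' v <;> simp [hv, hb]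
  · rw [← h3]
    refine Finset.prod_congr rfl fun v _ => ?_
    by_cases hv : InArc n n' v <;> simp [hv, hb]

/-- The data of a pair of spanning trees `T` and `T ∖ {e} ∪ {f}`: the arc from the edge `n` to the edge
`n'` is the component of `T ∖ {e}` without the centre, and `Φ` is the set of faces that are enclosed by
the cycle in `T ∪ {f}`. Here `T` has the spokes `S` and lacks the edges `M` of the circle. The fields
are the hypotheses of `linked_erase_iff` and of `enclosed_iff`, together with the position of `e`. -/
structure Move (S : Finset (Fin 3)) (M : Finset (Fin (p + q + r))) (e n n' : Fin (p + q + r))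
    (f : Fin 3) (Φ : Finset (Fin 3)) : Prop where
  conn : Conn h (insert f S) (insert e M)
  left_mem : n ∈ insert e M
  right_mem : n' ∈ insert e M
  foot_notMem : ∀ i ∈ S, foot h i ∉ arc n n'
  foot_mem : foot h f ∈ arc n n'
  conn_of_sector_mem : ∀ g, g ∉ M → sector p q g ∈ Φ → Conn h (insert f S) (insert g M)
  sector_notMem : ∀ g ∈ M, sector p q g ∉ Φ
  conn_erase : ∀ i, ¬ (i ∈ Φ ↔ i - 1 ∈ Φ) → i ∈ insert f S ∧ Conn h ((insert f S).erase i) M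
  exists_notMem : ∀ φ, φ ∉ Φ → ∃ g ∈ M, sector p q g = φ ∨
      ∃ i, i ∉ insert f S ∧ (φ = i ∧ sector p q g = i - 1 ∨ φ = i - 1 ∧ sector p q g = i)
  sector_mem : sector p q e ∈ Φ

variable {h} {Φ : Finset (Fin 3)}

/-- The edge `e` is counter-clockwise on the boundary of its sector, which is enclosed, so that the dart in
the definition of the orientation ends at the vertex `e + 1`. -/
theorem Move.counterClockwise_iff (m : Move h S M e n n' f Φ) (b : (graph h).V) :
    (graph h).CounterClockwise (treeOf S M) (Sum.inr e) (Sum.inl f) b ↔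
      ¬ (wrap h (e + 1) ∈ arc n n' ↔ InArc n n' b) := by
  have henc := enclosed_iff h m.conn_of_sector_mem m.sector_notMem m.conn_erase m.exists_notMem
  have hlink := linked_erase_iff h m.conn m.left_mem m.right_mem m.foot_notMem m.foot_mem
  constructor
  · rintro ⟨_ | _, h1, h2⟩
    · have := (henc none).1 h1
      simp at this
    · exact fun hh => h2 ((hlink (some (wrap h (e + 1))) b).2 (by rw [inArc_some]; exact hh))
  · intro hb
    refine ⟨true, (henc (some (sector p q e))).2 ⟨_, m.sector_mem, rfl⟩, fun hh => hb ?_⟩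
    have := (hlink (some (wrap h (e + 1))) b).1 hh
    rwa [inArc_some] at this

open Classical in
theorem Move.alpha_eq (m : Move h S M e n n' f Φ) (b : (graph h).V) :
    (graph h).alpha b (treeOf S M) (Sum.inr e) (Sum.inl f) =
      if wrap h (e + 1) ∈ arc n n' ↔ InArc n n' b then (∏ φ ∈ Φ, sectorVar h b φ)⁻¹
      else ∏ φ ∈ Φ, sectorVar h b φ := by
  have henc := enclosed_iff h m.conn_of_sector_mem m.sector_notMem m.conn_erase m.exists_notMem
  have h1 : ∀ g : Fin 3 → (graph h).K b, ∏ φ : {φ : (graph h).F // φ ≠ (graph h).outer},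
      (if (graph h).Enclosed ((graph h).cycle (treeOf S M) (Sum.inl f)) φ.1 then
        φ.1.elim 1 g else 1) = ∏ φ ∈ Φ, g φ := by
    intro g
    have h2 : ∏ φ : (graph h).F,
      (if (graph h).Enclosed ((graph h).cycle (treeOf S M) (Sum.inl f)) φ then
        φ.elim 1 g else 1) = ∏ φ ∈ Φ, g φ := by
      change ∏ φ : Option (Fin 3), _ = _
      rw [Fintype.prod_option, ← Finset.prod_filter]
      simp only [Option.elim, ite_self, one_mul]
      refine Finset.prod_congr ?_ fun _ _ => rfl
      ext φ
      simp [henc]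
    rw [← h2, Fintype.prod_eq_mul_prod_subtype_ne _ (graph h).outer]
    refine (one_mul _).symm.trans (congrArg₂ _ ?_ rfl)
    exact (ite_self _).symm
  unfold BlackGraph.alpha
  rw [m.counterClockwise_iff]
  split_ifs with hb
  · rw [← Finset.prod_inv_distrib, ← h1]
    refine Finset.prod_congr rfl ?_
    rintro ⟨_ | φ, hφ⟩ _
    · exact absurd rfl hφ
    · rfl
  · rw [← h1]
    refine Finset.prod_congr rfl ?_
    rintro ⟨_ | φ, hφ⟩ _
    · exact absurd rfl hφ
    · rfl

/-- Inverting the argument of `1 / (1 + x)` adds `1`, so that inverting both `α` and `β` does not change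
a coefficient of `Ψ`. -/
theorem inv_term {K : Type*} [Field K] [CharP K 2] {x : K} (h0 : x ≠ 0) (h1 : x ≠ 1) :
    1 / (1 + x⁻¹) = 1 + 1 / (1 + x) := by
  have := one_add_ne_zero h1
  have : x + 1 ≠ 0 := by rwa [add_comm]
  field_simp
  grind

/-- The coefficient of `Ψ` for a move in which the edge `e` is the start of the arc. It does not depend on
the position of the base point. -/
theorem Move.term_eq_left (m : Move h S M e e n' f Φ) (b : (graph h).V)
    (hΦ : ∏ φ ∈ Φ, sectorVar h b φ ≠ 1) (hX : arcWeight h b e n' ≠ 1) :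
    1 / (1 + (graph h).alpha b (treeOf S M) (Sum.inr e) (Sum.inl f)) +
      1 / (1 + (graph h).beta b (treeOf S M) (Sum.inr e)) =
    1 / (1 + ∏ φ ∈ Φ, sectorVar h b φ) + 1 / (1 + arcWeight h b e n') := by
  classical
  have hΦ0 : ∏ φ ∈ Φ, sectorVar h b φ ≠ 0 :=
    Finset.prod_ne_zero_iff.2 fun _ _ => sectorVar_ne_zero _ _ _
  rw [m.alpha_eq, beta_eq h b m.conn m.left_mem m.right_mem m.foot_notMem m.foot_mem]
  have hs := succ_mem_arc_left h e n'
  by_cases hb : InArc e n' b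
  · rw [if_pos (iff_of_true hs hb), if_pos hb]
    rw [inv_term hΦ0 hΦ, inv_term (arcWeight_ne_zero h b e n') hX]
    grind
  · rw [if_neg fun hh => hb (hh.1 hs), if_neg hb]

/-- The coefficient of `Ψ` for a move in which the edge `e` is the end of the arc. In comparison with
`Move.term_eq_left` the orientation is reversed, which adds `1`. -/
theorem Move.term_eq_right (m : Move h S M e n e f Φ) (b : (graph h).V) (hne : n ≠ e)
    (hΦ : ∏ φ ∈ Φ, sectorVar h b φ ≠ 1) (hX : arcWeight h b n e ≠ 1) :
    1 / (1 + (graph h).alpha b (treeOf S M) (Sum.inr e) (Sum.inl f)) +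
      1 / (1 + (graph h).beta b (treeOf S M) (Sum.inr e)) =
    1 + 1 / (1 + ∏ φ ∈ Φ, sectorVar h b φ) + 1 / (1 + arcWeight h b n e) := by
  classical
  have hΦ0 : ∏ φ ∈ Φ, sectorVar h b φ ≠ 0 :=
    Finset.prod_ne_zero_iff.2 fun _ _ => sectorVar_ne_zero _ _ _
  rw [m.alpha_eq, beta_eq h b m.conn m.left_mem m.right_mem m.foot_notMem m.foot_mem]
  have hs := succ_notMem_arc h hne
  by_cases hb : InArc n e b
  · rw [if_neg fun hh => hs (hh.2 hb), if_pos hb]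
    rw [inv_term (arcWeight_ne_zero h b n e) hX]
    ring
  · rw [if_pos (iff_of_false hs hb), if_neg hb]
    rw [inv_term hΦ0 hΦ]

end Wheel
end BOS

/-! ### The exchanges between spanning trees of the wheel -/

namespace BOS
namespace Wheel
variable {p q r : ℕ} {h : 0 < p + q + r}
variable {S S' : Finset (Fin 3)} {M M' : Finset (Fin (p + q + r))} {m m' n n' e : Fin (p + q + r)}
  {f : Fin 3}

theorem conn_pair_insert {a s : Fin 3} (ha : sector p q m = a) (hm : sector p q m ≠ sector p q m')
    (hs : insert f {s} = ({a, a + 1} : Finset (Fin 3))) : Conn h (insert f {s}) {m, m'} := by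
  rw [hs]; exact conn_pair h hm ha

/-- The exchange of the edge `m'` for a second spoke in the spanning tree with the spoke `s` that lacks
`m`, where the two spokes bound the sector `a` of `m`. The cycle encloses the other two sectors. -/
theorem move_compl {a s : Fin 3} (ha : sector p q m = a) (hm : sector p q m ≠ sector p q m')
    (hs : insert f {s} = ({a, a + 1} : Finset (Fin 3)))
    (hn : n ∈ ({m', m} : Finset (Fin (p + q + r)))) (hn' : n' ∈ ({m', m} : Finset (Fin (p + q + r))))
    (hsn : foot h s ∉ arc n n') (hf : foot h f ∈ arc n n') :
    Move h {s} {m} m' n n' f {a}ᶜ where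
  conn := by
    rw [Finset.pair_comm m' m]
    exact conn_pair_insert ha hm hs
  left_mem := hn
  right_mem := hn'
  foot_notMem := by simpa using hsn
  foot_mem := hf
  conn_of_sector_mem g _ hg := by
    have hg' : sector p q g ≠ a := by simpa using hg
    rw [Finset.pair_comm g m]
    exact conn_pair_insert ha (by rw [ha]; exact hg'.symm) hs
  sector_notMem := by simp [ha]
  conn_erase i hi := by
    have : i ∈ (insert f {s} : Finset (Fin 3)) ∧ ∃ s', (insert f {s} : Finset (Fin 3)).erase i = {s'} := by
      rw [hs]; clear * - hi; revert a i; decide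
    obtain ⟨h1, s', h2⟩ := this
    exact ⟨h1, by rw [h2]; exact conn_singleton h s' m⟩
  exists_notMem φ hφ := ⟨m, by simp, Or.inl (by rw [ha]; simpa using Eq.symm (by simpa using hφ))⟩
  sector_mem := by rw [← ha]; simpa using hm.symm

/-- The exchange of the edge `m` for a second spoke in the spanning tree with the spoke `s` that lacks
`m'`, where the two spokes bound the sector `a` of `m`. The cycle encloses this sector. -/
theorem move_self {a s : Fin 3} (ha : sector p q m = a) (hm : sector p q m ≠ sector p q m')
    (hs : insert f {s} = ({a, a + 1} : Finset (Fin 3)))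
    (hn : n ∈ ({m, m'} : Finset (Fin (p + q + r)))) (hn' : n' ∈ ({m, m'} : Finset (Fin (p + q + r))))
    (hsn : foot h s ∉ arc n n') (hf : foot h f ∈ arc n n') :
    Move h {s} {m'} m n n' f {a} where
  conn := conn_pair_insert ha hm hs
  left_mem := hn
  right_mem := hn'
  foot_notMem := by simpa using hsn
  foot_mem := hf
  conn_of_sector_mem g _ hg := by
    have hg' : sector p q g = a := by simpa using hg
    exact conn_pair_insert hg' (by rw [hg', ← ha]; exact hm) hs
  sector_notMem := by simpa [← ha] using hm.symm
  conn_erase i hi := by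
    have : i ∈ (insert f {s} : Finset (Fin 3)) ∧ ∃ s', (insert f {s} : Finset (Fin 3)).erase i = {s'} := by
      rw [hs]; clear * - hi; revert a i; decide
    obtain ⟨h1, s', h2⟩ := this
    exact ⟨h1, by rw [h2]; exact conn_singleton h s' m'⟩
  exists_notMem φ hφ := by
    refine ⟨m', by simp, ?_⟩
    rw [hs]
    rw [ha] at hm
    generalize sector p q m' = c at *
    clear * - hφ hm
    revert a φ c; decide
  sector_mem := by simpa using ha

theorem image_fin_three {X : Type*} [DecidableEq X] (t : Fin 3 → X) :
    Finset.univ.image t = {t 0, t 1, t 2} := by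
  ext x; simp [Fin.exists_fin_succ, eq_comm]

theorem conn_triple {t : Fin 3 → Fin (p + q + r)} (ht : ∀ i, sector p q (t i) = i) :
    Conn h Finset.univ (Finset.univ.image t) := by
  rw [image_fin_three]; exact conn_univ h ht

theorem sector_apply_ne {t : Fin 3 → Fin (p + q + r)} (ht : ∀ i, sector p q (t i) = i) {i j : Fin 3}
    (hij : i ≠ j) : sector p q (t i) ≠ sector p q (t j) := by rwa [ht, ht]

/-- The exchange of the edge `t j` for the third spoke `i + 2` in a spanning tree with two spokes. -/
theorem move_triple {t : Fin 3 → Fin (p + q + r)} (ht : ∀ i, sector p q (t i) = i) (i j : Fin 3)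
    (hj : j ≠ i) : Move h {i, i + 1} ((Finset.univ.erase j).image t) (t j) (t (i + 1)) (t (i + 2))
      (i + 2) {j} := by
  have h1 : insert (i + 2) {i, i + 1} = (Finset.univ : Finset (Fin 3)) := by clear * -; revert i; decide
  have h2 : ∀ (t : Fin 3 → Fin (p + q + r)) (j : Fin 3),
      insert (t j) ((Finset.univ.erase j).image t) = Finset.univ.image t := fun t j => by
    rw [← Finset.image_insert, Finset.insert_erase (Finset.mem_univ j)]
  have h3 : i + 1 ≠ i + 2 := by clear * -; revert i; decide
  refine ⟨?_, ?_, ?_, ?_, ?_, ?_, ?_, ?_, ?_, ?_⟩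
  · rw [h1, h2]; exact conn_triple ht
  · rw [h2]; simp
  · rw [h2]; simp
  · intro i' hi'
    rw [foot_mem_arc h (sector_apply_ne ht h3), ht, ht]
    clear * - hi'
    revert i i'; decide
  · rw [foot_mem_arc h (sector_apply_ne ht h3), ht, ht]
    clear * -
    revert i; decide
  · intro g _ hg
    rw [h1]
    have hg' : sector p q g = j := by simpa using hg
    have := h2 (Function.update t j g) j
    rw [Function.update_self, Finset.image_congr (g := t)] at this
    · rw [this]
      refine conn_triple fun i' => ?_
      by_cases hi' : i' = j
      · subst hi'; simpa using hg'
      · rw [Function.update_of_ne hi', ht]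
    · intro i' hi'
      exact Function.update_of_ne (by simpa using hi') _ _
  · intro g hg
    simp only [Finset.mem_image, Finset.mem_erase, Finset.mem_univ, and_true] at hg
    obtain ⟨i', hi', rfl⟩ := hg
    simpa [ht] using hi'
  · intro i' hi'
    rw [h1]
    refine ⟨Finset.mem_univ _, ?_⟩
    have : ∃ a a', a ≠ a' ∧ Finset.univ.erase i' = ({a, a + 1} : Finset (Fin 3)) ∧
        Finset.univ.erase j = ({a, a'} : Finset (Fin 3)) := by
      clear * - hi'
      revert j i'; decide
    obtain ⟨a, a', h4, h5, h6⟩ := this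
    rw [h5, h6, Finset.image_insert, Finset.image_singleton]
    exact conn_pair h (sector_apply_ne ht h4) (ht a)
  · intro φ hφ
    refine ⟨t φ, ?_, Or.inl (ht φ)⟩
    exact Finset.mem_image_of_mem t (by simpa using hφ)
  · simp [ht]

open Classical in
/-- The definition of the coefficient, with the heights of the edges of the wheel. -/
theorem coeff_eq_sum (b : (graph h).V) (T T' : Finset (Edge p q r)) :
    (graph h).coeff b T T' = ∑ e : Edge p q r, ∑ f : Edge p q r,
      if e ∈ T ∧ Sum.elim (fun _ => (1 : Fin 2)) (fun _ => 0) e = 0 ∧ f ∉ T ∧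
        Sum.elim (fun _ => (1 : Fin 2)) (fun _ => 0) f = 1 ∧ T' = insert f (T.erase e) then
        1 / (1 + (graph h).alpha b T e f) + 1 / (1 + (graph h).beta b T e) else 0 := by
  refine Finset.sum_congr rfl fun e _ => Finset.sum_congr rfl fun f _ => ?_
  by_cases hc : e ∈ T ∧ Sum.elim (fun _ => (1 : Fin 2)) (fun _ => 0) e = 0 ∧ f ∉ T ∧
      Sum.elim (fun _ => (1 : Fin 2)) (fun _ => 0) f = 1 ∧ T' = insert f (T.erase e)
  · exact (if_pos hc).trans (if_pos hc).symm
  · exact (if_neg hc).trans (if_neg hc).symm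

/-- The condition that the coefficient of `Ψ` between two given sets of edges is not zero. -/
theorem coeff_condition_iff {x y : Edge p q r} :
    (x ∈ treeOf S M ∧ Sum.elim (fun _ => (1 : Fin 2)) (fun _ => 0) x = 0 ∧ y ∉ treeOf S M ∧
      Sum.elim (fun _ => (1 : Fin 2)) (fun _ => 0) y = 1 ∧
      treeOf S' M' = insert y ((treeOf S M).erase x)) ↔
    ∃ e f, x = Sum.inr e ∧ y = Sum.inl f ∧ e ∉ M ∧ f ∉ S ∧ S' = insert f S ∧ M' = insert e M := by
  constructor
  · rintro ⟨h1, h2, h3, h4, h5⟩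
    obtain i | e := x
    · simp at h2
    obtain f | j := y
    · rw [treeOf_erase_inr, ← treeOf_insert_left] at h5
      obtain ⟨h6, h7⟩ := treeOf_injective h5
      exact ⟨e, f, rfl, rfl, by simpa using h1, by simpa using h3, h6, h7⟩
    · simp at h4
  · rintro ⟨e, f, rfl, rfl, h1, h2, rfl, rfl⟩
    refine ⟨by simpa using h1, rfl, by simpa using h2, rfl, ?_⟩
    rw [treeOf_erase_inr, ← treeOf_insert_left]

theorem coeff_eq_zero (b : (graph h).V)
    (hne : ∀ e f, e ∉ M → f ∉ S → S' = insert f S → M' ≠ insert e M) :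
    (graph h).coeff b (treeOf S M) (treeOf S' M') = 0 := by
  rw [coeff_eq_sum]
  refine Finset.sum_eq_zero fun x _ => Finset.sum_eq_zero fun y _ => if_neg fun hh => ?_
  obtain ⟨e, f, -, -, h1, h2, h3, h4⟩ := coeff_condition_iff.1 hh
  exact hne e f h1 h2 h3 h4

theorem coeff_eq (b : (graph h).V) (he : e ∉ M) (hf : f ∉ S) :
    (graph h).coeff b (treeOf S M) (treeOf (insert f S) (insert e M)) =
      1 / (1 + (graph h).alpha b (treeOf S M) (Sum.inr e) (Sum.inl f)) +
      1 / (1 + (graph h).beta b (treeOf S M) (Sum.inr e)) := by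
  rw [coeff_eq_sum, Finset.sum_eq_single (Sum.inr e), Finset.sum_eq_single (Sum.inl f), if_pos]
  · exact coeff_condition_iff.2 ⟨e, f, rfl, rfl, he, hf, rfl, rfl⟩
  · intro y _ hy
    refine if_neg fun hh => hy ?_
    obtain ⟨e', f', -, rfl, -, h2, h3, -⟩ := coeff_condition_iff.1 hh
    have : f ∈ insert f' S := h3 ▸ Finset.mem_insert_self f S
    rw [(Finset.mem_insert.1 this).resolve_right hf]
  · exact fun hh => absurd (Finset.mem_univ _) hh
  · intro x _ hx
    refine Finset.sum_eq_zero fun y _ => if_neg fun hh => hx ?_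
    obtain ⟨e', f', rfl, -, h1, -, -, h4⟩ := coeff_condition_iff.1 hh
    have : e ∈ insert e' M := h4 ▸ Finset.mem_insert_self e M
    rw [(Finset.mem_insert.1 this).resolve_right he]
  · exact fun hh => absurd (Finset.mem_univ _) hh

end Wheel
end BOS

/-! ### Relations that the variables do not satisfy -/

namespace BOS

/-- The fraction `x` of polynomials takes the value `a` under the substitution `φ`. -/
def Specializes {R K L : Type*} [CommRing R] [Field K] [Algebra R K] [Field L] (φ : R →+* L) (x : K)
    (a : L) : Prop :=
  ∃ r s : R, φ s ≠ 0 ∧ x = algebraMap R K r / algebraMap R K s ∧ a = φ r / φ s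

namespace Specializes
variable {R K L : Type*} [CommRing R] [Field K] [Algebra R K] [Field L]
  {φ : R →+* L} {x y : K} {a c : L}

theorem of_ring (r : R) : Specializes φ (algebraMap R K r) (φ r) :=
  ⟨r, 1, by simp, by simp, by simp⟩

theorem zero : Specializes φ (0 : K) 0 := by simpa using Specializes.of_ring (K := K) (φ := φ) 0

theorem one : Specializes φ (1 : K) 1 := by simpa using Specializes.of_ring (K := K) (φ := φ) 1

theorem mul (hx : Specializes φ x a) (hy : Specializes φ y c) : Specializes φ (x * y) (a * c) := by
  obtain ⟨r, s, hs, rfl, rfl⟩ := hx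
  obtain ⟨r', s', hs', rfl, rfl⟩ := hy
  refine ⟨r * r', s * s', ?_, ?_, ?_⟩
  · rw [map_mul]; exact mul_ne_zero hs hs'
  · rw [div_mul_div_comm]; simp only [map_mul]
  · rw [div_mul_div_comm]; simp only [map_mul]

theorem inv (hx : Specializes φ x a) (ha : a ≠ 0) : Specializes φ x⁻¹ a⁻¹ := by
  obtain ⟨r, s, hs, rfl, rfl⟩ := hx
  refine ⟨s, r, ?_, by simp, by simp⟩
  rintro hr
  simp [hr] at ha

theorem pow (hx : Specializes φ x a) (n : ℕ) : Specializes φ (x ^ n) (a ^ n) := by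
  induction n with
  | zero => simpa using one
  | succ n ih => rw [pow_succ, pow_succ]; exact ih.mul hx

theorem prod {ι : Type*} {s : Finset ι} {x : ι → K} {a : ι → L} (hx : ∀ i ∈ s, Specializes φ (x i) (a i)) :
    Specializes φ (∏ i ∈ s, x i) (∏ i ∈ s, a i) := by
  classical
  induction s using Finset.induction_on with
  | empty => simpa using one
  | insert i s hi ih =>
    rw [Finset.prod_insert hi, Finset.prod_insert hi]
    exact (hx i (by simp)).mul (ih fun j hj => hx j (by simp [hj]))

variable [IsFractionRing R K]

theorem ne_zero_of_map {s : R} (hs : φ s ≠ 0) : algebraMap R K s ≠ 0 := by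
  rw [Ne, FaithfulSMul.algebraMap_eq_zero_iff]
  rintro rfl
  exact hs (map_zero φ)

theorem add (hx : Specializes φ x a) (hy : Specializes φ y c) : Specializes φ (x + y) (a + c) := by
  obtain ⟨r, s, hs, rfl, rfl⟩ := hx
  obtain ⟨r', s', hs', rfl, rfl⟩ := hy
  refine ⟨r * s' + s * r', s * s', ?_, ?_, ?_⟩
  · rw [map_mul]; exact mul_ne_zero hs hs'
  · rw [div_add_div _ _ (ne_zero_of_map hs) (ne_zero_of_map hs')]; simp only [map_add, map_mul]
  · rw [div_add_div _ _ hs hs']; simp only [map_add, map_mul]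

theorem unique (hx : Specializes φ x a) (hy : Specializes φ x c) : a = c := by
  obtain ⟨r, s, hs, rfl, rfl⟩ := hx
  obtain ⟨r', s', hs', h, rfl⟩ := hy
  rw [div_eq_div_iff (ne_zero_of_map hs) (ne_zero_of_map hs'), ← map_mul, ← map_mul] at h
  have := congrArg φ (IsFractionRing.injective R K h)
  rw [div_eq_div_iff hs hs', ← map_mul, ← map_mul, this]

/-- Fractions with different values are different. -/
theorem ne (hx : Specializes φ x a) (hy : Specializes φ y c) (h : a ≠ c) : x ≠ y :=
  fun e => h (hx.unique (e ▸ hy))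

end Specializes

/-- The values of the vertex and face variables can be prescribed, as long as the product of the values of
the weights is `1`. -/
theorem BlackGraph.exists_specializes (B : BlackGraph) (b : B.V) {L : Type} [Field L] [CharP L 2]
    (val : B.V → L) (hval : ∀ v, val v ≠ 0) (hprod : ∏ v, val v = 1) (col : B.F → L) :
    ∃ φ : MvPolynomial ({v : B.V // v ≠ b} ⊕ {φ : B.F // φ ≠ B.outer}) (ZMod 2) →+* L,
      (∀ v, Specializes φ (B.weight b v) (val v)) ∧
      ∀ ψ, Specializes φ (B.faceVar b ψ) (col ψ) := by
  let g : {v : B.V // v ≠ b} ⊕ {φ : B.F // φ ≠ B.outer} → L :=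
    Sum.elim (fun v => val v.1) (fun ψ => col ψ.1)
  have h1 : ∀ v, Specializes (MvPolynomial.eval₂Hom (ZMod.castHom dvd_rfl L) g)
      (B.vertexVar b v) (val v) := fun v => by
    have := Specializes.of_ring (K := B.K b)
      (φ := MvPolynomial.eval₂Hom (ZMod.castHom dvd_rfl L) g) (MvPolynomial.X (Sum.inl v))
    rwa [MvPolynomial.eval₂Hom_X'] at this
  refine ⟨MvPolynomial.eval₂Hom (ZMod.castHom dvd_rfl L) g, fun v => ?_, fun ψ => ?_⟩
  · by_cases hv : v ≠ b
    · rw [BlackGraph.weight, dif_pos hv]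
      exact h1 ⟨v, hv⟩
    · rw [BlackGraph.weight, dif_neg hv]
      obtain rfl : v = b := not_not.1 hv
      have h2 := (Specializes.prod (s := Finset.univ) fun u _ => h1 u).inv
        (Finset.prod_ne_zero_iff.2 fun u _ => hval u.1)
      rw [Fintype.prod_eq_mul_prod_subtype_ne _ v] at hprod
      rwa [← eq_inv_of_mul_eq_one_left hprod] at h2
  · have := Specializes.of_ring (K := B.K b)
      (φ := MvPolynomial.eval₂Hom (ZMod.castHom dvd_rfl L) g) (MvPolynomial.X (Sum.inr ψ))
    rwa [MvPolynomial.eval₂Hom_X'] at this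

/-- A primitive third root of unity in characteristic two serves as a value different from `0` and `1`. -/
theorem exists_cube_root : ∃ ω : AlgebraicClosure (ZMod 2), ω ^ 2 + ω + 1 = 0 := by
  obtain ⟨ω, hω⟩ := IsAlgClosed.exists_root
    (Polynomial.X ^ 2 + Polynomial.X + 1 : Polynomial (AlgebraicClosure (ZMod 2))) (by
      have : (Polynomial.X ^ 2 + Polynomial.X + 1 :
        Polynomial (AlgebraicClosure (ZMod 2))).degree = 2 := by compute_degree!
      rw [this]; norm_num)
  exact ⟨ω, by simpa using hω⟩

namespace Wheel
variable {p q r : ℕ} (h : 0 < p + q + r)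

/-- The values of the variables of the vertices of the circle, weighted as above, and of the bounded faces
can be prescribed. -/
theorem exists_specializes (b : (graph h).V) {L : Type} [Field L] [CharP L 2]
    (val : Fin (p + q + r) → L) (hval : ∀ v, val v ≠ 0) (col : Fin 3 → L) :
    ∃ φ : MvPolynomial ({v : (graph h).V // v ≠ b} ⊕ {φ : (graph h).F // φ ≠ (graph h).outer}) (ZMod 2)
        →+* L,
      (∀ j, Specializes φ ((graph h).weight b (some j)) (val j)) ∧
      ∀ ψ, Specializes φ (sectorVar h b ψ) (col ψ) := by
  have h0 : ∏ j, val j ≠ 0 := Finset.prod_ne_zero_iff.2 fun j _ => hval j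
  obtain ⟨φ, h1, h2⟩ := (graph h).exists_specializes b (L := L)
    (fun v => Option.elim (v : Option (Fin (p + q + r))) (∏ j, val j)⁻¹ val)
    (by
      rintro (_ | j)
      · exact inv_ne_zero h0
      · exact hval j)
    (by
      refine (Fintype.prod_option _).trans ?_
      exact inv_mul_cancel₀ h0)
    (fun ψ => Option.elim (ψ : Option (Fin 3)) 1 col)
  exact ⟨φ, fun j => h1 (some j), fun ψ => h2 ⟨some ψ, Option.some_ne_none ψ⟩⟩

theorem prod_weight_ne_one (b : (graph h).V) {U : Finset (Fin (p + q + r))} (hU : U.Nonempty) :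
    ∏ j ∈ U, (graph h).weight b (some j) ≠ 1 := by
  obtain ⟨ω, hω⟩ := exists_cube_root
  obtain ⟨u, hu⟩ := hU
  obtain ⟨φ, h1, -⟩ := exists_specializes h b (Function.update 1 u ω)
    (by intro v; by_cases hv : v = u
        · subst hv; rw [Function.update_self]; rintro rfl; simp at hω
        · rw [Function.update_of_ne hv]; exact one_ne_zero) 1
  refine (Specializes.prod fun j _ => h1 j).ne Specializes.one ?_
  rw [Finset.prod_update_of_mem hu]
  simp only [Pi.one_apply, Finset.prod_const_one, mul_one]
  rintro rfl
  have : (1 : AlgebraicClosure (ZMod 2)) + 1 = 0 := CharTwo.add_self_eq_zero 1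
  simp [this] at hω

theorem prod_sectorVar_ne_one (b : (graph h).V) {Φ : Finset (Fin 3)} (hΦ : Φ.Nonempty) :
    ∏ φ ∈ Φ, sectorVar h b φ ≠ 1 := by
  obtain ⟨ω, hω⟩ := exists_cube_root
  obtain ⟨u, hu⟩ := hΦ
  obtain ⟨φ, -, h1⟩ := exists_specializes h b (L := AlgebraicClosure (ZMod 2)) 1
    (fun _ => one_ne_zero) (Function.update 1 u ω)
  refine (Specializes.prod fun j _ => h1 j).ne Specializes.one ?_
  rw [Finset.prod_update_of_mem hu]
  simp only [Pi.one_apply, Finset.prod_const_one, mul_one]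
  rintro rfl
  have : (1 : AlgebraicClosure (ZMod 2)) + 1 = 0 := CharTwo.add_self_eq_zero 1
  simp [this] at hω

/-- The product of the weights of the vertices of the circle up to the vertex `m`. -/
def partialWeight (b : (graph h).V) (m : Fin (p + q + r)) : (graph h).K b :=
  ∏ j ∈ Finset.Iic m, (graph h).weight b (some j)

/-- The product of the weights of the vertices of the circle. -/
def circleWeight (b : (graph h).V) : (graph h).K b := ∏ j, (graph h).weight b (some j)

variable {h}
variable {b : (graph h).V} {m m' : Fin (p + q + r)}

theorem partialWeight_ne_zero (b : (graph h).V) (m : Fin (p + q + r)) : partialWeight h b m ≠ 0 :=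
  Finset.prod_ne_zero_iff.2 fun _ _ => BlackGraph.weight_ne_zero _ _ _

theorem circleWeight_ne_zero (b : (graph h).V) : circleWeight h b ≠ 0 :=
  Finset.prod_ne_zero_iff.2 fun _ _ => BlackGraph.weight_ne_zero _ _ _

theorem circleWeight_ne_one (b : (graph h).V) : circleWeight h b ≠ 1 :=
  prod_weight_ne_one h b ⟨⟨0, h⟩, Finset.mem_univ _⟩

theorem arcWeight_ne_one (b : (graph h).V) (m m' : Fin (p + q + r)) : arcWeight h b m m' ≠ 1 :=
  prod_weight_ne_one h b ⟨m', mem_arc_right m m'⟩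

theorem arcWeight_of_lt (b : (graph h).V) (hm : m < m') :
    arcWeight h b m m' = partialWeight h b m' / partialWeight h b m := by
  rw [eq_div_iff (partialWeight_ne_zero b m), arcWeight, partialWeight, partialWeight,
    ← Finset.prod_union]
  · refine Finset.prod_congr ?_ fun _ _ => rfl
    ext j
    rw [Finset.mem_union, mem_arc]
    simp only [Finset.mem_Iic, Fin.le_def, Fin.lt_def] at *
    split_ifs; omega
  · rw [Finset.disjoint_left]
    intro j
    rw [mem_arc]
    simp only [Finset.mem_Iic, Fin.le_def, Fin.lt_def] at *
    split_ifs; omega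

theorem arcWeight_of_gt (b : (graph h).V) (hm : m' < m) :
    arcWeight h b m m' = circleWeight h b * partialWeight h b m' / partialWeight h b m := by
  have h1 : arcWeight h b m m' * arcWeight h b m' m = circleWeight h b := by
    rw [arcWeight, arcWeight, circleWeight, ← Finset.prod_union]
    · refine Finset.prod_congr ?_ fun _ _ => rfl
      ext j
      rw [Finset.mem_union, mem_arc_comm hm.ne]
      simp only [Finset.mem_univ, iff_true]
      exact em _
    · rw [Finset.disjoint_left]
      intro j hj hj'
      rw [mem_arc_comm hm.ne] at hj'
      exact hj' hj
  rw [arcWeight_of_lt b hm, mul_div_assoc', div_eq_iff (partialWeight_ne_zero b m')] at h1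
  rw [eq_div_iff (partialWeight_ne_zero b m), h1]

theorem partialWeight_ne (b : (graph h).V) (hm : m ≠ m') : partialWeight h b m ≠ partialWeight h b m' := by
  wlog hlt : m < m' generalizing m m'
  · exact (this hm.symm (lt_of_le_of_ne (not_lt.1 hlt) hm.symm)).symm
  have := arcWeight_ne_one b m m'
  rw [arcWeight_of_lt b hlt, Ne, div_eq_one_iff_eq (partialWeight_ne_zero b m)] at this
  exact Ne.symm this

theorem circleWeight_mul_partialWeight_ne (b : (graph h).V) (hm : m < m') :
    circleWeight h b * partialWeight h b m ≠ partialWeight h b m' := by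
  have := arcWeight_ne_one b m' m
  rwa [arcWeight_of_gt b hm, Ne, div_eq_one_iff_eq (partialWeight_ne_zero b m')] at this

/-- Put the variable of the sector `0` equal to a third root of unity and everything else equal to `1`. -/
theorem esym₃_partialWeight_ne (b : (graph h).V) (s t : Fin 3 → Fin (p + q + r)) :
    sectorVar h b 0 * circleWeight h b * esym₃ (fun i => partialWeight h b (s i)) ≠
      sectorVar h b 1 * esym₃ (fun i => partialWeight h b (t i)) := by
  obtain ⟨ω, hω⟩ := exists_cube_root
  obtain ⟨φ, h1, h2⟩ := exists_specializes h b (L := AlgebraicClosure (ZMod 2)) 1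
    (fun _ => one_ne_zero) ![ω, 1, 1]
  have hY : ∀ m, Specializes φ (partialWeight h b m) 1 := fun m => by
    have := Specializes.prod (s := Finset.Iic m) fun j _ => h1 j
    simp only [Pi.one_apply, Finset.prod_const_one] at this
    exact this
  have hP : Specializes φ (circleWeight h b) 1 := by
    have := Specializes.prod (s := Finset.univ) fun j _ => h1 j
    simp only [Pi.one_apply, Finset.prod_const_one] at this
    exact this
  unfold esym₃
  refine (((h2 0).mul hP).mul (((hY _).mul (hY _)).mul (hY _))).ne
    ((h2 1).mul (((hY _).mul (hY _)).mul (hY _))) ?_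
  simp only [Matrix.cons_val_zero, Matrix.cons_val_one, mul_one]
  rintro rfl
  have : (1 : AlgebraicClosure (ZMod 2)) + 1 = 0 := CharTwo.add_self_eq_zero 1
  simp [this] at hω

/-- Put the weight of the vertex `0` equal to a third root of unity `ω` and all other weights of the
circle equal to `1`: then all partial products are `ω`, and the expression is `1`. -/
theorem discriminant_ne_zero (b : (graph h).V) (s t : Fin 3 → Fin (p + q + r)) :
    let P := circleWeight h b
    let y := fun i => partialWeight h b (s i)
    let z := fun i => partialWeight h b (t i)
    (esym₃ z + P ^ 3 * esym₃ y) ^ 2 + P ^ 2 * (esym₂ y * esym₃ z + P * esym₃ y * esym₂ z) *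
      (esym₁ z + P * esym₁ y) ≠ 0 := by
  intro P y z
  obtain ⟨ω, hω⟩ := exists_cube_root
  have hω0 : ω ≠ 0 := by rintro rfl; simp at hω
  have hu : ∀ v : Fin (p + q + r), v ≠ ⟨0, h⟩ →
      Function.update (1 : Fin (p + q + r) → AlgebraicClosure (ZMod 2)) ⟨0, h⟩ ω v = 1 :=
      fun v hv => by
    rw [Function.update_of_ne hv]; rfl
  obtain ⟨φ, h1, -⟩ := exists_specializes h b (Function.update 1 ⟨0, h⟩ ω)
    (by intro v; by_cases hv : v = ⟨0, h⟩
        · subst hv; rwa [Function.update_self]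
        · rw [hu v hv]; exact one_ne_zero) 1
  have hprod : ∀ U : Finset (Fin (p + q + r)), ⟨0, h⟩ ∈ U →
      Specializes φ (∏ j ∈ U, (graph h).weight b (some j)) ω := fun U hU => by
    have := Specializes.prod (s := U) fun j _ => h1 j
    rw [Finset.prod_update_of_mem hU] at this
    simpa using this
  have hY : ∀ m, Specializes φ (partialWeight h b m) ω := fun m =>
    hprod _ (Finset.mem_Iic.2 (Fin.le_def.2 (Nat.zero_le _)))
  have hP : Specializes φ P ω := hprod _ (Finset.mem_univ _)
  have e1 : ∀ s : Fin 3 → Fin (p + q + r),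
      Specializes φ (esym₁ fun i => partialWeight h b (s i)) (esym₁ fun _ => ω) := fun s =>
    ((hY _).add (hY _)).add (hY _)
  have e2 : ∀ s : Fin 3 → Fin (p + q + r),
      Specializes φ (esym₂ fun i => partialWeight h b (s i)) (esym₂ fun _ => ω) := fun s =>
    (((hY _).mul (hY _)).add ((hY _).mul (hY _))).add ((hY _).mul (hY _))
  have e3 : ∀ s : Fin 3 → Fin (p + q + r),
      Specializes φ (esym₃ fun i => partialWeight h b (s i)) (esym₃ fun _ => ω) := fun s =>
    ((hY _).mul (hY _)).mul (hY _)
  refine ((((e3 t).add ((hP.pow 3).mul (e3 s))).pow 2).add (((hP.pow 2).mul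
    (((e2 s).mul (e3 t)).add ((hP.mul (e3 s)).mul (e2 t)))).mul ((e1 t).add (hP.mul (e1 s))))).ne
    Specializes.zero ?_
  unfold esym₁ esym₂ esym₃
  intro hzero
  refine one_ne_zero (α := AlgebraicClosure (ZMod 2)) ?_
  clear * - hω hzero
  grind

end Wheel
end BOS

/-! ### The coefficients of the differential -/

namespace BOS
namespace Wheel
variable {p q r : ℕ} {h : 0 < p + q + r}
variable {m m' : Fin (p + q + r)} {a : Fin 3}

theorem prod_compl_singleton {K : Type*} [CommMonoid K] (A : Fin 3 → K) (a : Fin 3) :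
    ∏ φ ∈ {a}ᶜ, A φ = A (a + 1) * A (a + 2) := by
  have h1 : ({a}ᶜ : Finset (Fin 3)) = {a + 1, a + 2} := by revert a; decide
  have h2 : a + 1 ≠ a + 2 := by revert a; decide
  rw [h1, Finset.prod_pair h2]

theorem add_two_ne (a : Fin 3) : a + 2 ≠ a := by revert a; decide

theorem add_one_ne (a : Fin 3) : a + 1 ≠ a := by revert a; decide

/-- The outer end of the spoke at the end of the sector of `m` lies on the arc that starts at `m`. -/
theorem foot_mem_arc_left (ha : sector p q m = a) (hm : sector p q m ≠ sector p q m') :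
    foot h (a + 1) ∈ arc m m' ∧ foot h a ∉ arc m m' := by
  rw [foot_mem_arc h hm, foot_mem_arc h hm, ha]
  rw [ha] at hm
  generalize sector p q m' = c at *
  clear * - hm
  revert a c; decide

/-- See `foot_mem_arc_left`. -/
theorem foot_mem_arc_right (ha : sector p q m = a) (hm : sector p q m ≠ sector p q m') :
    foot h a ∈ arc m' m ∧ foot h (a + 1) ∉ arc m' m := by
  rw [foot_mem_arc h hm.symm, foot_mem_arc h hm.symm, ha]
  rw [ha] at hm
  generalize sector p q m' = c at *
  clear * - hm
  revert a c; decide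

/-- The coefficients of `Ψ` into the spanning tree with the spokes `a, a + 1` that lacks the edges `m, m'`,
from the four spanning trees with one of these spokes that lack one of these edges. -/
theorem coeff_single_left_left (b : (graph h).V) (ha : sector p q m = a)
    (hm : sector p q m ≠ sector p q m') :
    (graph h).coeff b (treeOf {a} {m}) (treeOf {a, a + 1} {m, m'}) =
      1 + 1 / (1 + sectorVar h b (a + 1) * sectorVar h b (a + 2)) + 1 / (1 + arcWeight h b m m') := by
  have hne := ne_of_sector_ne hm
  have hf := foot_mem_arc_left (h := h) ha hm
  rw [Finset.pair_comm a, Finset.pair_comm m, coeff_eq b (by simpa using hne.symm)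
    (by simp), (move_compl (n := m) (n' := m') ha hm (Finset.pair_comm _ _) (by simp)
      (by simp) hf.2 hf.1).term_eq_right b hne, prod_compl_singleton]
  · exact prod_sectorVar_ne_one h b ⟨a + 1, by simp⟩
  · exact arcWeight_ne_one b _ _

/-- See `coeff_single_left_left`. -/
theorem coeff_single_left_right (b : (graph h).V) (ha : sector p q m = a)
    (hm : sector p q m ≠ sector p q m') :
    (graph h).coeff b (treeOf {a} {m'}) (treeOf {a, a + 1} {m, m'}) =
      1 / (1 + sectorVar h b a) + 1 / (1 + arcWeight h b m m') := by
  have hne := ne_of_sector_ne hm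
  have hf := foot_mem_arc_left (h := h) ha hm
  rw [Finset.pair_comm a, coeff_eq b (by simpa using hne)
    (by simp), (move_self (n := m) (n' := m') ha hm (Finset.pair_comm _ _) (by simp)
      (by simp) hf.2 hf.1).term_eq_left b, Finset.prod_singleton]
  · exact prod_sectorVar_ne_one h b ⟨a, by simp⟩
  · exact arcWeight_ne_one b _ _

/-- See `coeff_single_left_left`. -/
theorem coeff_single_right_left (b : (graph h).V) (ha : sector p q m = a)
    (hm : sector p q m ≠ sector p q m') :
    (graph h).coeff b (treeOf {a + 1} {m}) (treeOf {a, a + 1} {m, m'}) =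
      1 / (1 + sectorVar h b (a + 1) * sectorVar h b (a + 2)) + 1 / (1 + arcWeight h b m' m) := by
  have hne := ne_of_sector_ne hm
  have hf := foot_mem_arc_right (h := h) ha hm
  rw [Finset.pair_comm m, coeff_eq b (by simpa using hne.symm)
    (by simp), (move_compl (n := m') (n' := m) ha hm rfl (by simp)
      (by simp) hf.2 hf.1).term_eq_left b, prod_compl_singleton]
  · exact prod_sectorVar_ne_one h b ⟨a + 1, by simp⟩
  · exact arcWeight_ne_one b _ _

/-- See `coeff_single_left_left`. -/
theorem coeff_single_right_right (b : (graph h).V) (ha : sector p q m = a)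
    (hm : sector p q m ≠ sector p q m') :
    (graph h).coeff b (treeOf {a + 1} {m'}) (treeOf {a, a + 1} {m, m'}) =
      1 + 1 / (1 + sectorVar h b a) + 1 / (1 + arcWeight h b m' m) := by
  have hne := ne_of_sector_ne hm
  have hf := foot_mem_arc_right (h := h) ha hm
  rw [coeff_eq b (by simpa using hne)
    (by simp), (move_self (n := m') (n' := m) ha hm rfl (by simp)
      (by simp) hf.2 hf.1).term_eq_right b hne.symm, Finset.prod_singleton]
  · exact prod_sectorVar_ne_one h b ⟨a, by simp⟩
  · exact arcWeight_ne_one b _ _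

theorem coeff_single_eq_zero (b : (graph h).V) {i : Fin 3} {n : Fin (p + q + r)}
    (hin : ¬ ((i = a ∨ i = a + 1) ∧ (n = m ∨ n = m'))) :
    (graph h).coeff b (treeOf {i} {n}) (treeOf {a, a + 1} {m, m'}) = 0 := by
  refine coeff_eq_zero b fun e f _ _ hS hM => hin ⟨?_, ?_⟩
  · have : i ∈ ({a, a + 1} : Finset (Fin 3)) := by rw [hS]; simp
    simpa using this
  · have : n ∈ ({m, m'} : Finset (Fin (p + q + r))) := by rw [hM]; simp
    simpa using this

theorem coeff_triple {t : Fin 3 → Fin (p + q + r)} (ht : ∀ i, sector p q (t i) = i)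
    (b : (graph h).V) {i j : Fin 3} :
    (graph h).coeff b (treeOf {i, i + 1} ((Finset.univ.erase j).image t))
      (treeOf Finset.univ (Finset.univ.image t)) =
      1 / (1 + (graph h).alpha b (treeOf {i, i + 1} ((Finset.univ.erase j).image t)) (Sum.inr (t j))
        (Sum.inl (i + 2))) +
      1 / (1 + (graph h).beta b (treeOf {i, i + 1} ((Finset.univ.erase j).image t)) (Sum.inr (t j))) := by
  have h1 : (Finset.univ : Finset (Fin 3)) = insert (i + 2) {i, i + 1} := by clear * -; revert i; decide
  have h2 : Finset.univ.image t = insert (t j) ((Finset.univ.erase j).image t) := by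
    rw [← Finset.image_insert, Finset.insert_erase (Finset.mem_univ j)]
  have h3 : t j ∉ (Finset.univ.erase j).image t := by
    simp only [Finset.mem_image, Finset.mem_erase, Finset.mem_univ, and_true, not_exists, not_and]
    intro i' hi' he
    exact hi' (by rw [← ht i', he, ht])
  have h4 : i + 2 ∉ ({i, i + 1} : Finset (Fin 3)) := by clear * -; revert i; decide
  rw [← coeff_eq b h3 h4, ← h1, ← h2]

theorem image_erase_add_one {X : Type*} [DecidableEq X] (t : Fin 3 → X) (i : Fin 3) :
    (Finset.univ.erase (i + 1)).image t = {t i, t (i + 2)} := by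
  have : Finset.univ.erase (i + 1) = ({i, i + 2} : Finset (Fin 3)) := by revert i; decide
  rw [this, Finset.image_insert, Finset.image_singleton]

theorem image_erase_add_two {X : Type*} [DecidableEq X] (t : Fin 3 → X) (i : Fin 3) :
    (Finset.univ.erase (i + 2)).image t = {t i, t (i + 1)} := by
  have : Finset.univ.erase (i + 2) = ({i, i + 1} : Finset (Fin 3)) := by revert i; decide
  rw [this, Finset.image_insert, Finset.image_singleton]

/-- The coefficient of `Ψ` into a spanning tree with three spokes from one that lacks the edges in the
sectors `i` and `i + 1`. -/
theorem coeff_pair_next {t : Fin 3 → Fin (p + q + r)} (ht : ∀ i, sector p q (t i) = i)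
    (b : (graph h).V) (i : Fin 3) :
    (graph h).coeff b (treeOf {i, i + 1} {t i, t (i + 1)})
      (treeOf Finset.univ (Finset.univ.image t)) =
      1 + 1 / (1 + sectorVar h b (i + 2)) + 1 / (1 + arcWeight h b (t (i + 1)) (t (i + 2))) := by
  have h3 : i + 1 ≠ i + 2 := by revert i; decide
  rw [← image_erase_add_two, coeff_triple ht b,
    (move_triple ht i (i + 2) (add_two_ne i)).term_eq_right b
      (ne_of_sector_ne (sector_apply_ne ht h3)), Finset.prod_singleton]
  · exact prod_sectorVar_ne_one h b ⟨_, Finset.mem_singleton_self _⟩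
  · exact arcWeight_ne_one b _ _

/-- The coefficient of `Ψ` into a spanning tree with three spokes from one with the same spokes as in
`coeff_pair_next` that lacks the edges in the sectors `i` and `i + 2`. -/
theorem coeff_pair_skip {t : Fin 3 → Fin (p + q + r)} (ht : ∀ i, sector p q (t i) = i)
    (b : (graph h).V) (i : Fin 3) :
    (graph h).coeff b (treeOf {i, i + 1} {t i, t (i + 2)})
      (treeOf Finset.univ (Finset.univ.image t)) =
      1 / (1 + sectorVar h b (i + 1)) + 1 / (1 + arcWeight h b (t (i + 1)) (t (i + 2))) := by
  rw [← image_erase_add_one, coeff_triple ht b,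
    (move_triple ht i (i + 1) (add_one_ne i)).term_eq_left b, Finset.prod_singleton]
  · exact prod_sectorVar_ne_one h b ⟨_, Finset.mem_singleton_self _⟩
  · exact arcWeight_ne_one b _ _

theorem mem_range_of_image_eq {t : Fin 3 → Fin (p + q + r)} {m m' e : Fin (p + q + r)}
    (he : Finset.univ.image t = insert e {m, m'}) : m ∈ Set.range t ∧ m' ∈ Set.range t := by
  have h1 : m ∈ Finset.univ.image t := by rw [he]; simp
  have h2 : m' ∈ Finset.univ.image t := by rw [he]; simp
  simpa using And.intro h1 h2

theorem coeff_pair_eq_zero (b : (graph h).V) {t : Fin 3 → Fin (p + q + r)}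
    (ht : ∀ i, sector p q (t i) = i) (hin : ¬ (t (sector p q m) = m ∧ t (sector p q m') = m')) {S} :
    (graph h).coeff b (treeOf S {m, m'}) (treeOf Finset.univ (Finset.univ.image t)) = 0 := by
  refine coeff_eq_zero b fun e f _ _ hS hM => hin ?_
  obtain ⟨⟨i, rfl⟩, ⟨j, rfl⟩⟩ := mem_range_of_image_eq hM
  rw [ht, ht]
  exact ⟨rfl, rfl⟩

theorem card_image_triple {t : Fin 3 → Fin (p + q + r)} (ht : ∀ i, sector p q (t i) = i) :
    (Finset.univ.image t).card = 3 := by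
  rw [Finset.card_image_of_injective _ (fun i j hij => by rw [← ht i, hij, ht])]
  rfl

variable (h)

/-- The spanning tree with the spoke `i` and all edges of the circle except `n`. -/
def singleTree {c : ℚ} (hc : c = 1) (i : Fin 3) (n : Fin (p + q + r)) : (graph h).Tree c :=
  ⟨treeOf {i} {n}, isSpanningTree_treeOf.2 ⟨conn_singleton h i n, rfl⟩, by
    rw [totalHeight_treeOf, hc]; norm_num⟩

/-- The spanning tree with the two spokes that bound the sector of `m` and all edges of the circle except
`m` and `m'`. -/
def pairTree {c : ℚ} (hc : c = 2) {m m' : Fin (p + q + r)} (hm : sector p q m ≠ sector p q m') :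
    (graph h).Tree c :=
  ⟨treeOf {sector p q m, sector p q m + 1} {m, m'}, isSpanningTree_treeOf.2 ⟨conn_pair h hm rfl, by
      rw [Finset.card_pair (ne_of_sector_ne hm), Finset.card_pair (add_one_ne _).symm]⟩, by
    rw [totalHeight_treeOf, hc, Finset.card_pair (ne_of_sector_ne hm),
      Finset.card_pair (add_one_ne _).symm]; norm_num⟩

/-- The spanning tree with all spokes and all edges of the circle except the edges `t i`. -/
def tripleTree {c : ℚ} (hc : c = 3) {t : Fin 3 → Fin (p + q + r)} (ht : ∀ i, sector p q (t i) = i) :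
    (graph h).Tree c :=
  ⟨treeOf Finset.univ (Finset.univ.image t), isSpanningTree_treeOf.2 ⟨conn_triple ht, by
      rw [card_image_triple ht]; rfl⟩, by
    rw [totalHeight_treeOf, hc, card_image_triple ht]; norm_num⟩

variable {h} {c d : ℚ}

theorem singleTree_injective (hc : c = 1) {i j : Fin 3} {n n' : Fin (p + q + r)}
    (he : singleTree h hc i n = singleTree h hc j n') : i = j ∧ n = n' := by
  obtain ⟨h1, h2⟩ := treeOf_injective (congrArg Subtype.val he)
  exact ⟨Finset.singleton_injective h1, Finset.singleton_injective h2⟩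

theorem pairTree_injective (hc : c = 2) {n n' : Fin (p + q + r)} (hm : sector p q m ≠ sector p q m')
    (hn : sector p q n ≠ sector p q n') (he : pairTree h hc hm = pairTree h hc hn) :
    m = n ∧ m' = n' := by
  obtain ⟨h1, h2⟩ := treeOf_injective (congrArg Subtype.val he)
  have h3 : sector p q m = sector p q n := by
    clear * - h1
    generalize sector p q m = a at *
    generalize sector p q n = c at *
    revert a c; decide
  have h4 : m ∈ ({n, n'} : Finset (Fin (p + q + r))) := h2 ▸ Finset.mem_insert_self _ _
  have h5 : m' ∈ ({n, n'} : Finset (Fin (p + q + r))) := by rw [← h2]; simp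
  simp only [Finset.mem_insert, Finset.mem_singleton] at h4 h5
  have h6 : m = n := h4.resolve_right fun e => hn (by rw [← h3, e])
  exact ⟨h6, h5.resolve_left fun e => ne_of_sector_ne hm (by rw [e, h6])⟩

theorem tripleTree_injective (hc : c = 3) {t u : Fin 3 → Fin (p + q + r)}
    (ht : ∀ i, sector p q (t i) = i) (hu : ∀ i, sector p q (u i) = i)
    (he : tripleTree h hc ht = tripleTree h hc hu) : t = u := by
  obtain ⟨-, h2⟩ := treeOf_injective (congrArg Subtype.val he)
  funext i
  have : t i ∈ Finset.univ.image u := by rw [← h2]; simp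
  obtain ⟨j, -, hj⟩ := Finset.mem_image.1 this
  rw [← hj]
  congr 1
  rw [← hu j, hj, ht]

theorem exists_eq_treeOf (T : (graph h).Tree c) :
    ∃ S M, T.1 = treeOf S M ∧ Conn h S M ∧ S.card = M.card ∧ (S.card : ℚ) = c := by
  obtain ⟨T, hT, hc⟩ := T
  obtain ⟨S, M, rfl⟩ := exists_treeOf T
  obtain ⟨h1, h2⟩ := isSpanningTree_treeOf.1 hT
  refine ⟨S, M, rfl, h1, h2, ?_⟩
  rw [totalHeight_treeOf, ← h2] at hc
  push_cast at hc
  linarith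

theorem exists_eq_singleTree (hc : c = 1) (T : (graph h).Tree c) :
    ∃ i n, T = singleTree h hc i n := by
  obtain ⟨S, M, hT, -, h2, h3⟩ := exists_eq_treeOf T
  have h4 : S.card = 1 := by rw [hc] at h3; exact_mod_cast h3
  obtain ⟨i, rfl⟩ := Finset.card_eq_one.1 h4
  obtain ⟨n, rfl⟩ := Finset.card_eq_one.1 (h2 ▸ h4)
  exact ⟨i, n, Subtype.ext hT⟩

theorem exists_eq_pairTree (hc : c = 2) (T : (graph h).Tree c) :
    ∃ (m m' : Fin (p + q + r)) (hm : sector p q m ≠ sector p q m'), T = pairTree h hc hm := by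
  obtain ⟨S, M, hT, h1, h2, h3⟩ := exists_eq_treeOf T
  have h4 : S.card = 2 := by rw [hc] at h3; exact_mod_cast h3
  obtain ⟨n, n', hn, rfl, rfl⟩ := h1.exists_pair h4 (h2 ▸ h4)
  exact ⟨n, n', hn, Subtype.ext hT⟩

theorem exists_eq_tripleTree (hc : c = 3) (T : (graph h).Tree c) :
    ∃ (t : Fin 3 → Fin (p + q + r)) (ht : ∀ i, sector p q (t i) = i), T = tripleTree h hc ht := by
  obtain ⟨S, M, hT, h1, h2, h3⟩ := exists_eq_treeOf T
  have h4 : S.card = 3 := by rw [hc] at h3; exact_mod_cast h3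
  obtain ⟨t, ht, rfl, rfl⟩ := h1.exists_triple h4 (h2 ▸ h4)
  refine ⟨t, ht, Subtype.ext ?_⟩
  rw [hT, ← image_fin_three]
  rfl

theorem isEmpty_tree (h1 : c ≠ 1) (h2 : c ≠ 2) (h3 : c ≠ 3) : IsEmpty ((graph h).Tree c) := by
  refine ⟨fun T => ?_⟩
  obtain ⟨S, M, -, hc, -, h0⟩ := exists_eq_treeOf T
  have h4 : S.card ≤ 3 := by simpa using S.card_le_univ
  have h5 := hc.nonempty.card_pos
  interval_cases S.card
  · exact h1 (by rw [← h0]; norm_num)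
  · exact h2 (by rw [← h0]; norm_num)
  · exact h3 (by rw [← h0]; norm_num)

end Wheel
end BOS

/-! ### The differential and its square -/

namespace BOS

theorem BlackGraph.Psi_apply (B : BlackGraph) (b : B.V) (c d : ℚ) (u : B.C b c) (T' : B.Tree d) :
    B.Psi b c d u T' = ∑ T : B.Tree c, B.coeff b T.1 T'.1 * u T := rfl

namespace Wheel
variable {p q r : ℕ} {h : 0 < p + q + r}
variable {m m' : Fin (p + q + r)} {a : Fin 3} {c d : ℚ}

/-- The components of `Ψ` in the middle degree: four spanning trees contribute. -/
theorem Psi_pairTree (b : (graph h).V) (hc : c = 1) (hd : d = 2) (u : (graph h).C b c)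
    (hm : sector p q m ≠ sector p q m') (ha : sector p q m = a) :
    (graph h).Psi b c d u (pairTree h hd hm) =
      (1 + 1 / (1 + sectorVar h b (a + 1) * sectorVar h b (a + 2)) + 1 / (1 + arcWeight h b m m')) *
        u (singleTree h hc a m) +
      (1 / (1 + sectorVar h b a) + 1 / (1 + arcWeight h b m m')) * u (singleTree h hc a m') +
      (1 / (1 + sectorVar h b (a + 1) * sectorVar h b (a + 2)) + 1 / (1 + arcWeight h b m' m)) *
        u (singleTree h hc (a + 1) m) +
      (1 + 1 / (1 + sectorVar h b a) + 1 / (1 + arcWeight h b m' m)) *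
        u (singleTree h hc (a + 1) m') := by
  subst ha
  set a := sector p q m with ha
  let e : Bool × Bool → (graph h).Tree c := fun x =>
    singleTree h hc (bif x.1 then a else a + 1) (bif x.2 then m else m')
  have he : Function.Injective e := by
    rintro ⟨x, y⟩ ⟨x', y'⟩ hxy
    obtain ⟨h1, h2⟩ := singleTree_injective hc hxy
    have := (add_one_ne a).symm
    have := add_one_ne a
    have := ne_of_sector_ne hm
    have := (ne_of_sector_ne hm).symm
    revert h1 h2
    cases x <;> cases x' <;> cases y <;> cases y' <;> simp_all
  rw [BlackGraph.Psi_apply, ← Fintype.sum_of_injective e he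
    (fun x => (graph h).coeff b (e x).1 (pairTree h hd hm).1 * u (e x)) _ ?_ fun _ => rfl]
  · rw [Fintype.sum_prod_type, Fintype.sum_bool, Fintype.sum_bool, Fintype.sum_bool,
      ← coeff_single_left_left b ha.symm hm, ← coeff_single_left_right b ha.symm hm,
      ← coeff_single_right_left b ha.symm hm, ← coeff_single_right_right b ha.symm hm]
    exact (add_assoc _ _ _).symm
  · intro T hT
    obtain ⟨i, n, rfl⟩ := exists_eq_singleTree hc T
    refine mul_eq_zero_of_left (coeff_single_eq_zero b ?_) _
    rintro ⟨rfl | rfl, rfl | rfl⟩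
    · exact hT ⟨(true, true), rfl⟩
    · exact hT ⟨(true, false), rfl⟩
    · exact hT ⟨(false, true), rfl⟩
    · exact hT ⟨(false, false), rfl⟩

theorem coeff_pairTree_next {t : Fin 3 → Fin (p + q + r)} (ht : ∀ i, sector p q (t i) = i)
    (b : (graph h).V) (hc : c = 2) (hd : d = 3) (i : Fin 3)
    (hm : sector p q (t i) ≠ sector p q (t (i + 1))) :
    (graph h).coeff b (pairTree h hc hm).1 (tripleTree h hd ht).1 =
      1 + 1 / (1 + sectorVar h b (i + 2)) + 1 / (1 + arcWeight h b (t (i + 1)) (t (i + 2))) := by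
  rw [← coeff_pair_next ht, pairTree, tripleTree]
  simp only [ht]

theorem coeff_pairTree_skip {t : Fin 3 → Fin (p + q + r)} (ht : ∀ i, sector p q (t i) = i)
    (b : (graph h).V) (hc : c = 2) (hd : d = 3) (i : Fin 3)
    (hm : sector p q (t i) ≠ sector p q (t (i + 2))) :
    (graph h).coeff b (pairTree h hc hm).1 (tripleTree h hd ht).1 =
      1 / (1 + sectorVar h b (i + 1)) + 1 / (1 + arcWeight h b (t (i + 1)) (t (i + 2))) := by
  rw [← coeff_pair_skip ht, pairTree, tripleTree]
  simp only [ht]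

/-- The components of `Ψ` in the highest degree: six spanning trees contribute. -/
theorem Psi_tripleTree (b : (graph h).V) (hc : c = 2) (hd : d = 3) (u : (graph h).C b c)
    {t : Fin 3 → Fin (p + q + r)} (ht : ∀ i, sector p q (t i) = i)
    (h1 : ∀ i, sector p q (t i) ≠ sector p q (t (i + 1)))
    (h2 : ∀ i, sector p q (t i) ≠ sector p q (t (i + 2))) :
    (graph h).Psi b c d u (tripleTree h hd ht) = ∑ i,
      ((1 + 1 / (1 + sectorVar h b (i + 2)) + 1 / (1 + arcWeight h b (t (i + 1)) (t (i + 2)))) *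
        u (pairTree h hc (h1 i)) +
      (1 / (1 + sectorVar h b (i + 1)) + 1 / (1 + arcWeight h b (t (i + 1)) (t (i + 2)))) *
        u (pairTree h hc (h2 i))) := by
  let e : Fin 3 × Bool → (graph h).Tree c := fun x =>
    match x with
    | (i, true) => pairTree h hc (h1 i)
    | (i, false) => pairTree h hc (h2 i)
  have he : Function.Injective e := by
    have h12 : ∀ i : Fin 3, i + 1 ≠ i + 2 := by decide
    rintro ⟨i, x⟩ ⟨j, y⟩ hxy
    have ti : ∀ i j, t i = t j → i = j := fun i j hij => by rw [← ht i, hij, ht]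
    cases x <;> cases y <;> obtain ⟨h3, h4⟩ := pairTree_injective hc _ _ hxy <;>
      obtain rfl := ti _ _ h3 <;> have h5 := ti _ _ h4
    · rfl
    · exact absurd h5.symm (h12 i)
    · exact absurd h5 (h12 i)
    · rfl
  rw [BlackGraph.Psi_apply, ← Fintype.sum_of_injective e he
    (fun x => (graph h).coeff b (e x).1 (tripleTree h hd ht).1 * u (e x)) _ ?_ fun _ => rfl]
  · rw [Fintype.sum_prod_type]
    refine Finset.sum_congr rfl fun i _ => ?_
    rw [Fintype.sum_bool, ← coeff_pairTree_next ht b hc hd i (h1 i),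
      ← coeff_pairTree_skip ht b hc hd i (h2 i)]
  · intro T hT
    obtain ⟨n, n', hn, rfl⟩ := exists_eq_pairTree hc T
    refine mul_eq_zero_of_left (coeff_pair_eq_zero b ht ?_) _
    rintro ⟨h3, h4⟩
    have h5 : sector p q n' = sector p q n + 1 ∨ sector p q n' = sector p q n + 2 := by
      clear * - hn
      generalize sector p q n = a at *
      generalize sector p q n' = c at *
      revert a c; decide
    have key : ∀ (k k' : Fin (p + q + r)) (hk : sector p q k ≠ sector p q k'), k = n → k' = n' →
        pairTree h hc hk = pairTree h hc hn := by
      rintro _ _ _ rfl rfl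
      rfl
    rcases h5 with h5 | h5
    · exact hT ⟨(sector p q n, true), key _ _ _ h3 (h5 ▸ h4)⟩
    · exact hT ⟨(sector p q n, false), key _ _ _ h3 (h5 ▸ h4)⟩

theorem lt_of_sector_lt {m m' : Fin (p + q + r)} (hm : sector p q m < sector p q m') : m < m' := by
  revert hm
  unfold sector
  rw [Fin.lt_def (a := m)]
  split_ifs <;> simp <;> omega

/-- The square of the differential vanishes in the only degree in which this is not void. -/
theorem Psi_comp_Psi (b : (graph h).V) {e : ℚ} (hc : c = 1) (hd : d = 2) (he : e = 3) :
    (graph h).Psi b d e ∘ₗ (graph h).Psi b c d = 0 := by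
  refine LinearMap.ext fun u => funext fun T => ?_
  obtain ⟨t, ht, rfl⟩ := exists_eq_tripleTree he T
  have h1 : ∀ i, sector p q (t i) ≠ sector p q (t (i + 1)) := fun i =>
    sector_apply_ne ht (add_one_ne i).symm
  have h2 : ∀ i, sector p q (t i) ≠ sector p q (t (i + 2)) := fun i =>
    sector_apply_ne ht (add_two_ne i).symm
  rw [LinearMap.comp_apply, LinearMap.zero_apply, Pi.zero_apply, Psi_tripleTree b hd he _ ht h1 h2]
  simp only [Psi_pairTree b hc hd u _ (ht _)]
  have hA : ∀ i, 1 + sectorVar h b i ≠ 0 := fun i => one_add_ne_zero (by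
    simpa using prod_sectorVar_ne_one h b (Φ := {i}) (by simp))
  have hAB : ∀ i j, i ≠ j → 1 + sectorVar h b i * sectorVar h b j ≠ 0 := fun i j hij =>
    one_add_ne_zero (by
      simpa [Finset.prod_pair hij] using prod_sectorVar_ne_one h b (Φ := {i, j}) (by simp))
  have hX : ∀ i j, 1 + arcWeight h b i j ≠ 0 := fun i j => one_add_ne_zero (arcWeight_ne_one b i j)
  have l01 : t 0 < t 1 := lt_of_sector_lt (by rw [ht, ht]; decide)
  have l12 : t 1 < t 2 := lt_of_sector_lt (by rw [ht, ht]; decide)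
  have y : ∀ i, partialWeight h b (t i) ≠ 0 := fun i => partialWeight_ne_zero b _
  -- The arcs between consecutive edges `t i` fit together.
  have m0 : arcWeight h b (t 0) (t 2) = arcWeight h b (t 0) (t 1) * arcWeight h b (t 1) (t 2) := by
    rw [arcWeight_of_lt b l01, arcWeight_of_lt b l12, arcWeight_of_lt b (l01.trans l12)]
    have := y 1
    field_simp
  have m1 : arcWeight h b (t 1) (t 0) = arcWeight h b (t 1) (t 2) * arcWeight h b (t 2) (t 0) := by
    rw [arcWeight_of_gt b l01, arcWeight_of_lt b l12, arcWeight_of_gt b (l01.trans l12)]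
    have := y 2
    field_simp
  have m2 : arcWeight h b (t 2) (t 1) = arcWeight h b (t 2) (t 0) * arcWeight h b (t 0) (t 1) := by
    rw [arcWeight_of_lt b l01, arcWeight_of_gt b l12, arcWeight_of_gt b (l01.trans l12)]
    have := y 0
    field_simp
  have mul : ∀ i, arcWeight h b (t i) (t (i + 2)) =
      arcWeight h b (t i) (t (i + 1)) * arcWeight h b (t (i + 1)) (t (i + 2)) := by
    intro i
    fin_cases i
    · exact m0
    · exact m1
    · exact m2
  have h12 : ∀ i : Fin 3, i + 1 ≠ i + 2 := by decide
  have s0 : ∀ i, _ := fun i => square_identity₀ (hA (i + 1)) (hA (i + 2)) (hAB _ _ (h12 i))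
    (hX (t i) (t (i + 1))) (hX (t (i + 1)) (t (i + 2))) (mul i ▸ hX (t i) (t (i + 2)))
  have s1 : ∀ i, _ := fun i => square_identity₁ (hA i) (hA (i + 1)) (hAB _ _ (add_one_ne i).symm)
    (hX (t i) (t (i + 1))) (hX (t (i + 1)) (t (i + 2))) (mul i ▸ hX (t i) (t (i + 2)))
  simp only [← mul] at s0 s1
  clear hA hAB hX l01 l12 y m0 m1 m2 mul h12
  have a00 := s0 0
  have a01 := s0 1
  have a02 := s0 2
  have a10 := s1 0
  have a11 := s1 1
  have a12 := s1 2
  clear s0 s1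
  have two : (2 : (graph h).K b) = 0 := CharTwo.two_eq_zero
  rw [Fin.sum_univ_three]
  simp only [show (0 : Fin 3) + 1 = 1 from rfl, show (0 : Fin 3) + 2 = 2 from rfl,
    show (1 : Fin 3) + 1 = 2 from rfl, show (1 : Fin 3) + 2 = 0 from rfl,
    show (2 : Fin 3) + 1 = 0 from rfl, show (2 : Fin 3) + 2 = 1 from rfl] at *
  rw [mul_comm (sectorVar h b 2) (sectorVar h b 0)] at *
  generalize 1 / (1 + sectorVar h b 0 * sectorVar h b 1) = B01 at *
  generalize 1 / (1 + sectorVar h b 1 * sectorVar h b 2) = B12 at *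
  generalize 1 / (1 + sectorVar h b 0 * sectorVar h b 2) = B02 at *
  generalize 1 / (1 + sectorVar h b 0) = A0 at *
  generalize 1 / (1 + sectorVar h b 1) = A1 at *
  generalize 1 / (1 + sectorVar h b 2) = A2 at *
  generalize 1 / (1 + arcWeight h b (t 0) (t 1)) = X01 at *
  generalize 1 / (1 + arcWeight h b (t 1) (t 0)) = X10 at *
  generalize 1 / (1 + arcWeight h b (t 1) (t 2)) = X12 at *
  generalize 1 / (1 + arcWeight h b (t 2) (t 1)) = X21 at *
  generalize 1 / (1 + arcWeight h b (t 0) (t 2)) = X02 at *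
  generalize 1 / (1 + arcWeight h b (t 2) (t 0)) = X20 at *
  -- The spanning trees with the spoke `i` that lack `t (i + 1)` contribute two equal products.
  linear_combination u (singleTree h hc 0 (t 0)) * a00 + u (singleTree h hc 1 (t 1)) * a01 +
    u (singleTree h hc 2 (t 2)) * a02 + u (singleTree h hc 0 (t 2)) * a10 +
    u (singleTree h hc 1 (t 0)) * a11 + u (singleTree h hc 2 (t 1)) * a12 +
    ((A0 + X01) * (1 + A2 + X12) * u (singleTree h hc 0 (t 1)) +
     (A1 + X12) * (1 + A0 + X20) * u (singleTree h hc 1 (t 2)) +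
     (A2 + X20) * (1 + A1 + X01) * u (singleTree h hc 2 (t 0))) * two

end Wheel
end BOS

/-! ### Numbers of spanning trees and ranks -/

namespace BOS
namespace Wheel
variable {p q r : ℕ} {h : 0 < p + q + r} {c d : ℚ}

theorem card_sector (i : Fin 3) :
    Fintype.card {n : Fin (p + q + r) // sector p q n = i} = ![p, q, r] i := by
  have h1 : (Finset.univ.filter fun n : Fin (p + q + r) => sector p q n = i).map Fin.valEmbedding =
      Finset.Ico (start p q i) (finish p q r i) := by
    ext n
    simp only [Finset.mem_map, Finset.mem_filter, Finset.mem_univ, true_and, Fin.valEmbedding_apply,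
      Finset.mem_Ico]
    constructor
    · rintro ⟨n, rfl, rfl⟩
      exact ⟨start_sector_le _, lt_finish_sector n.2⟩
    · rintro ⟨h1, h2⟩
      exact ⟨⟨n, h2.trans_le (finish_le i)⟩, sector_eq h1 h2, rfl⟩
  rw [Fintype.card_subtype, ← Finset.card_map Fin.valEmbedding, h1, Nat.card_Ico]
  fin_cases i <;> simp [start, finish]

theorem card_tree_one (hc : c = 1) : Fintype.card ((graph h).Tree c) = 3 * (p + q + r) := by
  rw [← Fintype.card_of_bijective (f := fun x : Fin 3 × Fin (p + q + r) => singleTree h hc x.1 x.2)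
    ⟨fun x y hxy => Prod.ext_iff.2 (singleTree_injective hc hxy), fun T => ?_⟩]
  · simp
  · obtain ⟨i, n, rfl⟩ := exists_eq_singleTree hc T
    exact ⟨(i, n), rfl⟩

theorem card_tree_two (hc : c = 2) :
    Fintype.card ((graph h).Tree c) = 2 * (p * q + q * r + r * p) := by
  -- The pairs of different sectors are the pairs `(x.1, σ x)`.
  let σ : Fin 3 × Bool → Fin 3 := fun x => x.1 + bif x.2 then 1 else 2
  have hσ : ∀ x, x.1 ≠ σ x := by decide
  have hσ' : ∀ i j, i ≠ j → ∃ s, σ (i, s) = j := by decide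
  have hσi : ∀ x y : Fin 3 × Bool, x.1 = y.1 → σ x = σ y → x = y := by decide
  let e : (Σ x : Fin 3 × Bool, {n : Fin (p + q + r) // sector p q n = x.1} ×
      {n : Fin (p + q + r) // sector p q n = σ x}) → (graph h).Tree c :=
    fun x => pairTree h hc (m := x.2.1.1) (m' := x.2.2.1) (by rw [x.2.1.2, x.2.2.2]; exact hσ x.1)
  have he : Function.Bijective e := by
    constructor
    · rintro ⟨x, ⟨n, hn⟩, ⟨n', hn'⟩⟩ ⟨y, ⟨m, hm⟩, ⟨m', hm'⟩⟩ hxy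
      obtain ⟨h1, h2⟩ := pairTree_injective hc _ _ hxy
      dsimp only at h1 h2
      subst h1 h2
      obtain rfl := hσi x y (hn.symm.trans hm) (hn'.symm.trans hm')
      rfl
    · intro T
      obtain ⟨n, n', hn, rfl⟩ := exists_eq_pairTree hc T
      obtain ⟨s, hs⟩ := hσ' _ _ hn
      exact ⟨⟨(sector p q n, s), ⟨n, rfl⟩, ⟨n', hs.symm⟩⟩, rfl⟩
  rw [← Fintype.card_of_bijective he, Fintype.card_sigma]
  simp only [Fintype.card_prod, card_sector]
  rw [Fintype.sum_prod_type, Fin.sum_univ_three]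
  simp only [Fintype.sum_bool, σ, cond_true, cond_false]
  simp only [show (0 : Fin 3) + 1 = 1 from rfl, show (0 : Fin 3) + 2 = 2 from rfl,
    show (1 : Fin 3) + 1 = 2 from rfl, show (1 : Fin 3) + 2 = 0 from rfl,
    show (2 : Fin 3) + 1 = 0 from rfl, show (2 : Fin 3) + 2 = 1 from rfl, Matrix.cons_val]
  ring

theorem card_tree_three (hc : c = 3) : Fintype.card ((graph h).Tree c) = p * q * r := by
  rw [← Fintype.card_of_bijective
    (f := fun t : {t : Fin 3 → Fin (p + q + r) // ∀ i, sector p q (t i) = i} => tripleTree h hc t.2)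
    ⟨fun t u htu => Subtype.ext (tripleTree_injective hc t.2 u.2 htu), fun T => ?_⟩]
  · rw [Fintype.card_congr (Equiv.subtypePiEquivPi
      (p := fun (i : Fin 3) (n : Fin (p + q + r)) => sector p q n = i)), Fintype.card_pi]
    simp only [card_sector]
    rw [Fin.prod_univ_three]
    rfl
  · obtain ⟨t, ht, rfl⟩ := exists_eq_tripleTree hc T
    exact ⟨⟨t, ht⟩, rfl⟩

end Wheel

section cohomology
variable (B : BlackGraph) (b : B.V)

theorem BlackGraph.finrank_H_add {i : ℚ} (hΨ : B.Psi b i (i + 1) ∘ₗ B.Psi b (i - 1) i = 0) :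
    Module.finrank (B.K b) (B.H b i) + Module.finrank (B.K b) (LinearMap.range (B.Psi b (i - 1) i)) =
      Module.finrank (B.K b) (LinearMap.ker (B.Psi b i (i + 1))) := by
  rw [← Submodule.finrank_quotient_add_finrank
    ((LinearMap.range (B.Psi b (i - 1) i)).comap (LinearMap.ker (B.Psi b i (i + 1))).subtype),
    (Submodule.comapSubtypeEquivOfLe (LinearMap.range_le_ker_iff.2 hΨ)).finrank_eq]

theorem BlackGraph.finrank_range_add {i j : ℚ} :
    Module.finrank (B.K b) (LinearMap.range (B.Psi b i j)) +
      Module.finrank (B.K b) (LinearMap.ker (B.Psi b i j)) = Fintype.card (B.Tree i) := by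
  rw [LinearMap.finrank_range_add_finrank_ker, Module.finrank_fintype_fun_eq_card]

end cohomology
end BOS

/-! ### The cohomology of the wheels with sectors of lengths 3, 3, k -/

namespace BOS
namespace Wheel

section general
variable {p q r : ℕ} {h : 0 < p + q + r} {c d : ℚ}

/-- In each component the four coefficients add up to zero. -/
theorem Psi_const (b : (graph h).V) (hc : c = 1) (hd : d = 2) :
    (graph h).Psi b c d (fun _ => 1) = 0 := by
  funext T
  obtain ⟨m, m', hm, rfl⟩ := exists_eq_pairTree hd T
  rw [Psi_pairTree b hc hd _ hm rfl]
  have two : (2 : (graph h).K b) = 0 := CharTwo.two_eq_zero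
  simp only [mul_one, Pi.zero_apply]
  generalize 1 / (1 + sectorVar h b (sector p q m)) = x1
  generalize 1 / (1 + sectorVar h b (sector p q m + 1) * sectorVar h b (sector p q m + 2)) = x2
  generalize 1 / (1 + arcWeight h b m m') = x3
  generalize 1 / (1 + arcWeight h b m' m) = x4
  linear_combination (1 + x1 + x2 + x3 + x4) * two

open Classical in
/-- A functional that vanishes on the image of `Ψ` is orthogonal to the rows of `Ψ`. -/
theorem sum_coeff_eq_zero (b : (graph h).V) {f : (graph h).C b d →ₗ[(graph h).K b] (graph h).K b}
    (hf : LinearMap.range ((graph h).Psi b c d) ≤ LinearMap.ker f) (T : (graph h).Tree c) :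
    ∑ T' : (graph h).Tree d, f (Pi.single T' 1) * (graph h).coeff b T.1 T'.1 = 0 := by
  have h1 : f ((graph h).Psi b c d (Pi.single T 1)) = 0 := hf ⟨_, rfl⟩
  have h2 : (graph h).Psi b c d (Pi.single T 1) = fun T' => (graph h).coeff b T.1 T'.1 := by
    funext T'
    rw [BlackGraph.Psi_apply, Finset.sum_eq_single T]
    · simp
    · intro U _ hU; simp [hU]
    · exact fun hT => absurd (Finset.mem_univ _) hT
  rw [h2, pi_eq_sum_univ (fun T' : (graph h).Tree d => (graph h).coeff b T.1 T'.1), map_sum] at h1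
  rw [← h1]
  refine Finset.sum_congr rfl fun T' _ => ?_
  rw [map_smul, smul_eq_mul, mul_comm]
  congr 2
  funext U
  simp [Pi.single_apply, eq_comm]

end general

/-- The edges of the circle in the sector `0`. -/
def edge₀ (k : ℕ) (i : Fin 3) : Fin (3 + 3 + k) := ⟨i, by omega⟩

/-- The edges of the circle in the sector `1`. -/
def edge₁ (k : ℕ) (j : Fin 3) : Fin (3 + 3 + k) := ⟨3 + j, by omega⟩

variable {k : ℕ} {h : 0 < 3 + 3 + k} {c d : ℚ}

theorem sector_edge₀ (i : Fin 3) : sector 3 3 (edge₀ k i) = 0 := by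
  simp [sector, edge₀]

theorem sector_edge₁ (j : Fin 3) : sector 3 3 (edge₁ k j) = 1 := by
  have := j.2
  unfold sector edge₁
  rw [if_neg (by simp), if_pos (by simp; omega)]

theorem edge₀_injective : Function.Injective (edge₀ k) := fun i j hij => by
  simpa [edge₀, Fin.ext_iff] using hij

theorem edge₁_injective : Function.Injective (edge₁ k) := fun i j hij => by
  simpa [edge₁, Fin.ext_iff] using hij

theorem exists_edge₀ {n : Fin (3 + 3 + k)} (hn : sector 3 3 n = 0) : ∃ i, edge₀ k i = n := by
  have : (n : ℕ) < 3 := by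
    by_contra h3
    unfold sector at hn
    rw [if_neg h3] at hn
    split_ifs at hn <;> simp at hn
  exact ⟨⟨n, this⟩, rfl⟩

theorem exists_edge₁ {n : Fin (3 + 3 + k)} (hn : sector 3 3 n = 1) : ∃ j, edge₁ k j = n := by
  unfold sector at hn
  split_ifs at hn with h1 h2
  · simp at hn
  · exact ⟨⟨n - 3, by omega⟩, Fin.ext (by simp [edge₁]; omega)⟩
  · simp at hn

theorem edge₀_lt_edge₁ (i j : Fin 3) : edge₀ k i < edge₁ k j :=
  lt_of_sector_lt (by rw [sector_edge₀, sector_edge₁]; decide)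

theorem edge₀_lt {n : Fin (3 + 3 + k)} (hn : sector 3 3 n = 2) (i : Fin 3) : edge₀ k i < n :=
  lt_of_sector_lt (by rw [sector_edge₀, hn]; decide)

theorem edge₁_lt {n : Fin (3 + 3 + k)} (hn : sector 3 3 n = 2) (i : Fin 3) : edge₁ k i < n :=
  lt_of_sector_lt (by rw [sector_edge₁, hn]; decide)

/-- The cocycles in degree `1` are the constant functions. -/
theorem ker_Psi_one (b : (graph h).V) (hc : c = 1) (hd : d = 2) {u : (graph h).C b c}
    (hu : (graph h).Psi b c d u = 0) : ∃ x, u = fun _ => x := by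
  have sv : ∀ i, sectorVar h b i ≠ 1 := fun i => by
    simpa using prod_sectorVar_ne_one h b (Φ := {i}) (by simp)
  have sv2 : ∀ i j, i ≠ j → sectorVar h b i * sectorVar h b j ≠ 1 := fun i j hij => by
    simpa [Finset.prod_pair hij] using prod_sectorVar_ne_one h b (Φ := {i, j}) (by simp)
  have sv3 : sectorVar h b 0 * sectorVar h b 1 * sectorVar h b 2 ≠ 1 := by
    simpa [Fin.prod_univ_three] using prod_sectorVar_ne_one h b (Φ := Finset.univ) (by simp)
  have inj : ∀ e : Fin 3 → Fin (3 + 3 + k), Function.Injective e →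
      Function.Injective fun i => partialWeight h b (e i) := fun e he i j hij => by
    by_contra hne
    exact partialWeight_ne b (fun hh => hne (he hh)) hij
  have s01 : ∀ i j, sector 3 3 (edge₀ k i) ≠ sector 3 3 (edge₁ k j) := fun i j => by
    rw [sector_edge₀, sector_edge₁]; decide
  have e01 : ∀ i j, (graph h).Psi b c d u (pairTree h hd (s01 i j)) = 0 := fun i j => by
    rw [hu]; rfl
  have e10 : ∀ i j, (graph h).Psi b c d u (pairTree h hd (s01 i j).symm) = 0 := fun i j => by
    rw [hu]; rfl
  obtain ⟨x, hx⟩ := cocycle_constant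
    (y := fun i => partialWeight h b (edge₀ k i)) (z := fun j => partialWeight h b (edge₁ k j))
    (P := circleWeight h b) (A₀ := sectorVar h b 0) (A₁ := sectorVar h b 1) (A₂ := sectorVar h b 2)
    (a := fun s i => u (singleTree h hc s (edge₀ k i)))
    (b := fun s j => u (singleTree h hc s (edge₁ k j)))
    (inj _ edge₀_injective) (fun _ => partialWeight_ne_zero b _)
    (inj _ edge₁_injective) (fun _ => partialWeight_ne_zero b _)
    (circleWeight_ne_zero b) (circleWeight_ne_one b)
    (sectorVar_ne_zero h b 0) (sectorVar_ne_zero h b 1) (sectorVar_ne_zero h b 2)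
    (sv 0) (sv 1) (sv 2) (sv2 1 2 (by decide)) (sv2 2 0 (by decide)) sv3
    (fun i j => partialWeight_ne b (edge₀_lt_edge₁ i j).ne')
    (fun i j => circleWeight_mul_partialWeight_ne b (edge₀_lt_edge₁ i j))
    (esym₃_partialWeight_ne b _ _) (discriminant_ne_zero b _ _)
    (fun i j => by
      rw [← e01 i j, Psi_pairTree b hc hd u (s01 i j) (sector_edge₀ i),
        arcWeight_of_lt b (edge₀_lt_edge₁ i j), arcWeight_of_gt b (edge₀_lt_edge₁ i j)]
      rfl)
    (fun i j => by
      rw [← e10 i j, Psi_pairTree b hc hd u (s01 i j).symm (sector_edge₁ j),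
        arcWeight_of_lt b (edge₀_lt_edge₁ i j), arcWeight_of_gt b (edge₀_lt_edge₁ i j)]
      simp only [show (1 : Fin 3) + 1 = 2 from rfl, show (1 : Fin 3) + 2 = 0 from rfl]
      ring)
  -- Subtracting the constant leaves a cocycle that vanishes except, possibly, in the sector `2`.
  refine ⟨x, ?_⟩
  have hv : (graph h).Psi b c d (u - x • fun _ => 1) = 0 := by
    rw [map_sub, map_smul, hu, Psi_const b hc hd, smul_zero, sub_zero]
  set v := u - x • fun _ => 1 with hv'
  have v0 : ∀ s i, v (singleTree h hc s (edge₀ k i)) = 0 := fun s i => by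
    have := (hx s i).1
    simp [v, this]
  have v1 : ∀ s i, v (singleTree h hc s (edge₁ k i)) = 0 := fun s i => by
    have := (hx s i).2
    simp [v, this]
  have v2 : ∀ (s : Fin 3) (n : Fin (3 + 3 + k)), sector 3 3 n = 2 → v (singleTree h hc s n) = 0 := by
    intro s n hn
    have s02 : ∀ i, sector 3 3 (edge₀ k i) ≠ sector 3 3 n := fun i => by
      rw [sector_edge₀, hn]; decide
    have s12 : ∀ i, sector 3 3 (edge₁ k i) ≠ sector 3 3 n := fun i => by
      rw [sector_edge₁, hn]; decide
    have f0 := cocycle_vanishes (y := fun i => partialWeight h b (edge₀ k i))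
      (x := partialWeight h b n) (P := circleWeight h b) (A := sectorVar h b 0)
      (a := v (singleTree h hc 0 n)) (b := v (singleTree h hc 1 n))
      (inj _ edge₀_injective) (fun _ => partialWeight_ne_zero b _) (partialWeight_ne_zero b n)
      (sv 0) (circleWeight_ne_one b) (fun i => partialWeight_ne b (edge₀_lt hn i).ne')
      (fun i => circleWeight_mul_partialWeight_ne b (edge₀_lt hn i)) (fun i => by
        have := congrFun hv (pairTree h hd (s02 i))
        rw [Psi_pairTree b hc hd v (s02 i) (sector_edge₀ i), arcWeight_of_lt b (edge₀_lt hn i),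
          arcWeight_of_gt b (edge₀_lt hn i), v0, v0] at this
        simp only [mul_zero, add_zero, zero_add, Pi.zero_apply] at this
        exact this)
    have f1 := cocycle_vanishes (y := fun i => partialWeight h b (edge₁ k i))
      (x := partialWeight h b n) (P := circleWeight h b) (A := sectorVar h b 1)
      (a := v (singleTree h hc 1 n)) (b := v (singleTree h hc 2 n))
      (inj _ edge₁_injective) (fun _ => partialWeight_ne_zero b _) (partialWeight_ne_zero b n)
      (sv 1) (circleWeight_ne_one b) (fun i => partialWeight_ne b (edge₁_lt hn i).ne')
      (fun i => circleWeight_mul_partialWeight_ne b (edge₁_lt hn i)) (fun i => by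
        have := congrFun hv (pairTree h hd (s12 i))
        rw [Psi_pairTree b hc hd v (s12 i) (sector_edge₁ i), arcWeight_of_lt b (edge₁_lt hn i),
          arcWeight_of_gt b (edge₁_lt hn i), v1, v1] at this
        simp only [mul_zero, add_zero, zero_add, Pi.zero_apply] at this
        exact this)
    -- `f0` and `f1` concern the spokes at the ends of the sectors `0` and `1`.
    fin_cases s
    · exact f0.1
    · exact f0.2
    · exact f1.2
  have hv0 : v = 0 := by
    funext T
    obtain ⟨s, n, rfl⟩ := exists_eq_singleTree hc T
    have h3 : ∀ i : Fin 3, i = 0 ∨ i = 1 ∨ i = 2 := by decide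
    rcases h3 (sector 3 3 n) with hn | hn | hn
    · obtain ⟨i, rfl⟩ := exists_edge₀ hn
      exact v0 s i
    · obtain ⟨i, rfl⟩ := exists_edge₁ hn
      exact v1 s i
    · exact v2 s n hn
  rw [hv0] at hv'
  rw [sub_eq_zero.1 hv'.symm]
  funext T
  simp

theorem sector_edges {n : Fin (3 + 3 + k)} (hn : sector 3 3 n = 2) (i j l : Fin 3) :
    sector 3 3 ((![edge₀ k i, edge₁ k j, n] : Fin 3 → Fin (3 + 3 + k)) l) = l := by
  fin_cases l
  · exact sector_edge₀ i
  · exact sector_edge₁ j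
  · exact hn

/-- `Ψ` is surjective onto the highest degree: a functional that vanishes on the image is zero, by
`eq_zero_of_orthogonal`, applied for each edge of the sector `2`. -/
theorem range_Psi_two (b : (graph h).V) (hc : c = 2) (hd : d = 3) :
    LinearMap.range ((graph h).Psi b c d) = ⊤ := by
  classical
  by_contra htop
  obtain ⟨f, hf0, hf⟩ := Submodule.exists_le_ker_of_lt_top _ (lt_top_iff_ne_top.2 htop)
  have orth := sum_coeff_eq_zero b hf
  have sv : ∀ i, sectorVar h b i ≠ 1 := fun i => by
    simpa using prod_sectorVar_ne_one h b (Φ := {i}) (by simp)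
  have inj : ∀ e : Fin 3 → Fin (3 + 3 + k), Function.Injective e →
      Function.Injective fun i => partialWeight h b (e i) := fun e he i j hij => by
    by_contra hne
    exact partialWeight_ne b (fun hh => hne (he hh)) hij
  refine hf0 (LinearMap.pi_ext' fun T => LinearMap.ext_ring ?_)
  change f (Pi.single T 1) = 0
  obtain ⟨t, ht, rfl⟩ := exists_eq_tripleTree hd T
  obtain ⟨i₀, hi₀⟩ := exists_edge₀ (ht 0)
  obtain ⟨j₀, hj₀⟩ := exists_edge₁ (ht 1)
  have hn := ht 2
  set n := t 2
  let E : Fin 3 → Fin 3 → (graph h).Tree d := fun i j => tripleTree h hd (sector_edges hn i j)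
  have hE : ∀ i j i' j', E i j = E i' j' → i = i' ∧ j = j' := fun i j i' j' he => by
    have := tripleTree_injective hd _ _ he
    exact ⟨edge₀_injective (congrFun this 0), edge₁_injective (congrFun this 1)⟩
  have hE' : ∀ (u : Fin 3 → Fin (3 + 3 + k)) (hu : ∀ i, sector 3 3 (u i) = i) (i j : Fin 3),
      u 0 = edge₀ k i → u 1 = edge₁ k j → u 2 = n → E i j = tripleTree h hd hu := by
    intro u hu i j h0 h1 h2
    obtain rfl : u = ![edge₀ k i, edge₁ k j, n] := by
      funext l
      fin_cases l <;> assumption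
    rfl
  have hT : E i₀ j₀ = tripleTree h hd ht := hE' t ht i₀ j₀ hi₀.symm hj₀.symm rfl
  rw [← hT]
  -- The sums over the triples that contain a given pair of edges.
  have sum₁ : ∀ (i : Fin 3) (T : (graph h).Tree c),
      (∀ (u : Fin 3 → Fin (3 + 3 + k)) (hu : ∀ i, sector 3 3 (u i) = i),
        ¬ (u 0 = edge₀ k i ∧ u 2 = n) → (graph h).coeff b T.1 (tripleTree h hd hu).1 = 0) →
      ∑ j, f (Pi.single (E i j) 1) * (graph h).coeff b T.1 (E i j).1 = 0 := by
    intro i T hTu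
    rw [← orth T]
    refine Fintype.sum_of_injective (E i) (fun j j' hj => (hE _ _ _ _ hj).2) _ _ ?_ fun _ => rfl
    intro T' hT'
    obtain ⟨u, hu, rfl⟩ := exists_eq_tripleTree hd T'
    rw [hTu u hu, mul_zero]
    rintro ⟨h0, h2⟩
    obtain ⟨j, hj⟩ := exists_edge₁ (hu 1)
    exact hT' ⟨j, hE' u hu i j h0 hj.symm h2⟩
  have sum₀ : ∀ (j : Fin 3) (T : (graph h).Tree c),
      (∀ (u : Fin 3 → Fin (3 + 3 + k)) (hu : ∀ i, sector 3 3 (u i) = i),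
        ¬ (u 1 = edge₁ k j ∧ u 2 = n) → (graph h).coeff b T.1 (tripleTree h hd hu).1 = 0) →
      ∑ i, f (Pi.single (E i j) 1) * (graph h).coeff b T.1 (E i j).1 = 0 := by
    intro j T hTu
    rw [← orth T]
    refine Fintype.sum_of_injective (fun i => E i j) (fun i i' hi => (hE _ _ _ _ hi).1) _ _ ?_
      fun _ => rfl
    intro T' hT'
    obtain ⟨u, hu, rfl⟩ := exists_eq_tripleTree hd T'
    rw [hTu u hu, mul_zero]
    rintro ⟨h0, h2⟩
    obtain ⟨i, hi⟩ := exists_edge₀ (hu 0)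
    exact hT' ⟨i, hE' u hu i j hi.symm h0 h2⟩
  have y0 := fun i => partialWeight_ne_zero b (edge₀ k i)
  have z0 := fun j => partialWeight_ne_zero b (edge₁ k j)
  have x0 := partialWeight_ne_zero b n
  refine eq_zero_of_orthogonal (W := fun i j => f (Pi.single (E i j) 1))
    (y := fun i => partialWeight h b (edge₀ k i)) (z := fun j => partialWeight h b (edge₁ k j))
    (x := partialWeight h b n) (P := circleWeight h b) (A := sectorVar h b 0) (B := sectorVar h b 1)
    (inj _ edge₀_injective) y0 (inj _ edge₁_injective) z0 x0 (circleWeight_ne_zero b)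
    (sectorVar_ne_zero h b 1) (sv 0) (sv 1)
    (fun i j => partialWeight_ne b (edge₀_lt_edge₁ i j).ne')
    (fun i => partialWeight_ne b (edge₀_lt hn i).ne')
    (fun j => partialWeight_ne b (edge₁_lt hn j).ne')
    (fun i => circleWeight_mul_partialWeight_ne b (edge₀_lt hn i))
    (fun j => circleWeight_mul_partialWeight_ne b (edge₁_lt hn j))
    (esym₃_partialWeight_ne b _ _) (fun i => ?_) (fun i => ?_) (fun j => ?_) (fun j => ?_) i₀ j₀
  · have hm : sector 3 3 (edge₀ k i) ≠ sector 3 3 n := by rw [sector_edge₀, hn]; decide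
    refine Eq.trans (Finset.sum_congr rfl fun j _ => ?_) (sum₁ i (pairTree h hc hm) ?_)
    · rw [← arcWeight_of_lt b (edge₁_lt hn j)]
      exact congrArg _ (coeff_pairTree_skip (sector_edges hn i j) b hc hd 0 hm).symm
    · intro u hu hne
      refine coeff_pair_eq_zero b hu fun hh => hne ?_
      rwa [sector_edge₀, hn] at hh
  · have hm : sector 3 3 n ≠ sector 3 3 (edge₀ k i) := by rw [sector_edge₀, hn]; decide
    refine Eq.trans (Finset.sum_congr rfl fun j _ => ?_) (sum₁ i (pairTree h hc hm) ?_)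
    · rw [← arcWeight_of_lt b (edge₀_lt_edge₁ i j)]
      exact congrArg _ (coeff_pairTree_next (sector_edges hn i j) b hc hd 2 hm).symm
    · intro u hu hne
      refine coeff_pair_eq_zero b hu fun hh => hne ?_
      rw [sector_edge₀, hn] at hh
      exact hh.symm
  · have hm : sector 3 3 (edge₁ k j) ≠ sector 3 3 n := by rw [sector_edge₁, hn]; decide
    refine Eq.trans (Finset.sum_congr rfl fun i _ => ?_) (sum₀ j (pairTree h hc hm) ?_)
    · rw [← arcWeight_of_gt b (edge₀_lt hn i)]
      exact congrArg _ (coeff_pairTree_next (sector_edges hn i j) b hc hd 1 hm).symm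
    · intro u hu hne
      refine coeff_pair_eq_zero b hu fun hh => hne ?_
      rwa [sector_edge₁, hn] at hh
  · have hm : sector 3 3 n ≠ sector 3 3 (edge₁ k j) := by rw [sector_edge₁, hn]; decide
    refine Eq.trans (Finset.sum_congr rfl fun i _ => ?_) (sum₀ j (pairTree h hc hm) ?_)
    · rw [← arcWeight_of_lt b (edge₀_lt_edge₁ i j)]
      exact congrArg _ (coeff_pairTree_skip (sector_edges hn i j) b hc hd 2 hm).symm
    · intro u hu hne
      refine coeff_pair_eq_zero b hu fun hh => hne ?_
      rw [sector_edge₁, hn] at hh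
      exact hh.symm

end Wheel

open Wheel

/-- `Ψ ∘ Ψ = 0` in all degrees. -/
theorem Wheel.Psi_comp_Psi_eq_zero {p q r : ℕ} (h : 0 < p + q + r) (b : (graph h).V) {c d e : ℚ}
    (hd : d = c + 1) (he : e = d + 1) : (graph h).Psi b d e ∘ₗ (graph h).Psi b c d = 0 := by
  by_cases hc : c = 1
  · exact Psi_comp_Psi b hc (by rw [hd, hc]; norm_num) (by rw [he, hd, hc]; norm_num)
  by_cases hc' : c = 2 ∨ c = 3
  · have : IsEmpty ((graph h).Tree e) := by
      refine isEmpty_tree ?_ ?_ ?_ <;> rcases hc' with rfl | rfl <;> rw [he, hd] <;> norm_num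
    exact LinearMap.ext fun u => Subsingleton.elim _ _
  · have : IsEmpty ((graph h).Tree c) :=
      isEmpty_tree hc (fun hh => hc' (Or.inl hh)) (fun hh => hc' (Or.inr hh))
    refine LinearMap.ext fun u => ?_
    rw [Subsingleton.elim u 0, map_zero, map_zero]

theorem Wheel.finrank_H {k : ℕ} (h : 0 < 3 + 3 + k) (b : (graph h).V) (i : ℚ) :
    Module.finrank ((graph h).K b) ((graph h).H b i) = if i = 1 ∨ i = 2 then 1 else 0 := by
  have hadd := (graph h).finrank_H_add b (i := i)
    (Psi_comp_Psi_eq_zero h b (c := i - 1) (d := i) (e := i + 1) (by ring) rfl)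
  have rank_one : ∀ c d : ℚ, c = 1 → d = 2 →
      Module.finrank ((graph h).K b) (LinearMap.ker ((graph h).Psi b c d)) = 1 := by
    intro c d hc hd
    have h1 : LinearMap.ker ((graph h).Psi b c d) = Submodule.span _ {fun _ => 1} := by
      refine le_antisymm (fun u hu => ?_) ?_
      · obtain ⟨x, rfl⟩ := ker_Psi_one b hc hd hu
        refine Submodule.mem_span_singleton.2 ⟨x, ?_⟩
        funext T
        simp
      · rw [Submodule.span_singleton_le_iff_mem]
        exact Psi_const b hc hd
    rw [h1]
    refine finrank_span_singleton fun h0 => ?_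
    exact one_ne_zero (congrFun h0 (singleTree h hc 0 ⟨0, h⟩))
  have rank_two : ∀ c d : ℚ, c = 2 → d = 3 →
      Module.finrank ((graph h).K b) (LinearMap.range ((graph h).Psi b c d)) = 9 * k := by
    intro c d hc hd
    rw [range_Psi_two b hc hd, finrank_top, Module.finrank_fintype_fun_eq_card, card_tree_three hd]
  -- Rank counts, with `3 (6 + k)`, `18 + 12 k` and `9 k` spanning trees in the degrees `1, 2, 3`.
  by_cases h1 : i = 1
  · rw [if_pos (Or.inl h1)]
    have := (graph h).finrank_range_add b (i := i - 1) (j := i)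
    have h0 : Fintype.card ((graph h).Tree (i - 1)) = 0 := by
      rw [Fintype.card_eq_zero_iff]
      refine isEmpty_tree ?_ ?_ ?_ <;> rw [h1] <;> norm_num
    have := rank_one i (i + 1) h1 (by rw [h1]; norm_num)
    omega
  by_cases h2 : i = 2
  · rw [if_pos (Or.inr h2)]
    have e1 := (graph h).finrank_range_add b (i := i - 1) (j := i)
    have e2 := (graph h).finrank_range_add b (i := i) (j := i + 1)
    rw [card_tree_one (by rw [h2]; norm_num), rank_one _ _ (by rw [h2]; norm_num) h2] at e1
    rw [card_tree_two h2, rank_two _ _ h2 (by rw [h2]; norm_num)] at e2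
    omega
  rw [if_neg (by tauto)]
  have e2 := (graph h).finrank_range_add b (i := i) (j := i + 1)
  by_cases h3 : i = 3
  · rw [rank_two _ _ (by rw [h3]; norm_num) h3] at hadd
    rw [card_tree_three h3] at e2
    omega
  · have h0 : Fintype.card ((graph h).Tree i) = 0 := by
      rw [Fintype.card_eq_zero_iff]
      exact isEmpty_tree h1 h2 h3
    omega

end BOS

theorem proposition4p1 (k : ℕ) (b : (BOS.blackGraph33 k).V) :
    (∀ i : ℚ, (BOS.blackGraph33 k).Psi b (i + 1) (i + 1 + 1) ∘ₗ
      (BOS.blackGraph33 k).Psi b i (i + 1) = 0) ∧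
    ∀ i : ℚ, Module.finrank ((BOS.blackGraph33 k).K b) ((BOS.blackGraph33 k).H b i) =
      if i = 1 ∨ i = 2 then 1 else 0 :=
  ⟨fun _ => BOS.Wheel.Psi_comp_Psi_eq_zero _ b rfl rfl, BOS.Wheel.finrank_H _ b⟩

end
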